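/- Let $\Pi$ be a Poisson point process on $\mathbb{R}_+\times[0,1]^2$ with intensity $\mathrm{d}t\otimes\mathrm{d}x\,\mathrm{d}y$, and let $((\tau_i,x_i,y_i))_{i\ge 1}$ be its atoms, ranked in increasing order of $\tau_i$. Let $\mathrm{Quad}(0)=\{[0,1]^2\}$; at each time $\tau_i$ the rectangle whose interior contains $(x_i,y_i)$ is replaced by the four closed subrectangles into which it is cut by the vertical and the horizontal line through $(x_i,y_i)$. This defines a.s. a process $(\mathrm{Quad}(t))_{t\ge 0}$ of finite coverings of $[0,1]^2$ by closed rectangles with disjoint interiors. The unit square has generation $0$, and the four parts of a rectangle of generation $n$ have generation $n+1$. Let $\mathcal{F}_t$ be the $\sigma$-field generated by $(\mathrm{Quad}(u))_{0\le u\le t}$, let $\lambda$ be the Lebesgue measure on $[0,1]^2$, and put $\beta=\frac{\sqrt{17}-3}{2}$ and $h(u)=(u(1-u))^{\beta/2}$ for $u\in[0,1]$. A rectangle $R=[\ell,r]\times[b,c]$ is above $x\in[0,1]$ if $\ell\le x\le r$; the position of $x$ in it is then $x_R=\frac{x-\ell}{r-\ell}$. Set $$M_t(x)=\sum_{R\in\mathrm{Quad}(t),\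 R\text{ above }x}\lambda(R)^\beta h(x_R),\qquad \tilde M_n(x)=\sum_{R}\lambda(R)^\beta h(x_R),$$ where the second sum runs over all rectangles $R$ of generation $n$ above $x$ that appear in the process. Then for every $x\in[0,1]$ the process $(M_t(x))_{t\ge 0}$ is a non-negative continuous-time martingale with respect to $(\mathcal{F}_t)_{t\ge0}$. Moreover there is a random variable $\tilde M_\infty(x)$, belonging to $L^p$ for every $p\in(1,\infty)$, such that $\tilde M_n(x)\to\tilde M_\infty(x)$ as $n\to\infty$, almost surely and in $L^p$ for every $p\in(1,\infty)$, such that $M_t(x)=E[\tilde M_\infty(x)\mid\mathcal{F}_t]$ a.s. for every $t\ge0$, and such that $M_t(x)\to\tilde M_\infty(x)$ as $t\to\infty$, almost surely and in $L^p$ for every $p\in(1,\infty)$. -/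

import Mathlib

open MeasureTheory ProbabilityTheory Filter Topology
open scoped NNReal ENNReal

/-- `N` is a Poisson point process (Poisson random measure) with intensity `μ` under `P`: the
number of points in a Borel set of finite `μ`-measure is Poisson with mean this measure, and the
numbers of points in finitely many pairwise disjoint Borel sets are independent. -/
structure IsPoissonPointProcess {Ω E : Type*} [MeasurableSpace Ω] [MeasurableSpace E]
    (N : Ω → Measure E) (μ : Measure E) (P : Measure Ω) : Prop where
  measurable : Measurable N
  law : ∀ B : Set E, MeasurableSet B → ∀ r : ℝ≥0, μ B = r →
    P.map (fun ω => N ω B) = (poissonMeasure r).map (fun k : ℕ => (k : ℝ≥0∞))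
  indep : ∀ (n : ℕ) (B : Fin n → Set E), (∀ i, MeasurableSet (B i)) →
    Pairwise (Function.onFun Disjoint B) → iIndepFun (fun i ω => N ω (B i)) P

namespace Quadtree

noncomputable section

/-- The intensity `dt ⊗ dx dy` on `ℝ₊ × [0,1]²`. -/
def intensity : Measure (ℝ × ℝ × ℝ) :=
  volume.restrict (Set.Ici 0 ×ˢ (Set.Icc 0 1 ×ˢ Set.Icc 0 1))

/-- A rectangle `[left, right] × [bottom, top]` with sides parallel to the axes. -/
@[ext]
structure Rect where
  left : ℝ
  right : ℝ
  bottom : ℝ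
  top : ℝ

/-- The Borel σ-algebra of `ℝ⁴`, carried over to the space of rectangles. -/
instance : MeasurableSpace Rect :=
  MeasurableSpace.comap (fun R => (R.left, R.right, R.bottom, R.top)) inferInstance

/-- The points of the closed rectangle. -/
def Rect.carrier (R : Rect) : Set (ℝ × ℝ) :=
  Set.Icc R.left R.right ×ˢ Set.Icc R.bottom R.top

/-- The unit square `[0,1]²`. -/
def unitSquare : Rect := ⟨0, 1, 0, 1⟩

/-- The four subrectangles cut out by the vertical and the horizontal line through `p`, in
counter-clockwise order starting with the north-east one. -/
def Rect.split (R : Rect) (p : ℝ × ℝ) : Fin 4 → Rect :=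
  ![⟨p.1, R.right, p.2, R.top⟩,
    ⟨R.left, p.1, p.2, R.top⟩,
    ⟨R.left, p.1, R.bottom, p.2⟩,
    ⟨p.1, R.right, R.bottom, p.2⟩]

/-- A rectangle together with the word over a four-letter alphabet that encodes it. -/
abbrev Cell : Type := List (Fin 4) × Rect

open Classical in
/-- The effect of the point `p` on one encoded rectangle: if `p` lies in its interior, the
rectangle is replaced by its four subrectangles (the word `u` being replaced by `u1,…,u4`);
otherwise it is kept. -/
def Cell.step (p : ℝ × ℝ) (c : Cell) : Finset Cell :=
  if p ∈ interior c.2.carrier then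
    Finset.univ.image (fun j : Fin 4 => (c.1 ++ [j], c.2.split p j))
  else {c}

open Classical in
/-- The encoded rectangles of the quadtree after the insertion of the first `k` of the
points `p 0, p 1, …`. -/
def cellsAfter (p : ℕ → ℝ × ℝ) : ℕ → Finset Cell
  | 0 => {([], unitSquare)}
  | k + 1 => (cellsAfter p k).biUnion (Cell.step (p k))

/-- The number of the times `τ 0, τ 1, …` that are at most `t`. -/
def numAtoms (τ : ℕ → ℝ) (t : ℝ≥0) : ℕ := {i | τ i ≤ t}.ncard

open Classical in
/-- The covering `Quad(t)` of the unit square, for atoms `(τ i, p i)` ranked by `τ`. -/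
def quad (τ : ℕ → ℝ) (p : ℕ → ℝ × ℝ) (t : ℝ≥0) : Finset Rect :=
  (cellsAfter p (numAtoms τ t)).image Prod.snd

open Classical in
/-- The σ-algebra on finite sets of rectangles generated by the numbers of elements in Borel
sets of rectangles. -/
@[reducible] def rectFinsetSigma : MeasurableSpace (Finset Rect) :=
  ⨆ B : {B : Set Rect // MeasurableSet B},
    MeasurableSpace.comap (fun s => (s.filter (· ∈ B.1)).card) ⊤

/-- The σ-field generated by `(Quad(u))_{0 ≤ u ≤ t}`. -/
@[reducible] def history {Ω : Type*} (τ : ℕ → Ω → ℝ) (p : ℕ → Ω → ℝ × ℝ) (t : ℝ≥0) : MeasurableSpace Ω :=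
  ⨆ u : {u : ℝ≥0 // u ≤ t},
    MeasurableSpace.comap (fun ω => quad (fun i => τ i ω) (fun i => p i ω) u.1) rectFinsetSigma

/-- The exponent `β = (√17 - 3)/2`. -/
def beta : ℝ := (Real.sqrt 17 - 3) / 2

/-- The function `h(u) = (u(1-u))^{β/2}`. -/
def h (u : ℝ) : ℝ := (u * (1 - u)) ^ (beta / 2)

/-- The rectangle is above `x`: its horizontal side contains `x`. -/
def Rect.IsAbove (R : Rect) (x : ℝ) : Prop := x ∈ Set.Icc R.left R.right

/-- The position of `x` relative to the horizontal side of the rectangle. -/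
def Rect.position (R : Rect) (x : ℝ) : ℝ := (x - R.left) / (R.right - R.left)

/-- The weight `λ(R)^β h(position of x in R)`, with `λ` the Lebesgue measure. -/
def Rect.weight (R : Rect) (x : ℝ) : ℝ :=
  (volume R.carrier).toReal ^ beta * h (R.position x)

open Classical in
/-- `M_t(x)`: the sum of the weights of the rectangles of `Quad(t)` above `x`. -/
def M (τ : ℕ → ℝ) (p : ℕ → ℝ × ℝ) (x : ℝ) (t : ℝ≥0) : ℝ :=
  ∑ R ∈ (quad τ p t).filter (fun R => R.IsAbove x), R.weight x

/-- The encoded rectangles of generation `n` above `x` that appear in the quadtree process. -/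
def generationAbove (p : ℕ → ℝ × ℝ) (x : ℝ) (n : ℕ) : Set Cell :=
  {c | (∃ k, c ∈ cellsAfter p k) ∧ c.1.length = n ∧ c.2.IsAbove x}

/-- The sum of the weights of the rectangles of generation `n` above `x`; at most one rectangle
is encoded by each word, so that the sum is finite. -/
def Mgen (p : ℕ → ℝ × ℝ) (x : ℝ) (n : ℕ) : ℝ :=
  ∑ᶠ c ∈ generationAbove p x n, c.2.weight x

end

end Quadtree

/-!
Insert the marks one at a time. Splitting a rectangle at a uniform point preserves on average the
sum of `λ(R)^β h(x_R)` over the rectangles above `x`: the mean over the parts is an eigenvalue times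
the weight of the rectangle, and `β` makes this eigenvalue `1`. Hence the total weight is a
martingale in the number of points, and so is the capped weight obtained by splitting only the
rectangles of generation less than `n`. For a small `θ`, the exponential of `θ` times the sum of the
total weights of exponents `β` and `2β` is a supermartingale, since the mean decrease of the latter
absorbs the second-order term of the former; this bounds all the moments and gives convergence
almost surely and in every `L^q`.

Uniform points visit every non-degenerate rectangle infinitely often, so generation `n` is complete
after finitely many insertions, and `Mgen n` is the limit of the capped weights. Its mean square
distance to the limit of the full weight is at most `C ρ^n` with `ρ < 1`, hence summable. Finally,
the marks of the ranked atoms of the Poisson process are independent of the times, so that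
conditioning on the number of atoms up to `t` transfers the martingale property to continuous time.
-/

namespace Quadtree

/-! ### Exponential moments and convergence in `L^q` -/

section ExpMoments

variable {Ω : Type*} [MeasurableSpace Ω] {P : Measure Ω}

lemma lintegral_le_of_ae_tendsto {f : ℕ → Ω → ℝ≥0∞} {g : Ω → ℝ≥0∞} {C : ℝ≥0∞}
    (hf : ∀ n, AEMeasurable (f n) P) (hle : ∀ n, ∫⁻ ω, f n ω ∂P ≤ C)
    (hfg : ∀ᵐ ω ∂P, Tendsto (fun n => f n ω) atTop (𝓝 (g ω))) : ∫⁻ ω, g ω ∂P ≤ C :=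
  calc ∫⁻ ω, g ω ∂P = ∫⁻ ω, liminf (fun n => f n ω) atTop ∂P :=
        lintegral_congr_ae (hfg.mono fun _ hω => hω.liminf_eq.symm)
    _ ≤ liminf (fun n => ∫⁻ ω, f n ω ∂P) atTop := lintegral_liminf_le' hf
    _ ≤ C := liminf_le_of_le (by isBoundedDefault) fun _ hb =>
        let ⟨n, hn⟩ := hb.exists
        hn.trans (hle n)

lemma ae_tendsto_of_tsum_lintegral_sq_sub_ne_top {f : ℕ → Ω → ℝ} {g : Ω → ℝ}
    (hf : ∀ n, AEMeasurable (f n) P) (hg : AEMeasurable g P)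
    (hsum : ∑' n, ∫⁻ ω, ENNReal.ofReal ((g ω - f n ω) ^ 2) ∂P ≠ ∞) :
    ∀ᵐ ω ∂P, Tendsto (fun n => f n ω) atTop (𝓝 (g ω)) := by
  have hmeas : ∀ n, AEMeasurable (fun ω => ENNReal.ofReal ((g ω - f n ω) ^ 2)) P := fun n =>
    ((hg.sub (hf n)).pow_const 2).ennreal_ofReal
  rw [← lintegral_tsum hmeas] at hsum
  filter_upwards [ae_lt_top' (.tsum hmeas) hsum] with ω hω
  have hsq : Tendsto (fun n => (g ω - f n ω) ^ 2) atTop (𝓝 0) := by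
    have := (ENNReal.tendsto_toReal ENNReal.zero_ne_top).comp
      (ENNReal.tendsto_atTop_zero_of_tsum_ne_top hω.ne)
    simpa [Function.comp_def, ENNReal.toReal_ofReal, sq_nonneg] using this
  have hsub : Tendsto (fun n => g ω - f n ω) atTop (𝓝 0) := by
    rw [tendsto_zero_iff_abs_tendsto_zero]
    simpa [Function.comp_def, Real.sqrt_sq_eq_abs] using
      (Real.continuous_sqrt.tendsto 0).comp hsq
  simpa using hsub.const_sub (g ω)

lemma unifIntegrable_of_eLpNorm_le {ι : Type*} {f : ι → Ω → ℝ} {q r : ℝ≥0∞} (hq0 : q ≠ 0)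
    (hqr : q < r) {C : ℝ≥0} (hf : ∀ i, AEStronglyMeasurable (f i) P)
    (hC : ∀ i, eLpNorm (f i) r P ≤ C) : UnifIntegrable f q P := by
  have hexp : 0 < 1 / q.toReal - 1 / r.toReal := by
    have hq := ENNReal.toReal_pos hq0 hqr.ne_top
    rcases eq_or_ne r ∞ with rfl | hr
    · simpa using hq
    · exact sub_pos.2 (one_div_lt_one_div_of_lt hq ((ENNReal.toReal_lt_toReal hqr.ne_top hr).2 hqr))
  set a := 1 / q.toReal - 1 / r.toReal
  intro ε hε
  refine ⟨(ε / (C + 1)) ^ a⁻¹, by positivity, fun i s hs hμs => ?_⟩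
  calc eLpNorm (s.indicator (f i)) q P = eLpNorm (f i) q (P.restrict s) :=
        eLpNorm_indicator_eq_eLpNorm_restrict hs
    _ ≤ eLpNorm (f i) r (P.restrict s) * P.restrict s Set.univ ^ a :=
        eLpNorm_le_eLpNorm_mul_rpow_measure_univ hqr.le (hf i).restrict
    _ ≤ C * ENNReal.ofReal ((ε / (C + 1)) ^ a⁻¹) ^ a := by
        rw [Measure.restrict_apply_univ]
        gcongr
        exact (eLpNorm_mono_measure _ Measure.restrict_le_self).trans (hC i)
    _ = ENNReal.ofReal (C * (ε / (C + 1))) := by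
        rw [ENNReal.ofReal_rpow_of_nonneg (by positivity) hexp.le,
          Real.rpow_inv_rpow (by positivity) hexp.ne', ENNReal.ofReal_mul (by positivity),
          ENNReal.ofReal_coe_nnreal]
    _ ≤ ENNReal.ofReal ε := by
        refine ENNReal.ofReal_le_ofReal ?_
        rw [mul_div_left_comm]
        exact mul_le_of_le_one_right hε.le (div_le_one_of_le₀ (by linarith) (by positivity))

/-- A non-negative random variable whose exponential moment of order `θ` is at most `K`. -/
structure ExpBounded (P : Measure Ω) (θ K : ℝ) (f : Ω → ℝ) : Prop where
  aestronglyMeasurable : AEStronglyMeasurable f P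
  nonneg : ∀ᵐ ω ∂P, 0 ≤ f ω
  lintegral_exp_le : ∫⁻ ω, ENNReal.ofReal (Real.exp (θ * f ω)) ∂P ≤ ENNReal.ofReal K

lemma rpow_le_mul_exp {θ r x : ℝ} (hθ : 0 < θ) (hr : 0 < r) (hx : 0 ≤ x) :
    x ^ r ≤ (r / θ) ^ r * Real.exp (θ * x) :=
  calc x ^ r = (r / θ * (θ * x / r)) ^ r := by field_simp
    _ = (r / θ) ^ r * (θ * x / r) ^ r := Real.mul_rpow (by positivity) (by positivity)
    _ ≤ (r / θ) ^ r * Real.exp (θ * x / r) ^ r := by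
        gcongr
        linarith [Real.add_one_le_exp (θ * x / r)]
    _ = (r / θ) ^ r * Real.exp (θ * x) := by rw [← Real.exp_mul]; field_simp

namespace ExpBounded

variable {θ K : ℝ}

lemma eLpNorm_le (hθ : 0 < θ) {f : Ω → ℝ} (hf : ExpBounded P θ K f) {q : ℝ≥0∞} (hq0 : q ≠ 0)
    (hq : q ≠ ∞) :
    eLpNorm f q P ≤ (ENNReal.ofReal ((q.toReal / θ) ^ q.toReal) * ENNReal.ofReal K) ^
      (1 / q.toReal) := by
  have hr : 0 < q.toReal := ENNReal.toReal_pos hq0 hq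
  rw [eLpNorm_eq_lintegral_rpow_enorm_toReal hq0 hq]
  gcongr
  calc ∫⁻ ω, ‖f ω‖ₑ ^ q.toReal ∂P
      ≤ ∫⁻ ω, ENNReal.ofReal ((q.toReal / θ) ^ q.toReal) *
          ENNReal.ofReal (Real.exp (θ * f ω)) ∂P := by
        refine lintegral_mono_ae (hf.nonneg.mono fun ω hω => ?_)
        rw [Real.enorm_of_nonneg hω, ENNReal.ofReal_rpow_of_nonneg hω hr.le,
          ← ENNReal.ofReal_mul (by positivity)]
        exact ENNReal.ofReal_le_ofReal (rpow_le_mul_exp hθ hr hω)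
    _ = ENNReal.ofReal ((q.toReal / θ) ^ q.toReal) *
          ∫⁻ ω, ENNReal.ofReal (Real.exp (θ * f ω)) ∂P :=
        lintegral_const_mul' _ _ ENNReal.ofReal_ne_top
    _ ≤ _ := by gcongr; exact hf.lintegral_exp_le

lemma exists_eLpNorm_le (hθ : 0 < θ) (K : ℝ) {q : ℝ≥0∞} (hq0 : q ≠ 0) (hq : q ≠ ∞) :
    ∃ C : ℝ≥0, ∀ f, ExpBounded P θ K f → eLpNorm f q P ≤ C := by
  have hfin : (ENNReal.ofReal ((q.toReal / θ) ^ q.toReal) * ENNReal.ofReal K) ^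
      (1 / q.toReal) ≠ ∞ :=
    ENNReal.rpow_ne_top_of_nonneg (by positivity)
      (ENNReal.mul_ne_top ENNReal.ofReal_ne_top ENNReal.ofReal_ne_top)
  refine ⟨_, fun f hf => (hf.eLpNorm_le hθ hq0 hq).trans_eq (ENNReal.coe_toNNReal hfin).symm⟩

lemma memLp (hθ : 0 < θ) {f : Ω → ℝ} (hf : ExpBounded P θ K f) {q : ℝ≥0∞} (hq0 : q ≠ 0)
    (hq : q ≠ ∞) : MemLp f q P :=
  let ⟨_, hC⟩ := exists_eLpNorm_le hθ K hq0 hq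
  ⟨hf.aestronglyMeasurable, (hC f hf).trans_lt ENNReal.coe_lt_top⟩

lemma unifIntegrable {ι : Type*} (hθ : 0 < θ) {f : ι → Ω → ℝ}
    (hf : ∀ i, ExpBounded P θ K (f i)) {q : ℝ≥0∞} (hq0 : q ≠ 0) (hq : q ≠ ∞) :
    UnifIntegrable f q P :=
  let ⟨_, hC⟩ := exists_eLpNorm_le hθ K (add_ne_zero.2 (.inl hq0))
    (ENNReal.add_ne_top.2 ⟨hq, ENNReal.one_ne_top⟩)
  unifIntegrable_of_eLpNorm_le hq0 (ENNReal.lt_add_right hq one_ne_zero)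
    (fun i => (hf i).aestronglyMeasurable) fun i => hC (f i) (hf i)

lemma of_tendsto_ae {f : ℕ → Ω → ℝ} {g : Ω → ℝ} (hf : ∀ n, ExpBounded P θ K (f n))
    (hfg : ∀ᵐ ω ∂P, Tendsto (fun n => f n ω) atTop (𝓝 (g ω))) : ExpBounded P θ K g where
  aestronglyMeasurable :=
    aestronglyMeasurable_of_tendsto_ae atTop (fun n => (hf n).aestronglyMeasurable) hfg
  nonneg := by
    filter_upwards [hfg, ae_all_iff.2 fun n => (hf n).nonneg] with ω hlim hpos
    exact ge_of_tendsto' hlim hpos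
  lintegral_exp_le := by
    refine lintegral_le_of_ae_tendsto (fun n => (Real.measurable_exp.comp_aemeasurable
      ((hf n).aestronglyMeasurable.aemeasurable.const_mul θ)).ennreal_ofReal)
      (fun n => (hf n).lintegral_exp_le) (hfg.mono fun ω hω => ?_)
    exact (ENNReal.continuous_ofReal.tendsto _).comp
      ((Real.continuous_exp.tendsto _).comp (hω.const_mul θ))

lemma tendsto_eLpNorm_sub [IsFiniteMeasure P] {ι : Type*} {l : Filter ι} [l.IsCountablyGenerated]
    (hθ : 0 < θ) {f : ι → Ω → ℝ} {g : Ω → ℝ} (hf : ∀ i, ExpBounded P θ K (f i))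
    (hfg : ∀ᵐ ω ∂P, Tendsto (fun i => f i ω) l (𝓝 (g ω))) {q : ℝ≥0∞} (hq : 1 ≤ q)
    (hq' : q ≠ ∞) : Tendsto (fun i => eLpNorm (f i - g) q P) l (𝓝 0) := by
  refine tendsto_of_seq_tendsto fun u hu => ?_
  have hq0 : q ≠ 0 := (zero_lt_one.trans_le hq).ne'
  have hfu := fun n => hf (u n)
  have hlim : ∀ᵐ ω ∂P, Tendsto (fun n => f (u n) ω) atTop (𝓝 (g ω)) :=
    hfg.mono fun ω hω => hω.comp hu
  exact tendsto_Lp_finite_of_tendsto_ae hq hq' (fun n => (hfu n).aestronglyMeasurable)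
    ((of_tendsto_ae hfu hlim).memLp hθ hq0 hq') (unifIntegrable hθ hfu hq0 hq') hlim

end ExpBounded

end ExpMoments

/-! ### Functionals of independent marks -/

section Resampling

variable {ι E : Type*} [DecidableEq ι] [MeasurableSpace E]

lemma measurable_update_prod (k : ι) :
    Measurable fun y : (ι → E) × E => Function.update y.1 k y.2 := by
  refine measurable_pi_lambda _ fun i => ?_
  rcases eq_or_ne i k with rfl | hik
  · simpa only [Function.update_self] using measurable_snd
  · simpa only [Function.update_of_ne hik] using! (measurable_pi_apply i).comp measurable_fst

lemma measurePreserving_update (ν : Measure E) [IsProbabilityMeasure ν] (k : ι) :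
    MeasurePreserving (fun y : (ι → E) × E => Function.update y.1 k y.2)
      ((Measure.infinitePi fun _ : ι => ν).prod ν) (Measure.infinitePi fun _ : ι => ν) := by
  refine ⟨measurable_update_prod k, Measure.eq_infinitePi _ fun s t ht => ?_⟩
  have hpre : (fun y : (ι → E) × E => Function.update y.1 k y.2) ⁻¹' (Set.pi s t) =
      Set.pi (s.erase k) t ×ˢ (if k ∈ s then t k else Set.univ) := by
    ext ⟨z, q⟩
    simp only [Set.mem_preimage, Set.mem_pi, Finset.mem_coe, Set.mem_prod, Finset.mem_erase]
    constructor
    · refine fun hy => ⟨fun i hi => by simpa [hi.1] using hy i hi.2, ?_⟩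
      split_ifs with hk
      · simpa using hy k hk
      · trivial
    · rintro ⟨hz, hq⟩ i hi
      rcases eq_or_ne i k with rfl | hik
      · simpa [hi] using hq
      · simpa [hik] using hz i ⟨hik, hi⟩
  rw [Measure.map_apply (measurable_update_prod k)
    (.pi s.countable_toSet fun i _ => ht i), hpre, Measure.prod_prod,
    Measure.infinitePi_pi _ fun i _ => ht i]
  split_ifs with hk
  · exact Finset.prod_erase_mul s (fun i => ν (t i)) hk
  · rw [Finset.erase_eq_of_notMem hk, measure_univ, mul_one]

end Resampling

lemma setIntegral_preimage_of_measurePreserving {α γ : Type*} [MeasurableSpace α]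
    [MeasurableSpace γ] {μ : Measure α} {ρ : Measure γ} {f : α → γ} (hf : MeasurePreserving f μ ρ)
    {S : Set γ} (hS : MeasurableSet S) {F : γ → ℝ} (hF : StronglyMeasurable F) :
    ∫ a in f ⁻¹' S, F (f a) ∂μ = ∫ y in S, F y ∂ρ := by
  rw [← hf.map_eq, setIntegral_map hS hF.aestronglyMeasurable hf.aemeasurable]

/-- The marks `p 0, p 1, …` are independent with law `ν`, and the sequence of the marks is
independent of `T`. -/
structure IsIndependentMarking {Ω 𝒯 E : Type*} [MeasurableSpace Ω] [MeasurableSpace 𝒯]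
    [MeasurableSpace E] (P : Measure Ω) (ν : Measure E) [IsProbabilityMeasure ν] (T : Ω → 𝒯)
    (p : ℕ → Ω → E) : Prop where
  measurable_left : Measurable T
  measurable_mark : ∀ i, Measurable (p i)
  map_eq : P.map (fun ω => (T ω, fun i => p i ω)) =
    (P.map T).prod (Measure.infinitePi fun _ => ν)

/-- The variable `T` together with the first `k` marks. -/
def past {Ω 𝒯 E : Type*} (T : Ω → 𝒯) (p : ℕ → Ω → E) (k : ℕ) (ω : Ω) : 𝒯 × (Fin k → E) :=
  (T ω, fun i => p i ω)

/-- A sequence of bounded measurable functionals of a sequence of marks, the `k`-th of which only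
depends on the first `k` marks. -/
structure IsNonanticipating {E : Type*} [MeasurableSpace E] (Φ : ℕ → (ℕ → E) → ℝ) : Prop where
  measurable : ∀ k, Measurable (Φ k)
  exists_abs_le : ∀ k, ∃ C, ∀ z, |Φ k z| ≤ C
  congr : ∀ k z z', (∀ i < k, z i = z' i) → Φ k z = Φ k z'

namespace IsIndependentMarking

variable {Ω 𝒯 E : Type*} [mΩ : MeasurableSpace Ω] [MeasurableSpace 𝒯] [MeasurableSpace E]
  {P : Measure Ω} {ν : Measure E} [IsProbabilityMeasure ν] {T : Ω → 𝒯} {p : ℕ → Ω → E}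

lemma measurable_marks (hI : IsIndependentMarking P ν T p) : Measurable fun ω i => p i ω :=
  measurable_pi_lambda _ hI.measurable_mark

lemma measurable_past (hI : IsIndependentMarking P ν T p) (k : ℕ) : Measurable (past T p k) :=
  hI.measurable_left.prodMk (measurable_pi_lambda _ fun i => hI.measurable_mark i)

/-- The discrete-time filtration generated by `T` and by the marks, revealed one at a time. -/
def pastFiltration (hI : IsIndependentMarking P ν T p) : Filtration ℕ mΩ where
  seq k := MeasurableSpace.comap (past T p k) inferInstance
  mono' k l hkl := by
    have hrestrict : Measurable fun y : 𝒯 × (Fin l → E) =>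
        (y.1, fun i : Fin k => y.2 (Fin.castLE hkl i)) :=
      measurable_fst.prodMk (measurable_pi_lambda _ fun i =>
        (measurable_pi_apply (Fin.castLE hkl i)).comp measurable_snd)
    exact (hrestrict.comp (comap_measurable (past T p l))).comap_le
  le' k := (hI.measurable_past k).comap_le

lemma comap_le_pastFiltration (hI : IsIndependentMarking P ν T p) (k : ℕ) :
    MeasurableSpace.comap T inferInstance ≤ hI.pastFiltration k :=
  (measurable_fst.comp (comap_measurable (past T p k))).comap_le

lemma setIntegral_eq_setIntegral_update [IsProbabilityMeasure P]
    (hI : IsIndependentMarking P ν T p) {k : ℕ}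
    {Φ : (ℕ → E) → ℝ} (hΦ : Measurable Φ) {C : ℝ} (hC : ∀ z, |Φ z| ≤ C) {A : Set Ω}
    (hA : MeasurableSet[hI.pastFiltration k] A) :
    ∫ ω in A, Φ (fun i => p i ω) ∂P =
      ∫ ω in A, ∫ q, Φ (Function.update (fun i => p i ω) k q) ∂ν ∂P := by
  obtain ⟨S, hS, rfl⟩ := hA
  set μ := (P.map T).prod (Measure.infinitePi fun _ : ℕ => ν)
  have : IsProbabilityMeasure (P.map T) :=
    Measure.isProbabilityMeasure_map hI.measurable_left.aemeasurable
  have hlaw : MeasurePreserving (fun ω => (T ω, fun i => p i ω)) P μ :=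
    ⟨hI.measurable_left.prodMk hI.measurable_marks, hI.map_eq⟩
  have hresample : MeasurePreserving
      (fun y : (𝒯 × (ℕ → E)) × E => (y.1.1, Function.update y.1.2 k y.2)) (μ.prod ν) μ :=
    ((MeasurePreserving.id (P.map T)).prod (measurePreserving_update ν k)).comp
      (measurePreserving_prodAssoc _ _ _)
  let S' : Set (𝒯 × (ℕ → E)) := {y | (y.1, fun i : Fin k => y.2 i) ∈ S}
  have hS' : MeasurableSet S' := measurableSet_preimage (measurable_fst.prodMk
    (measurable_pi_lambda _ fun i => (measurable_pi_apply _).comp measurable_snd)) hS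
  have hS'_resample : (fun y : (𝒯 × (ℕ → E)) × E =>
      (y.1.1, Function.update y.1.2 k y.2)) ⁻¹' S' = S' ×ˢ Set.univ := by
    ext ⟨y, q⟩
    simp [S', Function.update_of_ne (Fin.is_lt _).ne]
  have hΦ_snd : Measurable fun y : 𝒯 × (ℕ → E) => Φ y.2 := hΦ.comp measurable_snd
  have hΦ_update : Measurable fun y : (𝒯 × (ℕ → E)) × E => Φ (Function.update y.1.2 k y.2) :=
    hΦ_snd.comp hresample.measurable
  calc ∫ ω in past T p k ⁻¹' S, Φ (fun i => p i ω) ∂P = ∫ y in S', Φ y.2 ∂μ :=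
        setIntegral_preimage_of_measurePreserving hlaw hS' hΦ_snd.stronglyMeasurable
    _ = ∫ y in S' ×ˢ Set.univ, Φ (Function.update y.1.2 k y.2) ∂(μ.prod ν) := by
        rw [← hS'_resample]
        exact (setIntegral_preimage_of_measurePreserving hresample hS'
          hΦ_snd.stronglyMeasurable).symm
    _ = ∫ y in S', ∫ q, Φ (Function.update y.2 k q) ∂ν ∂μ := by
        rw [← Measure.prod_restrict, Measure.restrict_univ, integral_prod]
        exact .of_bound hΦ_update.aestronglyMeasurable C (ae_of_all _ fun y => hC _)
    _ = ∫ ω in past T p k ⁻¹' S, ∫ q, Φ (Function.update (fun i => p i ω) k q) ∂ν ∂P :=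
        (setIntegral_preimage_of_measurePreserving hlaw hS'
          hΦ_update.stronglyMeasurable.integral_prod_right).symm

lemma integrable_functional [IsFiniteMeasure P] (hI : IsIndependentMarking P ν T p)
    {Φ : ℕ → (ℕ → E) → ℝ} (hΦ : IsNonanticipating Φ) (k : ℕ) :
    Integrable (fun ω => Φ k fun i => p i ω) P :=
  let ⟨C, hC⟩ := hΦ.exists_abs_le k
  .of_bound ((hΦ.measurable k).comp hI.measurable_marks).aestronglyMeasurable C
    (ae_of_all _ fun _ => hC _)

lemma stronglyAdapted_functional (hI : IsIndependentMarking P ν T p)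
    {Φ : ℕ → (ℕ → E) → ℝ} (hΦ : IsNonanticipating Φ) :
    StronglyAdapted hI.pastFiltration fun k ω => Φ k fun i => p i ω := by
  intro k
  obtain ⟨e⟩ : Nonempty E := nonempty_of_isProbabilityMeasure ν
  let extend : 𝒯 × (Fin k → E) → ℕ → E := fun y i => if hi : i < k then y.2 ⟨i, hi⟩ else e
  have hextend : Measurable extend := by
    refine measurable_pi_lambda _ fun i => ?_
    by_cases hi : i < k
    · simpa only [extend, hi, dite_true] using! (measurable_pi_apply _).comp measurable_snd
    · simpa only [extend, hi, dite_false] using measurable_const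
  have hfactor : (fun ω => Φ k fun i => p i ω) = Φ k ∘ extend ∘ past T p k :=
    funext fun ω => hΦ.congr k _ _ fun i hi => by simp [extend, past, hi]
  beta_reduce
  rw [hfactor]
  exact (((hΦ.measurable k).comp hextend).comp (comap_measurable (past T p k))).stronglyMeasurable

variable [IsProbabilityMeasure P]

lemma martingale_functional (hI : IsIndependentMarking P ν T p) {Φ : ℕ → (ℕ → E) → ℝ}
    (hΦ : IsNonanticipating Φ)
    (hdrift : ∀ k z, ∫ q, Φ (k + 1) (Function.update z k q) ∂ν = Φ k z) :
    Martingale (fun k ω => Φ k fun i => p i ω) hI.pastFiltration P := by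
  refine martingale_of_setIntegral_eq_succ (hI.stronglyAdapted_functional hΦ)
    (hI.integrable_functional hΦ) fun k A hA => ?_
  obtain ⟨C, hC⟩ := hΦ.exists_abs_le (k + 1)
  simp only [hI.setIntegral_eq_setIntegral_update (hΦ.measurable (k + 1)) hC hA, hdrift]

lemma supermartingale_functional (hI : IsIndependentMarking P ν T p) {Φ : ℕ → (ℕ → E) → ℝ}
    (hΦ : IsNonanticipating Φ)
    (hdrift : ∀ k z, ∫ q, Φ (k + 1) (Function.update z k q) ∂ν ≤ Φ k z) :
    Supermartingale (fun k ω => Φ k fun i => p i ω) hI.pastFiltration P := by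
  refine supermartingale_of_setIntegral_succ_le (hI.stronglyAdapted_functional hΦ)
    (hI.integrable_functional hΦ) fun k A hA => ?_
  obtain ⟨C, hC⟩ := hΦ.exists_abs_le (k + 1)
  rw [hI.setIntegral_eq_setIntegral_update (hΦ.measurable (k + 1)) hC hA]
  have hmeas : Measurable fun y : Ω × E => Φ (k + 1) (Function.update (fun i => p i y.1) k y.2) :=
    (hΦ.measurable (k + 1)).comp ((measurable_update_prod k).comp
      ((hI.measurable_marks.comp measurable_fst).prodMk measurable_snd))
  refine setIntegral_mono (Integrable.integrableOn (.of_bound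
    hmeas.stronglyMeasurable.integral_prod_right.aestronglyMeasurable C (ae_of_all _ fun ω => ?_)))
    (hI.integrable_functional hΦ k).integrableOn fun ω => hdrift k _
  simpa using norm_integral_le_of_norm_le_const (μ := ν) (C := C)
    (f := fun q => Φ (k + 1) (Function.update (fun i => p i ω) k q)) (ae_of_all _ fun q => hC _)

end IsIndependentMarking

end Quadtree

/-! ### Counts of a Poisson point process -/

namespace IsPoissonPointProcess

section Counts

variable {Ω X : Type*} [MeasurableSpace Ω] [MeasurableSpace X] {N : Ω → Measure X}
  {μ : Measure X} {P : Measure Ω}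

lemma measurable_count (hN : IsPoissonPointProcess N μ P) {S : Set X} (hS : MeasurableSet S) :
    Measurable fun ω => N ω S :=
  (Measure.measurable_coe hS).comp hN.measurable

lemma measure_count_mem (hN : IsPoissonPointProcess N μ P) {S : Set X} (hS : MeasurableSet S)
    (hμS : μ S ≠ ∞) {D : Set ℝ≥0∞} (hD : MeasurableSet D) :
    P {ω | N ω S ∈ D} = poissonMeasure (μ S).toNNReal {k | (k : ℝ≥0∞) ∈ D} := by
  have hlaw := congrArg (fun ρ => ρ D) (hN.law S hS _ (ENNReal.coe_toNNReal hμS).symm)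
  rwa [Measure.map_apply (hN.measurable_count hS) hD,
    Measure.map_apply measurable_from_nat hD] at hlaw

lemma measure_count_eq (hN : IsPoissonPointProcess N μ P) {S : Set X} (hS : MeasurableSet S)
    (hμS : μ S ≠ ∞) (k : ℕ) :
    P {ω | N ω S = k} =
      ENNReal.ofReal (Real.exp (-μ.real S) * μ.real S ^ k / (k.factorial : ℝ)) := by
  have hset : {j : ℕ | (j : ℝ≥0∞) ∈ ({(k : ℝ≥0∞)} : Set ℝ≥0∞)} = {k} := by ext; simp
  have hcount := hN.measure_count_mem hS hμS (measurableSet_singleton (k : ℝ≥0∞))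
  rwa [hset, poissonMeasure_singleton] at hcount

lemma ae_count_ne_top (hN : IsPoissonPointProcess N μ P) {S : Set X} (hS : MeasurableSet S)
    (hμS : μ S ≠ ∞) : ∀ᵐ ω ∂P, N ω S ≠ ∞ := by
  have hcount := hN.measure_count_mem hS hμS (measurableSet_singleton ∞)
  simpa [ae_iff] using hcount

lemma ae_count_eq_zero [IsProbabilityMeasure P] (hN : IsPoissonPointProcess N μ P) {S : Set X}
    (hS : MeasurableSet S) (hμS : μ S = 0) : ∀ᵐ ω ∂P, N ω S = 0 := by
  have hcount := hN.measure_count_eq hS (by simp [hμS]) 0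
  simp only [Measure.real, hμS, ENNReal.toReal_zero, neg_zero, Real.exp_zero, pow_zero, mul_one,
    Nat.factorial_zero, Nat.cast_one, div_one, ENNReal.ofReal_one, Nat.cast_zero] at hcount
  exact (prob_compl_eq_zero_iff (hN.measurable_count hS (measurableSet_singleton 0))).2 hcount

lemma measure_forall_count_eq (hN : IsPoissonPointProcess N μ P) {ι : Type*} [Fintype ι]
    {S : ι → Set X} (hS : ∀ i, MeasurableSet (S i)) (hdisj : Pairwise (Function.onFun Disjoint S))
    (k : ι → ℕ) : P {ω | ∀ i, N ω (S i) = k i} = ∏ i, P {ω | N ω (S i) = k i} := by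
  let e := Fintype.equivFin ι
  have hindep := hN.indep _ (fun j => S (e.symm j)) (fun j => hS _)
    fun i j hij => hdisj (e.symm.injective.ne hij)
  have hprod := hindep.measure_inter_preimage_eq_mul Finset.univ
    (sets := fun j => {(k (e.symm j) : ℝ≥0∞)}) fun j _ => measurableSet_singleton _
  calc P {ω | ∀ i, N ω (S i) = k i}
      = P (⋂ j ∈ Finset.univ, (fun ω => N ω (S (e.symm j))) ⁻¹' {(k (e.symm j) : ℝ≥0∞)}) := by
        congr 1
        ext ω
        simpa using e.symm.forall_congr_right.symm
    _ = ∏ i, P {ω | N ω (S i) = k i} := by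
        rw [hprod]
        exact e.symm.prod_comp fun i => P {ω | N ω (S i) = k i}

end Counts

section Marked

variable {Ω X E : Type*} [MeasurableSpace Ω] [MeasurableSpace X] [MeasurableSpace E]
  {N : Ω → Measure (X × E)} {κ : Measure X} {ν : Measure E} [IsProbabilityMeasure ν]
  {P : Measure Ω}

lemma measure_count_prod_mul (hN : IsPoissonPointProcess N (κ.prod ν) P) {A : Set X}
    (hA : MeasurableSet A) (hκA : κ A ≠ ∞) {V : Set E} (hV : MeasurableSet V) (k : ℕ) :
    P {ω | N ω (A ×ˢ V) = k} * P {ω | N ω (A ×ˢ Vᶜ) = (0 : ℕ)} =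
      ν V ^ k * P {ω | N ω (A ×ˢ Set.univ) = k} := by
  have htop : ∀ W : Set E, (κ.prod ν) (A ×ˢ W) ≠ ∞ := fun W => by
    rw [Measure.prod_prod]
    exact ENNReal.mul_ne_top hκA (measure_ne_top ν W)
  have hexp : Real.exp (-κ.real A) = Real.exp (-(κ.real A * ν.real V)) *
      Real.exp (-(κ.real A * (1 - ν.real V))) := by
    rw [← Real.exp_add]
    ring_nf
  rw [hN.measure_count_eq (hA.prod hV) (htop _), hN.measure_count_eq (hA.prod hV.compl) (htop _),
    hN.measure_count_eq (hA.prod .univ) (htop _), ← ENNReal.ofReal_mul (by positivity),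
    ← ofReal_measureReal, ← ENNReal.ofReal_pow (by positivity),
    ← ENNReal.ofReal_mul (by positivity)]
  simp only [measureReal_prod_prod, probReal_compl_eq_one_sub hV, probReal_univ, mul_one, hexp,
    mul_pow, pow_zero, Nat.factorial_zero, Nat.cast_one, div_one]
  congr 1
  ring

lemma measure_forall_count_prod (hN : IsPoissonPointProcess N (κ.prod ν) P) {ι : Type*}
    [Fintype ι] {A : ι → Set X} (hA : ∀ i, MeasurableSet (A i))
    (hdisj : Pairwise (Function.onFun Disjoint A)) (hκA : ∀ i, κ (A i) ≠ ∞) {V : ι → Set E}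
    (hV : ∀ i, MeasurableSet (V i)) (k : ι → ℕ) :
    P {ω | ∀ i, N ω (A i ×ˢ V i) = k i ∧ N ω (A i ×ˢ (V i)ᶜ) = 0} =
      (∏ i, ν (V i) ^ k i) * P {ω | ∀ i, N ω (A i ×ˢ Set.univ) = k i} := by
  let S : ι × Bool → Set (X × E) := fun y => A y.1 ×ˢ cond y.2 (V y.1) (V y.1)ᶜ
  have hS : ∀ y, MeasurableSet (S y)
    | (i, true) => (hA i).prod (hV i)
    | (i, false) => (hA i).prod (hV i).compl
  have hS_disj : Pairwise (Function.onFun Disjoint S) := by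
    rintro ⟨i, b⟩ ⟨j, c⟩ hne
    rcases eq_or_ne i j with rfl | hij
    · refine Set.Disjoint.set_prod_right ?_ _ _
      cases b <;> cases c <;>
        first | exact absurd rfl hne | exact disjoint_compl_right | exact disjoint_compl_left
    · exact Set.Disjoint.set_prod_left (hdisj hij) _ _
  calc P {ω | ∀ i, N ω (A i ×ˢ V i) = k i ∧ N ω (A i ×ˢ (V i)ᶜ) = 0}
      = P {ω | ∀ y, N ω (S y) = (cond y.2 (k y.1) 0 : ℕ)} := by
        simp [S, Prod.forall, Bool.forall_bool, and_comm]
    _ = ∏ i, P {ω | N ω (A i ×ˢ V i) = k i} * P {ω | N ω (A i ×ˢ (V i)ᶜ) = (0 : ℕ)} := by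
        rw [hN.measure_forall_count_eq hS hS_disj, Fintype.prod_prod_type]
        simp only [Fintype.prod_bool, S, cond_true, cond_false]
    _ = (∏ i, ν (V i) ^ k i) * P {ω | ∀ i, N ω (A i ×ˢ Set.univ) = k i} := by
        rw [hN.measure_forall_count_eq (fun i => (hA i).prod .univ)
          fun i j hij => Set.Disjoint.set_prod_left (hdisj hij) _ _, ← Finset.prod_mul_distrib]
        exact Finset.prod_congr rfl fun i _ =>
          hN.measure_count_prod_mul (hA i) (hκA i) (hV i) (k i)

end Marked

end IsPoissonPointProcess

namespace Quadtree

lemma sum_dirac_apply {ι X : Type*} [MeasurableSpace X] (y : ι → X) {S : Set X}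
    (hS : MeasurableSet S) : Measure.sum (fun i => Measure.dirac (y i)) S = (y ⁻¹' S).encard := by
  rw [Measure.sum_apply _ hS, ← ENNReal.tsum_set_one, tsum_subtype (y ⁻¹' S) fun _ => 1]
  exact tsum_congr fun i => Measure.dirac_apply' _ hS

/-! ### Independent marks of the ranked atoms -/

section Occupation

variable {m : ℕ} {g : ℕ → ℕ} {a : Fin (m + 1) → ℕ}

lemma encard_fiber_eq_ite (hg : Monotone g) (ha : StrictMono a) [DecidablePred (· ∈ Set.range a)]
    (hga : ∀ i : Fin (m + 1), g i = a i) (hlast : a (Fin.last m) < g (m + 1)) {b : ℕ}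
    (hb : b ≤ a (Fin.last m)) :
    {j | g j = b}.encard = (if b ∈ Set.range a then 1 else 0 : ℕ) := by
  have hfiber : ∀ j, g j = b → ∃ i : Fin (m + 1), (i : ℕ) = j ∧ a i = b := fun j hj =>
    have hjm : j < m + 1 := lt_of_not_ge fun hmj => by have := hg hmj; omega
    ⟨⟨j, hjm⟩, rfl, by rw [← hga, ← hj]⟩
  split_ifs with hba
  · obtain ⟨i, rfl⟩ := hba
    rw [Nat.cast_one, Set.encard_eq_one]
    refine ⟨i, Set.ext fun j => ⟨fun hj => ?_, fun hj => ?_⟩⟩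
    · obtain ⟨i', rfl, hi'⟩ := hfiber j hj
      exact congrArg Fin.val (ha.injective hi')
    · rw [Set.mem_singleton_iff.1 hj]
      exact hga i
  · rw [Nat.cast_zero, Set.encard_eq_zero, Set.eq_empty_iff_forall_notMem]
    exact fun j hj => hba ((hfiber j hj).imp fun i hi => hi.2)

lemma forall_eq_of_encard_fiber (hg : Monotone g) (ha : StrictMono a)
    [DecidablePred (· ∈ Set.range a)]
    (hcard : ∀ b ≤ a (Fin.last m),
      {j | g j = b}.encard = (if b ∈ Set.range a then 1 else 0 : ℕ)) :
    (∀ i : Fin (m + 1), g i = a i) ∧ a (Fin.last m) < g (m + 1) := by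
  have hle : ∀ i, a i ≤ a (Fin.last m) := fun i => ha.monotone (Fin.le_last i)
  have hone : ∀ i, ∃ j, {j | g j = a i} = {j} := fun i => by
    have := hcard (a i) (hle i)
    rwa [if_pos ⟨i, rfl⟩, Nat.cast_one, Set.encard_eq_one] at this
  have hunique : ∀ i {j j'}, g j = a i → g j' = a i → j = j' := fun i j j' hj hj' => by
    obtain ⟨l, hl⟩ := hone i
    exact (hl.subset hj).trans (hl.subset hj').symm
  have hrange : ∀ j, g j ≤ a (Fin.last m) → g j ∈ Set.range a := fun j hj => by
    by_contra hja
    have := hcard (g j) hj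
    rw [if_neg hja, Nat.cast_zero, Set.encard_eq_zero] at this
    exact this.subset (rfl : g j = g j)
  have hga : ∀ i : Fin (m + 1), g i = a i := fun i => by
    induction i using WellFoundedLT.induction with
    | ind i ih =>
      obtain ⟨j, hj⟩ := hone i
      have hgj : g j = a i := hj.superset rfl
      have hij : (i : ℕ) ≤ j := le_of_not_gt fun hji =>
        (ha hji : a ⟨j, hji.trans i.2⟩ < a i).ne ((ih ⟨j, hji.trans i.2⟩ hji).symm.trans hgj)
      have hgi : g i ≤ a i := hgj ▸ hg hij
      obtain ⟨l, hl⟩ := hrange i (hgi.trans (hle i))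
      rcases (ha.le_iff_le.1 (hl.trans_le hgi)).lt_or_eq with hli | rfl
      · exact absurd (Fin.ext (hunique l (ih l hli) hl.symm)) hli.ne
      · exact hl.symm
  refine ⟨hga, lt_of_not_ge fun hcon => ?_⟩
  obtain ⟨i, hi⟩ := hrange _ hcon
  have := hunique i hi.symm (hga i)
  omega

lemma prod_pow_ite_mem_range {R : Type*} [CommMonoid R] (ha : StrictMono a)
    [DecidablePred (· ∈ Set.range a)] (f : ℕ → R) :
    ∏ b : Fin (a (Fin.last m) + 1), f b ^ (if (b : ℕ) ∈ Set.range a then 1 else 0) =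
      ∏ i, f (a i) := by
  have himage : (Finset.range (a (Fin.last m) + 1)).filter (· ∈ Set.range a) =
      Finset.univ.image a := by
    ext b
    simp only [Finset.mem_filter, Finset.mem_range, Set.mem_range, Finset.mem_image,
      Finset.mem_univ, true_and, and_iff_right_iff_imp]
    rintro ⟨i, rfl⟩
    exact Nat.lt_succ_of_le (ha.monotone (Fin.le_last i))
  rw [Fin.prod_univ_eq_prod_range fun b => f b ^ (if b ∈ Set.range a then 1 else 0)]
  simp only [pow_ite, pow_one, pow_zero]
  rw [← Finset.prod_filter, himage, Finset.prod_image ha.injective.injOn]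

end Occupation

/-- The index of the cell of mesh `1 / (n + 1)` that contains the time `t`. -/
noncomputable def slotIndex (n : ℕ) (t : ℝ) : ℕ := ⌊t * (n + 1)⌋₊

lemma measurable_slotIndex (n : ℕ) : Measurable (slotIndex n) :=
  Nat.measurable_floor.comp (measurable_id.mul_const _)

lemma monotone_slotIndex (n : ℕ) : Monotone (slotIndex n) := fun _ _ hst =>
  Nat.floor_mono (mul_le_mul_of_nonneg_right hst (by positivity))

lemma slotIndex_preimage_inter_Ici_subset (n b : ℕ) :
    slotIndex n ⁻¹' {b} ∩ Set.Ici 0 ⊆ Set.Icc 0 (b + 1 : ℝ) := by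
  rintro t ⟨rfl, ht : 0 ≤ t⟩
  have hfloor := Nat.lt_floor_add_one (t * ((n : ℝ) + 1))
  exact ⟨ht, by rw [slotIndex]; nlinarith [(Nat.cast_nonneg n : (0 : ℝ) ≤ n)]⟩

lemma tendsto_slotIndex_div {t : ℝ} (ht : 0 ≤ t) :
    Tendsto (fun n : ℕ => (slotIndex n t : ℝ) / (n + 1)) atTop (𝓝 t) :=
  (tendsto_nat_floor_mul_div_atTop ht).comp
    (tendsto_natCast_atTop_atTop.atTop_add tendsto_const_nhds)

lemma eventually_slotIndex_lt_slotIndex {s t : ℝ} (hs : 0 ≤ s) (hst : s < t) :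
    ∀ᶠ n : ℕ in atTop, slotIndex n s < slotIndex n t := by
  have hlt := (tendsto_slotIndex_div hs).eventually_lt (tendsto_slotIndex_div (hs.trans hst.le)) hst
  filter_upwards [hlt] with n hn
  rwa [div_lt_div_iff_of_pos_right (by positivity), Nat.cast_lt] at hn

/-- The Borel sets whose indicator is, at every nonnegative time, the limit of its values at the
left endpoints of the slots. They form a `π`-system that contains the half-lines `(-∞, c]`. -/
def slotApproximable : Set (Set ℝ) :=
  {C | MeasurableSet C ∧
    ∀ t ≥ 0, ∀ᶠ n : ℕ in atTop, ((slotIndex n t : ℝ) / (n + 1) ∈ C ↔ t ∈ C)}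

lemma univ_mem_slotApproximable : Set.univ ∈ slotApproximable :=
  ⟨.univ, fun _ _ => Eventually.of_forall fun _ => Iff.rfl⟩

lemma Iic_mem_slotApproximable (c : ℝ) : Set.Iic c ∈ slotApproximable := by
  refine ⟨measurableSet_Iic, fun t ht => ?_⟩
  rcases le_or_gt t c with htc | htc
  · refine Eventually.of_forall fun n => iff_of_true ?_ htc
    have hfloor : (slotIndex n t : ℝ) ≤ t * (n + 1) := Nat.floor_le (by positivity)
    exact ((div_le_iff₀ (by positivity)).2 hfloor).trans htc
  · filter_upwards [(tendsto_slotIndex_div ht).eventually (lt_mem_nhds htc)] with n hn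
    exact iff_of_false (not_le.2 hn) (not_le.2 htc)

lemma isPiSystem_slotApproximable : IsPiSystem slotApproximable :=
  fun _ hC _ hD _ => ⟨hC.1.inter hD.1, fun t ht =>
    (hC.2 t ht).mp ((hD.2 t ht).mono fun _ h₁ h₂ => and_congr h₂ h₁)⟩

lemma generateFrom_squareCylinders_slotApproximable (ι : Type*) :
    MeasurableSpace.generateFrom (squareCylinders fun _ : ι => slotApproximable) =
      MeasurableSpace.pi := by
  refine le_antisymm (MeasurableSpace.generateFrom_le ?_) (iSup_le fun i => ?_)
  · rintro _ ⟨s, C, hC, rfl⟩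
    exact .pi s.countable_toSet fun i _ => (hC i trivial).1
  · let _ := MeasurableSpace.generateFrom (squareCylinders fun _ : ι => slotApproximable)
    refine (measurable_of_Iic fun c => MeasurableSpace.measurableSet_generateFrom ?_).comap_le
    exact ⟨{i}, fun _ => Set.Iic c, fun _ _ => Iic_mem_slotApproximable c, by ext; simp⟩

lemma forall_fin_mem_ite_univ_iff {E : Type*} {n : ℕ} {v : Finset ℕ} (hv : ∀ i ∈ v, i < n)
    (A : ℕ → Set E) (x : ℕ → E) :
    (∀ i : Fin n, x i ∈ if (i : ℕ) ∈ v then A i else Set.univ) ↔ ∀ i ∈ v, x i ∈ A i := by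
  refine ⟨fun h i hi => by simpa only [if_pos hi] using h ⟨i, hv i hi⟩, fun h i => ?_⟩
  split_ifs with hi
  exacts [h i hi, trivial]

section Counts

variable {E : Type*} [MeasurableSpace E]

lemma forall_count_slot_iff {t : ℕ → ℝ} (ht : Monotone t) {q : ℕ → E} {ξ : Measure (ℝ × E)}
    (hξ : ξ = Measure.sum fun i => Measure.dirac (t i, q i)) {n m : ℕ} {a : Fin (m + 1) → ℕ}
    (ha : StrictMono a) [DecidablePred (· ∈ Set.range a)] {V : ℕ → Set E}
    (hV : ∀ b, MeasurableSet (V b)) :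
    (∀ b : Fin (a (Fin.last m) + 1),
      ξ ((slotIndex n ⁻¹' {(b : ℕ)}) ×ˢ V b) = (if (b : ℕ) ∈ Set.range a then 1 else 0 : ℕ) ∧
        ξ ((slotIndex n ⁻¹' {(b : ℕ)}) ×ˢ (V b)ᶜ) = 0) ↔
      ((∀ i : Fin (m + 1), slotIndex n (t i) = a i) ∧
        a (Fin.last m) < slotIndex n (t (m + 1))) ∧ ∀ i : Fin (m + 1), q i ∈ V (a i) := by
  have hg : Monotone fun i => slotIndex n (t i) := (monotone_slotIndex n).comp ht
  have hcount : ∀ (b : ℕ) {W : Set E}, MeasurableSet W →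
      ξ ((slotIndex n ⁻¹' {b}) ×ˢ W) = {j | slotIndex n (t j) = b ∧ q j ∈ W}.encard := by
    intro b W hW
    rw [hξ, sum_dirac_apply _ ((measurable_slotIndex n (measurableSet_singleton b)).prod hW)]
    rfl
  have hcounts : ∀ (b k : ℕ), ((ξ ((slotIndex n ⁻¹' {b}) ×ˢ V b) = k ∧
      ξ ((slotIndex n ⁻¹' {b}) ×ˢ (V b)ᶜ) = 0) ↔ {j | slotIndex n (t j) = b}.encard = k ∧
        ∀ j, slotIndex n (t j) = b → q j ∈ V b) := by
    intro b k
    have hempty : ξ ((slotIndex n ⁻¹' {b}) ×ˢ (V b)ᶜ) = 0 ↔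
        ∀ j, slotIndex n (t j) = b → q j ∈ V b := by
      rw [hcount b (hV b).compl]
      simp [Set.eq_empty_iff_forall_notMem]
    rw [hempty]
    refine and_congr_left fun hq => ?_
    rw [hcount b (hV b), show {j | slotIndex n (t j) = b ∧ q j ∈ V b} =
      {j | slotIndex n (t j) = b} from Set.ext fun j => and_iff_left_of_imp (hq j)]
    norm_cast
  simp only [hcounts]
  constructor
  · intro h
    obtain ⟨hga, hlast⟩ := forall_eq_of_encard_fiber hg ha fun b hb =>
      (h ⟨b, Nat.lt_succ_of_le hb⟩).1
    exact ⟨⟨hga, hlast⟩, fun i => (h ⟨a i, Nat.lt_succ_of_le (ha.monotone (Fin.le_last i))⟩).2 i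
      (hga i)⟩
  · rintro ⟨⟨hga, hlast⟩, hq⟩ b
    refine ⟨encard_fiber_eq_ite hg ha hga hlast (Nat.le_of_lt_succ b.2), fun j hj => ?_⟩
    have hjm : j < m + 1 := lt_of_not_ge fun hmj => by have := hg hmj; grind
    have := hq ⟨j, hjm⟩
    rwa [← hga, hj] at this

variable {Ω : Type*} [MeasurableSpace Ω] {P : Measure Ω} {N : Ω → Measure (ℝ × E)}
  {ν : Measure E} [IsProbabilityMeasure ν] {τ : ℕ → Ω → ℝ} {p : ℕ → Ω → E}

lemma measure_slotIndex_eq_and_mem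
    (hN : IsPoissonPointProcess N ((volume.restrict (Set.Ici 0)).prod ν) P)
    (hatoms : ∀ᵐ ω ∂P, N ω = Measure.sum fun i => Measure.dirac (τ i ω, p i ω))
    (hrank : ∀ᵐ ω ∂P, StrictMono fun i => τ i ω) (n : ℕ) {m : ℕ} {a : Fin (m + 1) → ℕ}
    (ha : StrictMono a) {V : ℕ → Set E} (hV : ∀ b, MeasurableSet (V b)) :
    P {ω | ((∀ i : Fin (m + 1), slotIndex n (τ i ω) = a i) ∧
        a (Fin.last m) < slotIndex n (τ (m + 1) ω)) ∧ ∀ i : Fin (m + 1), p i ω ∈ V (a i)} =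
      (∏ i, ν (V (a i))) * P {ω | (∀ i : Fin (m + 1), slotIndex n (τ i ω) = a i) ∧
        a (Fin.last m) < slotIndex n (τ (m + 1) ω)} := by
  classical
  let A : Fin (a (Fin.last m) + 1) → Set ℝ := fun b => slotIndex n ⁻¹' {(b : ℕ)}
  let k : ℕ → ℕ := fun b => if b ∈ Set.range a then 1 else 0
  have hA : ∀ b, MeasurableSet (A b) := fun b =>
    measurable_slotIndex n (measurableSet_singleton _)
  have hmarked : ({ω | ((∀ i : Fin (m + 1), slotIndex n (τ i ω) = a i) ∧
      a (Fin.last m) < slotIndex n (τ (m + 1) ω)) ∧ ∀ i : Fin (m + 1), p i ω ∈ V (a i)} : Set Ω)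
      =ᵐ[P] {ω | ∀ b, N ω (A b ×ˢ V b) = k b ∧ N ω (A b ×ˢ (V b)ᶜ) = 0} := by
    filter_upwards [hatoms, hrank] with ω hω hmono
    exact propext (forall_count_slot_iff hmono.monotone hω ha hV).symm
  have hunmarked : ({ω | (∀ i : Fin (m + 1), slotIndex n (τ i ω) = a i) ∧
      a (Fin.last m) < slotIndex n (τ (m + 1) ω)} : Set Ω) =ᵐ[P]
      {ω | ∀ b, N ω (A b ×ˢ Set.univ) = k b} := by
    filter_upwards [hatoms, hrank] with ω hω hmono
    have hiff := forall_count_slot_iff (n := n) hmono.monotone hω ha (V := fun _ => Set.univ)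
      fun _ => .univ
    simp only [Set.compl_univ, Set.prod_empty, measure_empty, and_true, Set.mem_univ,
      implies_true] at hiff
    exact propext hiff.symm
  rw [measure_congr hmarked, measure_congr hunmarked, ← prod_pow_ite_mem_range ha fun b => ν (V b)]
  refine hN.measure_forall_count_prod hA (fun b c hbc => ?_) (fun b => ?_) (fun b => hV b)
    fun b => k b
  · exact (Set.disjoint_singleton.2 (Fin.val_ne_of_ne hbc)).preimage _
  · rw [Measure.restrict_apply (hA b)]
    exact measure_ne_top_of_subset (slotIndex_preimage_inter_Ici_subset n b)
      isCompact_Icc.measure_ne_top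

/-- The first `m + 2` of the ranked times `t 0, t 1, …` lie in distinct slots. -/
def SlotsSeparated (n m : ℕ) (t : ℕ → ℝ) : Prop :=
  ∀ i ≤ m, slotIndex n (t i) < slotIndex n (t (i + 1))

lemma measurableSet_slotsSeparated (hτ : ∀ i, Measurable (τ i)) (n m : ℕ) :
    MeasurableSet {ω | SlotsSeparated n m fun i => τ i ω} := by
  have hindex : ∀ i, Measurable fun ω => slotIndex n (τ i ω) := fun i =>
    (measurable_slotIndex n).comp (hτ i)
  simp only [SlotsSeparated, Set.ofPred_forall]
  exact .iInter fun i => .iInter fun _ => measurableSet_lt (hindex i) (hindex (i + 1))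

lemma eventually_slotsSeparated {t : ℕ → ℝ} (ht : StrictMono t) (ht0 : ∀ i, 0 ≤ t i) (m : ℕ) :
    ∀ᶠ n in atTop, SlotsSeparated n m t :=
  (Set.finite_Iic m).eventually_all.2 fun i _ =>
    eventually_slotIndex_lt_slotIndex (ht0 i) (ht i.lt_succ_self)

lemma forall_slotIndex_eq_and_slotsSeparated_iff {n m : ℕ} {t : ℕ → ℝ} {a : Fin (m + 1) → ℕ} :
    ((∀ i : Fin (m + 1), slotIndex n (t i) = a i) ∧ SlotsSeparated n m t) ↔
      StrictMono a ∧ (∀ i : Fin (m + 1), slotIndex n (t i) = a i) ∧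
        a (Fin.last m) < slotIndex n (t (m + 1)) := by
  rw [Fin.strictMono_iff_lt_succ, and_left_comm]
  refine and_congr_right fun hta => ?_
  simp only [SlotsSeparated, ← hta]
  constructor
  · exact fun h => ⟨fun i => h i i.2.le, h m le_rfl⟩
  · rintro ⟨hlt, hlast⟩ i hi
    rcases hi.lt_or_eq with hi | rfl
    · exact hlt ⟨i, hi⟩
    · exact hlast

lemma map_slotIndex_restrict
    (hN : IsPoissonPointProcess N ((volume.restrict (Set.Ici 0)).prod ν) P)
    (hτ : ∀ i, Measurable (τ i))
    (hatoms : ∀ᵐ ω ∂P, N ω = Measure.sum fun i => Measure.dirac (τ i ω, p i ω))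
    (hrank : ∀ᵐ ω ∂P, StrictMono fun i => τ i ω) (n m : ℕ)
    {B : Fin (m + 1) → Set E} (hB : ∀ i, MeasurableSet (B i)) :
    (P.restrict ({ω | SlotsSeparated n m fun i => τ i ω} ∩
        {ω | ∀ i : Fin (m + 1), p i ω ∈ B i})).map
          (fun ω (i : Fin (m + 1)) => slotIndex n (τ i ω)) =
      (∏ i, ν (B i)) • (P.restrict {ω | SlotsSeparated n m fun i => τ i ω}).map
        fun ω (i : Fin (m + 1)) => slotIndex n (τ i ω) := by
  have hindex : Measurable fun ω (i : Fin (m + 1)) => slotIndex n (τ i ω) :=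
    measurable_pi_lambda _ fun i => (measurable_slotIndex n).comp (hτ i)
  refine Measure.ext_of_singleton fun a => ?_
  have ha := hindex (measurableSet_singleton a)
  rw [Measure.smul_apply, Measure.map_apply hindex (measurableSet_singleton a),
    Measure.map_apply hindex (measurableSet_singleton a), Measure.restrict_apply ha,
    Measure.restrict_apply ha, ← Set.inter_assoc, smul_eq_mul]
  have hevent : (fun ω (i : Fin (m + 1)) => slotIndex n (τ i ω)) ⁻¹' {a} ∩
      {ω | SlotsSeparated n m fun i => τ i ω} = {ω | StrictMono a ∧
        (∀ i : Fin (m + 1), slotIndex n (τ i ω) = a i) ∧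
          a (Fin.last m) < slotIndex n (τ (m + 1) ω)} := by
    ext ω
    exact (and_congr_left' funext_iff).trans
      (forall_slotIndex_eq_and_slotsSeparated_iff (t := fun i => τ i ω))
  rw [hevent]
  by_cases hmono : StrictMono a
  · let V : ℕ → Set E := fun b => ⋂ i, ⋂ _ : a i = b, B i
    have hVa : ∀ i, V (a i) = B i := fun i => by simp [V, hmono.injective.eq_iff]
    have hV : ∀ b, MeasurableSet (V b) := fun b => .iInter fun i => .iInter fun _ => hB i
    simpa only [hVa, hmono, true_and] using! measure_slotIndex_eq_and_mem hN hatoms hrank n hmono hV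
  · simp [hmono]

lemma ae_forall_time_nonneg [IsProbabilityMeasure P]
    (hN : IsPoissonPointProcess N ((volume.restrict (Set.Ici 0)).prod ν) P)
    (hatoms : ∀ᵐ ω ∂P, N ω = Measure.sum fun i => Measure.dirac (τ i ω, p i ω)) :
    ∀ᵐ ω ∂P, ∀ i, 0 ≤ τ i ω := by
  have hS : MeasurableSet (Set.Iio (0 : ℝ) ×ˢ (Set.univ : Set E)) := measurableSet_Iio.prod .univ
  have hzero : ((volume.restrict (Set.Ici (0 : ℝ))).prod ν) (Set.Iio 0 ×ˢ Set.univ) = 0 := by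
    simp [Measure.prod_prod, Set.Iio_inter_Ici]
  filter_upwards [hN.ae_count_eq_zero hS hzero, hatoms] with ω hcount hω i
  rw [hω, sum_dirac_apply _ hS] at hcount
  rw [ENat.toENNReal_eq_zero, Set.encard_eq_zero, Set.eq_empty_iff_forall_notMem] at hcount
  exact le_of_not_gt fun hlt => hcount i ⟨hlt, trivial⟩

lemma ae_eventually_slotIndex_div_mem_iff [IsProbabilityMeasure P]
    (hN : IsPoissonPointProcess N ((volume.restrict (Set.Ici 0)).prod ν) P)
    (hatoms : ∀ᵐ ω ∂P, N ω = Measure.sum fun i => Measure.dirac (τ i ω, p i ω))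
    (hrank : ∀ᵐ ω ∂P, StrictMono fun i => τ i ω) {m : ℕ} {C : Fin (m + 1) → Set ℝ}
    (hC : ∀ i, C i ∈ slotApproximable) :
    ∀ᵐ ω ∂P, ∀ᶠ n : ℕ in atTop,
      (SlotsSeparated n m fun i => τ i ω) ∧
        ((∀ i : Fin (m + 1), (slotIndex n (τ i ω) : ℝ) / (n + 1) ∈ C i) ↔
          ∀ i : Fin (m + 1), τ i ω ∈ C i) := by
  filter_upwards [ae_forall_time_nonneg hN hatoms, hrank] with ω h0 hmono
  filter_upwards [eventually_slotsSeparated hmono h0 m,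
    eventually_all.2 fun i => (hC i).2 _ (h0 i)] with n hsep hiff
  exact ⟨hsep, forall_congr' hiff⟩

lemma measure_time_mem_and_mark_mem [IsProbabilityMeasure P]
    (hN : IsPoissonPointProcess N ((volume.restrict (Set.Ici 0)).prod ν) P)
    (hτ : ∀ i, Measurable (τ i)) (hp : ∀ i, Measurable (p i))
    (hatoms : ∀ᵐ ω ∂P, N ω = Measure.sum fun i => Measure.dirac (τ i ω, p i ω))
    (hrank : ∀ᵐ ω ∂P, StrictMono fun i => τ i ω) {m : ℕ} {C : Fin (m + 1) → Set ℝ}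
    (hC : ∀ i, C i ∈ slotApproximable) {B : Fin (m + 1) → Set E} (hB : ∀ i, MeasurableSet (B i)) :
    P ({ω | ∀ i : Fin (m + 1), τ i ω ∈ C i} ∩ {ω | ∀ i : Fin (m + 1), p i ω ∈ B i}) =
      (∏ i, ν (B i)) * P {ω | ∀ i : Fin (m + 1), τ i ω ∈ C i} := by
  let G : ℕ → Set Ω := fun n => {ω | SlotsSeparated n m fun i => τ i ω}
  let F : Set Ω := {ω | ∀ i : Fin (m + 1), p i ω ∈ B i}
  let D : ℕ → Set (Fin (m + 1) → ℕ) := fun n => {a | ∀ i, (a i : ℝ) / (n + 1) ∈ C i}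
  let A : ℕ → Ω → Fin (m + 1) → ℕ := fun n ω i => slotIndex n (τ i ω)
  have hA : ∀ n, Measurable (A n) := fun n =>
    measurable_pi_lambda _ fun i => (measurable_slotIndex n).comp (hτ i)
  have hAD : ∀ n, MeasurableSet (A n ⁻¹' D n) := fun n => hA n (Set.to_countable _).measurableSet
  have hG : ∀ n, MeasurableSet (G n) := fun n => measurableSet_slotsSeparated hτ n m
  have hF : MeasurableSet F := by
    simpa only [F, Set.ofPred_forall] using!
      MeasurableSet.iInter fun i : Fin (m + 1) => hp i (hB i)
  have hτC : MeasurableSet {ω | ∀ i : Fin (m + 1), τ i ω ∈ C i} := by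
    simpa only [Set.ofPred_forall] using!
      MeasurableSet.iInter fun i : Fin (m + 1) => hτ i (hC i).1
  have hmesh : ∀ n, P (A n ⁻¹' D n ∩ (G n ∩ F)) = (∏ i, ν (B i)) * P (A n ⁻¹' D n ∩ G n) := by
    intro n
    have hmap := congrArg (fun μ => μ (D n)) (map_slotIndex_restrict hN hτ hatoms hrank n m hB)
    rw [Measure.smul_apply, Measure.map_apply (hA n) (Set.to_countable _).measurableSet,
      Measure.map_apply (hA n) (Set.to_countable _).measurableSet,
      Measure.restrict_apply (hAD n), Measure.restrict_apply (hAD n)] at hmap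
    exact hmap
  have hlim := ae_eventually_slotIndex_div_mem_iff hN hatoms hrank hC
  have hlim_marked := tendsto_measure_of_ae_tendsto_indicator_of_isFiniteMeasure atTop (μ := P)
    (hτC.inter hF) (fun n => (hAD n).inter ((hG n).inter hF)) (by
      filter_upwards [hlim] with ω hω
      filter_upwards [hω] with n hn
      exact and_congr hn.2 (and_iff_right hn.1))
  have hlim_unmarked := tendsto_measure_of_ae_tendsto_indicator_of_isFiniteMeasure atTop (μ := P)
    hτC (fun n => (hAD n).inter (hG n)) (by
      filter_upwards [hlim] with ω hω
      filter_upwards [hω] with n hn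
      exact (and_iff_left hn.1).trans hn.2)
  simp only [hmesh] at hlim_marked
  exact tendsto_nhds_unique hlim_marked (ENNReal.Tendsto.const_mul hlim_unmarked
    (Or.inr (ENNReal.prod_ne_top fun i _ => measure_ne_top _ _)))

lemma measure_pi_preimage_inter_pi_preimage [IsProbabilityMeasure P]
    (hN : IsPoissonPointProcess N ((volume.restrict (Set.Ici 0)).prod ν) P)
    (hτ : ∀ i, Measurable (τ i)) (hp : ∀ i, Measurable (p i))
    (hatoms : ∀ᵐ ω ∂P, N ω = Measure.sum fun i => Measure.dirac (τ i ω, p i ω))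
    (hrank : ∀ᵐ ω ∂P, StrictMono fun i => τ i ω) (s u : Finset ℕ) {C : ℕ → Set ℝ}
    (hC : ∀ i, C i ∈ slotApproximable) {B : ℕ → Set E} (hB : ∀ i, MeasurableSet (B i)) :
    P ({ω | ∀ i ∈ s, τ i ω ∈ C i} ∩ {ω | ∀ i ∈ u, p i ω ∈ B i}) =
      (∏ i ∈ u, ν (B i)) * P {ω | ∀ i ∈ s, τ i ω ∈ C i} := by
  classical
  obtain ⟨m, hm⟩ : ∃ m, s ∪ u ⊆ Finset.range (m + 1) :=
    ⟨(s ∪ u).sup id, Finset.subset_range_sup_succ _⟩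
  have hsm : ∀ i ∈ s, i < m + 1 := fun i hi => Finset.mem_range.1 (hm (Finset.mem_union_left _ hi))
  have hum : ∀ i ∈ u, i < m + 1 := fun i hi => Finset.mem_range.1 (hm (Finset.mem_union_right _ hi))
  have hprod : ∏ i : Fin (m + 1), ν (if (i : ℕ) ∈ u then B i else Set.univ) = ∏ i ∈ u, ν (B i) := by
    rw [Fin.prod_univ_eq_prod_range fun i => ν (if i ∈ u then B i else Set.univ)]
    simp only [apply_ite ν, measure_univ]
    rw [Finset.prod_ite_mem, Finset.inter_eq_right.2 (Finset.subset_union_right.trans hm)]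
  have h := measure_time_mem_and_mark_mem hN hτ hp hatoms hrank (m := m)
    (C := fun i => if (i : ℕ) ∈ s then C i else Set.univ)
    (B := fun i => if (i : ℕ) ∈ u then B i else Set.univ)
    (fun i => by split_ifs; exacts [hC i, univ_mem_slotApproximable])
    (fun i => by split_ifs; exacts [hB i, .univ])
  rw [hprod] at h
  have hs : ∀ ω, (∀ i : Fin (m + 1), τ i ω ∈ if (i : ℕ) ∈ s then C i else Set.univ) ↔
      ∀ i ∈ s, τ i ω ∈ C i := fun ω => forall_fin_mem_ite_univ_iff hsm C (τ · ω)
  have hu : ∀ ω, (∀ i : Fin (m + 1), p i ω ∈ if (i : ℕ) ∈ u then B i else Set.univ) ↔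
      ∀ i ∈ u, p i ω ∈ B i := fun ω => forall_fin_mem_ite_univ_iff hum B (p · ω)
  simpa only [hs, hu] using h

end Counts

end Quadtree

theorem IsPoissonPointProcess.isIndependentMarking {E : Type*} [MeasurableSpace E] {Ω : Type*}
    [MeasurableSpace Ω] {P : Measure Ω} [IsProbabilityMeasure P] {N : Ω → Measure (ℝ × E)}
    {ν : Measure E} [IsProbabilityMeasure ν] {τ : ℕ → Ω → ℝ} {p : ℕ → Ω → E}
    (hN : IsPoissonPointProcess N ((volume.restrict (Set.Ici 0)).prod ν) P)
    (hτ : ∀ i, Measurable (τ i)) (hp : ∀ i, Measurable (p i))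
    (hatoms : ∀ᵐ ω ∂P, N ω = Measure.sum fun i => Measure.dirac (τ i ω, p i ω))
    (hrank : ∀ᵐ ω ∂P, StrictMono fun i => τ i ω) :
    Quadtree.IsIndependentMarking P ν (fun ω i => τ i ω) p := by
  have hτ' : Measurable fun ω i => τ i ω := measurable_pi_lambda _ hτ
  have hp' : Measurable fun ω i => p i ω := measurable_pi_lambda _ hp
  have := Measure.isProbabilityMeasure_map (μ := P) hτ'.aemeasurable
  refine ⟨hτ', hp, (Measure.prod_eq_generateFrom
    (Quadtree.generateFrom_squareCylinders_slotApproximable ℕ) generateFrom_squareCylinders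
    (isPiSystem_squareCylinders (fun _ => Quadtree.isPiSystem_slotApproximable)
      fun _ => Quadtree.univ_mem_slotApproximable)
    (isPiSystem_squareCylinders (fun _ => MeasurableSpace.isPiSystem_measurableSet) fun _ => .univ)
    ?_ ?_ ?_).symm⟩
  · exact ⟨fun _ => Set.univ, fun _ => ⟨∅, fun _ => Set.univ,
      fun _ _ => Quadtree.univ_mem_slotApproximable, by simp⟩, fun _ => measure_lt_top _ _,
      Set.iUnion_const _⟩
  · exact ⟨fun _ => Set.univ, fun _ => ⟨∅, fun _ => Set.univ, fun _ _ => .univ, by simp⟩,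
      fun _ => measure_lt_top _ _, Set.iUnion_const _⟩
  · rintro _ ⟨s, C, hC, rfl⟩ _ ⟨u, B, hB, rfl⟩
    have hCs : MeasurableSet ((s : Set ℕ).pi C) :=
      .pi s.countable_toSet fun i _ => (hC i trivial).1
    have hBu : MeasurableSet ((u : Set ℕ).pi B) := .pi u.countable_toSet fun i _ => hB i trivial
    rw [Measure.map_apply (hτ'.prodMk hp') (hCs.prod hBu), Measure.map_apply hτ' hCs,
      Measure.infinitePi_pi _ fun i _ => hB i trivial, mul_comm]
    exact Quadtree.measure_pi_preimage_inter_pi_preimage hN hτ hp hatoms hrank s u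
      (fun i => hC i trivial) fun i => hB i trivial

namespace Quadtree

/-! ### Cells of the quadtree -/

/-- The interior of a rectangle, written as a product of open intervals. -/
def Rect.inner (R : Rect) : Set (ℝ × ℝ) := Set.Ioo R.left R.right ×ˢ Set.Ioo R.bottom R.top

/-- A non-degenerate rectangle contained in the unit square. -/
structure Rect.Proper (R : Rect) : Prop where
  left_nonneg : 0 ≤ R.left
  left_lt_right : R.left < R.right
  right_le_one : R.right ≤ 1
  bottom_nonneg : 0 ≤ R.bottom
  bottom_lt_top : R.bottom < R.top
  top_le_one : R.top ≤ 1

section Geometry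

variable {R : Rect} {q : ℝ × ℝ}

lemma Rect.interior_carrier (R : Rect) : interior R.carrier = R.inner := by
  rw [Rect.carrier, Rect.inner, interior_prod_eq, interior_Icc, interior_Icc]

lemma Rect.mem_inner :
    q ∈ R.inner ↔ (R.left < q.1 ∧ q.1 < R.right) ∧ R.bottom < q.2 ∧ q.2 < R.top :=
  Iff.rfl

lemma Rect.measurableSet_inner (R : Rect) : MeasurableSet R.inner :=
  measurableSet_Ioo.prod measurableSet_Ioo

lemma Rect.Proper.inner_nonempty (hR : R.Proper) : R.inner.Nonempty :=
  (Set.nonempty_Ioo.2 hR.left_lt_right).prod (Set.nonempty_Ioo.2 hR.bottom_lt_top)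

lemma unitSquare_proper : unitSquare.Proper := by
  constructor <;> simp [unitSquare]

lemma Rect.Proper.split (hR : R.Proper) (hq : q ∈ R.inner) (j : Fin 4) :
    (R.split q j).Proper := by
  obtain ⟨⟨hl, hr⟩, hb, ht⟩ := Rect.mem_inner.1 hq
  obtain ⟨hl₀, -, hr₁, hb₀, -, ht₁⟩ := hR
  fin_cases j <;> constructor <;> simp only [Rect.split] <;> dsimp <;> linarith

lemma Rect.inner_split_subset (hq : q ∈ R.inner) (j : Fin 4) :
    (R.split q j).inner ⊆ R.inner := by
  obtain ⟨⟨hl, hr⟩, hb, ht⟩ := Rect.mem_inner.1 hq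
  fin_cases j <;> exact Set.prod_mono
    (Set.Ioo_subset_Ioo (by dsimp [Rect.split]; linarith) (by dsimp [Rect.split]; linarith))
    (Set.Ioo_subset_Ioo (by dsimp [Rect.split]; linarith) (by dsimp [Rect.split]; linarith))

lemma Rect.disjoint_inner_split (R : Rect) (q : ℝ × ℝ) {i j : Fin 4} (hij : i ≠ j) :
    Disjoint (R.split q i).inner (R.split q j).inner := by
  refine Set.disjoint_left.2 fun z hz hz' => ?_
  rw [Rect.mem_inner] at hz hz'
  fin_cases i <;> fin_cases j <;> simp [Rect.split] at hz hz' hij <;> linarith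

end Geometry

open Classical in
/-- The effect of the point `q` on one cell of the quadtree capped at generation `n`, in which
cells of generation `n` or more are never split; `n = ⊤` gives the quadtree itself. -/
noncomputable def cappedStep (n : ℕ∞) (q : ℝ × ℝ) (c : Cell) : Finset Cell :=
  if c.1.length < n then Cell.step q c else {c}

open Classical in
/-- The cells after the insertion of the first `k` points in the quadtree capped at generation
`n`. Capping turns the sums over a generation into time limits of sums over a quadtree. -/
noncomputable def cappedCells (n : ℕ∞) (p : ℕ → ℝ × ℝ) : ℕ → Finset Cell
  | 0 => {([], unitSquare)}
  | k + 1 => (cappedCells n p k).biUnion (cappedStep n (p k))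

/-- The cell `c` is split by the point `q` in the quadtree capped at generation `n`. -/
def IsSplit (n : ℕ∞) (q : ℝ × ℝ) (c : Cell) : Prop := c.1.length < n ∧ q ∈ c.2.inner

/-- The `j`-th of the four cells into which the cell `c` is split by the point `q`. -/
def child (q : ℝ × ℝ) (c : Cell) (j : Fin 4) : Cell := (c.1 ++ [j], c.2.split q j)

/-- A finite set of cells whose rectangles are proper and have pairwise disjoint interiors. -/
structure IsPacking (s : Finset Cell) : Prop where
  proper : ∀ c ∈ s, c.2.Proper
  pairwiseDisjoint : (s : Set Cell).PairwiseDisjoint fun c => c.2.inner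

section CappedStep

variable {n : ℕ∞} {q : ℝ × ℝ} {c d : Cell}

lemma length_child (q : ℝ × ℝ) (c : Cell) (j : Fin 4) :
    (child q c j).1.length = c.1.length + 1 := by
  simp [child]

lemma child_injective (q : ℝ × ℝ) (c : Cell) : Function.Injective (child q c) := by
  intro i j hij
  simpa [child] using congrArg Prod.fst hij

open Classical in
lemma cappedStep_of_isSplit (h : IsSplit n q c) :
    cappedStep n q c = Finset.univ.image (child q c) := by
  rw [cappedStep, if_pos h.1, Cell.step, Rect.interior_carrier, if_pos h.2]
  rfl

lemma cappedStep_of_not_isSplit (h : ¬ IsSplit n q c) : cappedStep n q c = {c} := by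
  rw [cappedStep]
  split_ifs with hc
  · rw [Cell.step, Rect.interior_carrier, if_neg fun hq => h ⟨hc, hq⟩]
  · rfl

lemma mem_cappedStep :
    d ∈ cappedStep n q c ↔ (IsSplit n q c ∧ ∃ j, d = child q c j) ∨ (¬ IsSplit n q c ∧ d = c) := by
  by_cases h : IsSplit n q c
  · simp [cappedStep_of_isSplit h, h, eq_comm]
  · simp [cappedStep_of_not_isSplit h, h]

lemma length_le_of_mem_cappedStep (hd : d ∈ cappedStep n q c) : c.1.length ≤ d.1.length := by
  rcases mem_cappedStep.1 hd with ⟨-, j, rfl⟩ | ⟨-, rfl⟩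
  · exact (Nat.le_succ _).trans (length_child q c j).ge
  · exact le_rfl

lemma inner_subset_of_mem_cappedStep (hd : d ∈ cappedStep n q c) : d.2.inner ⊆ c.2.inner := by
  rcases mem_cappedStep.1 hd with ⟨h, j, rfl⟩ | ⟨-, rfl⟩
  · exact Rect.inner_split_subset h.2 j
  · exact subset_rfl

lemma proper_of_mem_cappedStep (hc : c.2.Proper) (hd : d ∈ cappedStep n q c) : d.2.Proper := by
  rcases mem_cappedStep.1 hd with ⟨h, j, rfl⟩ | ⟨-, rfl⟩
  · exact hc.split h.2 j
  · exact hc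

lemma pairwiseDisjoint_inner_cappedStep (n : ℕ∞) (q : ℝ × ℝ) (c : Cell) :
    (cappedStep n q c : Set Cell).PairwiseDisjoint fun d => d.2.inner := by
  intro d hd d' hd' hne
  rcases mem_cappedStep.1 hd with ⟨h, j, rfl⟩ | ⟨h, rfl⟩ <;>
    rcases mem_cappedStep.1 hd' with ⟨h', j', rfl⟩ | ⟨h', rfl⟩
  · exact Rect.disjoint_inner_split _ _ fun hj => hne (by rw [hj])
  · exact absurd h h'
  · exact absurd h' h
  · exact absurd rfl hne

lemma sum_cappedStep_of_isSplit (h : IsSplit n q c) (g : Cell → ℝ) :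
    ∑ d ∈ cappedStep n q c, g d = ∑ j, g (child q c j) := by
  classical
  rw [cappedStep_of_isSplit h, Finset.sum_image (child_injective q c).injOn]

lemma sum_cappedStep_of_not_isSplit (h : ¬ IsSplit n q c) (g : Cell → ℝ) :
    ∑ d ∈ cappedStep n q c, g d = g c := by
  rw [cappedStep_of_not_isSplit h, Finset.sum_singleton]

end CappedStep

section IsPacking

variable {s : Finset Cell} {c d : Cell}

lemma IsPacking.eq_of_mem_inner (hs : IsPacking s) (hc : c ∈ s) (hd : d ∈ s) {q : ℝ × ℝ}
    (hqc : q ∈ c.2.inner) (hqd : q ∈ d.2.inner) : c = d :=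
  hs.pairwiseDisjoint.elim_set hc hd q hqc hqd

lemma IsPacking.injOn_snd (hs : IsPacking s) : Set.InjOn Prod.snd (s : Set Cell) := by
  intro c hc d hd hcd
  obtain ⟨q, hq⟩ := (hs.proper c hc).inner_nonempty
  exact hs.eq_of_mem_inner hc hd hq (hcd ▸ hq)

lemma IsPacking.pairwiseDisjoint_cappedStep (hs : IsPacking s) (n : ℕ∞) (q : ℝ × ℝ) :
    (s : Set Cell).PairwiseDisjoint (cappedStep n q) := by
  refine fun c hc c' hc' hne => Finset.disjoint_left.2 fun d hd hd' => ?_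
  obtain ⟨z, hz⟩ := (proper_of_mem_cappedStep (hs.proper c hc) hd).inner_nonempty
  exact hne (hs.eq_of_mem_inner hc hc' (inner_subset_of_mem_cappedStep hd hz)
    (inner_subset_of_mem_cappedStep hd' hz))

open Classical in
lemma IsPacking.biUnion_cappedStep (hs : IsPacking s) (n : ℕ∞) (q : ℝ × ℝ) :
    IsPacking (s.biUnion (cappedStep n q)) where
  proper d hd := by
    obtain ⟨c, hc, hd⟩ := Finset.mem_biUnion.1 hd
    exact proper_of_mem_cappedStep (hs.proper c hc) hd
  pairwiseDisjoint d hd d' hd' hne := by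
    obtain ⟨c, hc, hdc⟩ := Finset.mem_biUnion.1 hd
    obtain ⟨c', hc', hdc'⟩ := Finset.mem_biUnion.1 hd'
    by_cases hcc : c = c'
    · subst hcc
      exact pairwiseDisjoint_inner_cappedStep n q c hdc hdc' hne
    · exact (hs.pairwiseDisjoint hc hc' hcc).mono (inner_subset_of_mem_cappedStep hdc)
        (inner_subset_of_mem_cappedStep hdc')

end IsPacking

section CappedCells

variable {n : ℕ∞} {p : ℕ → ℝ × ℝ} {k : ℕ} {c : Cell}

lemma cappedCells_top (p : ℕ → ℝ × ℝ) (k : ℕ) : cappedCells ⊤ p k = cellsAfter p k := by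
  classical
  induction k with
  | zero => rfl
  | succ k ih =>
    rw [cappedCells, cellsAfter, ih]
    exact Finset.biUnion_congr rfl fun c _ => if_pos (ENat.natCast_lt_top _)

lemma mem_cappedCells_zero : c ∈ cappedCells n p 0 ↔ c = ([], unitSquare) :=
  Finset.mem_singleton

lemma mem_cappedCells_succ :
    c ∈ cappedCells n p (k + 1) ↔ ∃ d ∈ cappedCells n p k, c ∈ cappedStep n (p k) d := by
  classical
  exact Finset.mem_biUnion

lemma isPacking_cappedCells (n : ℕ∞) (p : ℕ → ℝ × ℝ) (k : ℕ) :
    IsPacking (cappedCells n p k) := by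
  induction k with
  | zero =>
    refine ⟨fun c hc => ?_, fun c hc d hd hne => ?_⟩
    · rw [mem_cappedCells_zero.1 hc]
      exact unitSquare_proper
    · exact absurd ((mem_cappedCells_zero.1 hc).trans (mem_cappedCells_zero.1 hd).symm) hne
  | succ k ih => exact ih.biUnion_cappedStep n (p k)

lemma isPacking_cellsAfter (p : ℕ → ℝ × ℝ) (k : ℕ) : IsPacking (cellsAfter p k) :=
  cappedCells_top p k ▸ isPacking_cappedCells ⊤ p k

lemma eq_of_mem_cappedCells_of_isSplit {q : ℝ × ℝ} {d : Cell} (hc : c ∈ cappedCells n p k)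
    (hd : d ∈ cappedCells n p k) (hqc : IsSplit n q c) (hqd : IsSplit n q d) : c = d :=
  (isPacking_cappedCells n p k).eq_of_mem_inner hc hd hqc.2 hqd.2

lemma cappedCells_congr (n : ℕ∞) {p' : ℕ → ℝ × ℝ} (hp : ∀ i < k, p i = p' i) :
    cappedCells n p k = cappedCells n p' k := by
  induction k with
  | zero => rfl
  | succ k ih =>
    rw [cappedCells, cappedCells, ih fun i hi => hp i (hi.trans k.lt_succ_self),
      hp k k.lt_succ_self]

lemma mem_cappedCells_succ_of_not_isSplit (hc : c ∈ cappedCells n p k)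
    (h : ¬ IsSplit n (p k) c) : c ∈ cappedCells n p (k + 1) :=
  mem_cappedCells_succ.2 ⟨c, hc, mem_cappedStep.2 (Or.inr ⟨h, rfl⟩)⟩

lemma child_mem_cappedCells_succ (hc : c ∈ cappedCells n p k) (h : IsSplit n (p k) c)
    (j : Fin 4) : child (p k) c j ∈ cappedCells n p (k + 1) :=
  mem_cappedCells_succ.2 ⟨c, hc, mem_cappedStep.2 (Or.inl ⟨h, j, rfl⟩)⟩

lemma cappedCells_succ_of_forall_not_isSplit (h : ∀ c ∈ cappedCells n p k, ¬ IsSplit n (p k) c) :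
    cappedCells n p (k + 1) = cappedCells n p k := by
  ext c
  refine ⟨fun hc => ?_, fun hc => mem_cappedCells_succ_of_not_isSplit hc (h c hc)⟩
  obtain ⟨d, hd, hc⟩ := mem_cappedCells_succ.1 hc
  rw [cappedStep_of_not_isSplit (h d hd), Finset.mem_singleton] at hc
  exact hc ▸ hd

lemma sum_cappedCells_succ (n : ℕ∞) (p : ℕ → ℝ × ℝ) (k : ℕ) (g : Cell → ℝ) :
    ∑ d ∈ cappedCells n p (k + 1), g d =
      ∑ c ∈ cappedCells n p k, ∑ d ∈ cappedStep n (p k) c, g d := by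
  classical
  exact Finset.sum_biUnion ((isPacking_cappedCells n p k).pairwiseDisjoint_cappedStep n (p k))

lemma sum_cappedCells_succ_of_isSplit (hc : c ∈ cappedCells n p k) (h : IsSplit n (p k) c)
    (g : Cell → ℝ) :
    ∑ d ∈ cappedCells n p (k + 1), g d =
      ∑ d ∈ cappedCells n p k, g d + (∑ j, g (child (p k) c j) - g c) := by
  classical
  have hother : ∀ d ∈ (cappedCells n p k).erase c, ∑ e ∈ cappedStep n (p k) d, g e = g d := by
    refine fun d hd => sum_cappedStep_of_not_isSplit (fun hd' => ?_) g
    obtain ⟨hne, hd⟩ := Finset.mem_erase.1 hd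
    exact hne (eq_of_mem_cappedCells_of_isSplit hd hc hd' h)
  rw [sum_cappedCells_succ, ← Finset.add_sum_erase _ _ hc, ← Finset.add_sum_erase _ g hc,
    sum_cappedStep_of_isSplit h, Finset.sum_congr rfl hother]
  ring

lemma length_le_of_mem_cappedCells (hc : c ∈ cappedCells n p k) : c.1.length ≤ n := by
  induction k generalizing c with
  | zero => simp [mem_cappedCells_zero.1 hc]
  | succ k ih =>
    obtain ⟨d, hd, hc⟩ := mem_cappedCells_succ.1 hc
    rcases mem_cappedStep.1 hc with ⟨h, j, rfl⟩ | ⟨-, rfl⟩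
    · rw [length_child]
      exact_mod_cast Order.add_one_le_of_lt h.1
    · exact ih hd

lemma mem_cappedCells_of_mem_cellsAfter (hn : c.1.length ≤ n) (hc : c ∈ cellsAfter p k) :
    c ∈ cappedCells n p k := by
  rw [← cappedCells_top] at hc
  induction k generalizing c with
  | zero => exact hc
  | succ k ih =>
    obtain ⟨d, hd, hc⟩ := mem_cappedCells_succ.1 hc
    have hd' := ih ((Nat.cast_le.2 (length_le_of_mem_cappedStep hc)).trans hn) hd
    rcases mem_cappedStep.1 hc with ⟨h, j, rfl⟩ | ⟨h, rfl⟩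
    · refine child_mem_cappedCells_succ hd' ⟨(Nat.cast_lt.2 ?_).trans_le hn, h.2⟩ j
      simp [length_child]
    · exact mem_cappedCells_succ_of_not_isSplit hd' fun h' => h ⟨ENat.natCast_lt_top _, h'.2⟩

lemma mem_cellsAfter_of_mem_cappedCells (hn : c.1.length < n) (hc : c ∈ cappedCells n p k) :
    c ∈ cellsAfter p k := by
  rw [← cappedCells_top]
  induction k generalizing c with
  | zero => exact hc
  | succ k ih =>
    obtain ⟨d, hd, hc⟩ := mem_cappedCells_succ.1 hc
    have hdn := (Nat.cast_le.2 (length_le_of_mem_cappedStep hc)).trans_lt hn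
    rw [cappedStep, if_pos hdn] at hc
    refine mem_cappedCells_succ.2 ⟨d, ih hdn hd, ?_⟩
    rwa [cappedStep, if_pos (ENat.natCast_lt_top _)]

lemma exists_le_mem_cellsAfter_of_mem_cappedCells (hc : c ∈ cappedCells n p k) :
    ∃ j ≤ k, c ∈ cellsAfter p j := by
  induction k with
  | zero => exact ⟨0, le_rfl, hc⟩
  | succ k ih =>
    obtain ⟨d, hd, hcd⟩ := mem_cappedCells_succ.1 hc
    rcases mem_cappedStep.1 hcd with ⟨h, j, rfl⟩ | ⟨-, rfl⟩
    · refine ⟨k + 1, le_rfl, ?_⟩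
      rw [← cappedCells_top]
      refine child_mem_cappedCells_succ ?_ ⟨ENat.natCast_lt_top _, h.2⟩ j
      rw [cappedCells_top]
      exact mem_cellsAfter_of_mem_cappedCells h.1 hd
    · obtain ⟨j, hj, hc⟩ := ih hd
      exact ⟨j, hj.trans k.le_succ, hc⟩

lemma mem_cappedCells_of_le {l : ℕ} (hn : n ≤ c.1.length) (hc : c ∈ cappedCells n p k)
    (hkl : k ≤ l) : c ∈ cappedCells n p l := by
  induction l, hkl using Nat.le_induction with
  | base => exact hc
  | succ l _ ih => exact mem_cappedCells_succ_of_not_isSplit ih fun h => hn.not_gt h.1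

end CappedCells

/-! ### Measurability -/

section Measurability

lemma measurable_left : Measurable Rect.left :=
  measurable_fst.comp (comap_measurable fun R : Rect => (R.left, R.right, R.bottom, R.top))

lemma measurable_right : Measurable Rect.right :=
  measurable_snd.fst.comp (comap_measurable fun R : Rect => (R.left, R.right, R.bottom, R.top))

lemma measurable_bottom : Measurable Rect.bottom :=
  measurable_snd.snd.fst.comp (comap_measurable fun R : Rect => (R.left, R.right, R.bottom, R.top))

lemma measurable_top : Measurable Rect.top :=
  measurable_snd.snd.snd.comp (comap_measurable fun R : Rect => (R.left, R.right, R.bottom, R.top))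

variable {Z : Type*} [MeasurableSpace Z]

lemma measurable_rect {f : Z → Rect} (hl : Measurable fun z => (f z).left)
    (hr : Measurable fun z => (f z).right) (hb : Measurable fun z => (f z).bottom)
    (ht : Measurable fun z => (f z).top) : Measurable f :=
  measurable_comap_iff.2 (hl.prodMk (hr.prodMk (hb.prodMk ht)))

lemma measurable_split {f : Z → Rect} {q : Z → ℝ × ℝ} (hf : Measurable f) (hq : Measurable q)
    (j : Fin 4) : Measurable fun z => (f z).split (q z) j := by
  have hl := measurable_left.comp hf
  have hr := measurable_right.comp hf
  have hb := measurable_bottom.comp hf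
  have ht := measurable_top.comp hf
  have hx := hq.fst
  have hy := hq.snd
  fin_cases j <;> apply measurable_rect <;> assumption

lemma measurableSet_mem_inner {f : Z → Rect} {q : Z → ℝ × ℝ} (hf : Measurable f)
    (hq : Measurable q) : MeasurableSet {z | q z ∈ (f z).inner} :=
  ((measurableSet_lt (measurable_left.comp hf) hq.fst).inter
    (measurableSet_lt hq.fst (measurable_right.comp hf))).inter
    ((measurableSet_lt (measurable_bottom.comp hf) hq.snd).inter
    (measurableSet_lt hq.snd (measurable_top.comp hf)))

open Classical in
lemma sum_cappedCells_succ_eq_sum_ite (n : ℕ∞) (p : ℕ → ℝ × ℝ) (k : ℕ) (g : Cell → ℝ) :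
    ∑ c ∈ cappedCells n p (k + 1), g c =
      ∑ c ∈ cappedCells n p k, if IsSplit n (p k) c then ∑ j, g (child (p k) c j) else g c := by
  rw [sum_cappedCells_succ]
  refine Finset.sum_congr rfl fun c _ => ?_
  split_ifs with h
  · exact sum_cappedStep_of_isSplit h g
  · exact sum_cappedStep_of_not_isSplit h g

lemma measurable_sum_cappedCells (n : ℕ∞) {p : Z → ℕ → ℝ × ℝ}
    (hp : ∀ i, Measurable fun z => p z i) (k : ℕ) (g : List (Fin 4) → Z → Rect → ℝ)
    (hg : ∀ u, Measurable fun y : Z × Rect => g u y.1 y.2) :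
    Measurable fun z => ∑ c ∈ cappedCells n (p z) k, g c.1 z c.2 := by
  classical
  induction k generalizing g with
  | zero =>
    simp only [cappedCells, Finset.sum_singleton]
    exact (hg []).comp (measurable_id.prodMk measurable_const)
  | succ k ih =>
    simp only [fun z => sum_cappedCells_succ_eq_sum_ite n (p z) k fun c => g c.1 z c.2]
    refine ih (fun u z R => if IsSplit n (p z k) (u, R) then
      ∑ j, g (u ++ [j]) z (R.split (p z k) j) else g u z R) fun u => ?_
    have hpk : Measurable fun y : Z × Rect => p y.1 k := (hp k).comp measurable_fst
    have hsplit : MeasurableSet {y : Z × Rect | IsSplit n (p y.1 k) (u, y.2)} :=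
      (MeasurableSet.const (u.length < n)).inter (measurableSet_mem_inner measurable_snd hpk)
    refine Measurable.ite hsplit (Finset.measurable_sum _ fun j _ => ?_) (hg u)
    exact (hg (u ++ [j])).comp (measurable_fst.prodMk (measurable_split measurable_snd hpk j))

end Measurability

/-! ### Power weights of rectangles -/

/-- The power `((x - l)⁺ (r - x)⁺) ^ s` of the distances from `x` to the end points of `[l, r]`,
extended by zero outside `[l, r]`: the horizontal factor of the weight of a rectangle. -/
noncomputable def endpointPow (s x l r : ℝ) : ℝ := (x - l)⁺ ^ s * (r - x)⁺ ^ s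

section EndpointPow

variable {s x l r a : ℝ}

lemma endpointPow_nonneg (s x l r : ℝ) : 0 ≤ endpointPow s x l r := by
  unfold endpointPow
  positivity

lemma endpointPow_of_le_left (hs : 0 < s) (hx : x ≤ l) : endpointPow s x l r = 0 := by
  rw [endpointPow, posPart_of_nonpos (sub_nonpos.2 hx), Real.zero_rpow hs.ne', zero_mul]

lemma endpointPow_of_right_le (hs : 0 < s) (hx : r ≤ x) : endpointPow s x l r = 0 := by
  rw [endpointPow, posPart_of_nonpos (sub_nonpos.2 hx), Real.zero_rpow hs.ne', mul_zero]

lemma endpointPow_of_mem_Icc (hx : x ∈ Set.Icc l r) :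
    endpointPow s x l r = ((x - l) * (r - x)) ^ s := by
  have hl := sub_nonneg.2 hx.1
  have hr := sub_nonneg.2 hx.2
  rw [endpointPow, posPart_of_nonneg hl, posPart_of_nonneg hr, Real.mul_rpow hl hr]

lemma endpointPow_le_one (hs : 0 < s) (hlr : r - l ≤ 1) : endpointPow s x l r ≤ 1 := by
  rcases le_total x l with hl | hl
  · exact (endpointPow_of_le_left hs hl).trans_le zero_le_one
  rcases le_total r x with hr | hr
  · exact (endpointPow_of_right_le hs hr).trans_le zero_le_one
  rw [endpointPow_of_mem_Icc ⟨hl, hr⟩]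
  have h₁ : 0 ≤ x - l := sub_nonneg.2 hl
  have h₂ : 0 ≤ r - x := sub_nonneg.2 hr
  exact Real.rpow_le_one (mul_nonneg h₁ h₂) (mul_le_one₀ (by linarith) h₂ (by linarith)) hs.le

lemma endpointPow_sq (s x l r : ℝ) : endpointPow s x l r ^ 2 = endpointPow (2 * s) x l r := by
  rw [endpointPow, endpointPow, mul_pow, ← Real.rpow_mul_natCast (posPart_nonneg _),
    ← Real.rpow_mul_natCast (posPart_nonneg _), Nat.cast_ofNat, mul_comm s]

lemma endpointPow_add_le (hs : 0 < s) (hla : l ≤ a) (har : a ≤ r) :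
    endpointPow s x l a + endpointPow s x a r ≤ endpointPow s x l r := by
  rcases le_total a x with hax | hax
  · rw [endpointPow_of_right_le hs hax, zero_add]
    unfold endpointPow
    gcongr
    exact posPart_mono (sub_le_sub_left hla x)
  · rw [endpointPow_of_le_left hs hax, add_zero]
    unfold endpointPow
    gcongr
    exact posPart_mono (sub_le_sub_right har x)

lemma continuous_posPart_rpow (hs : 0 < s) : Continuous fun a : ℝ => a⁺ ^ s :=
  continuous_posPart.rpow_const fun _ => Or.inr hs.le

lemma integral_zero_posPart_rpow (hs : 0 < s) (v : ℝ) :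
    ∫ a in (0 : ℝ)..v, a⁺ ^ s = v⁺ ^ (s + 1) / (s + 1) := by
  rcases le_total 0 v with hv | hv
  · have hcongr : Set.EqOn (fun a : ℝ => a⁺ ^ s) (fun a => a ^ s) (Set.uIcc 0 v) := by
      intro a ha
      rw [Set.uIcc_of_le hv] at ha
      simp only [posPart_of_nonneg ha.1]
    rw [intervalIntegral.integral_congr hcongr, integral_rpow (Or.inl (by linarith)),
      posPart_of_nonneg hv, Real.zero_rpow (by linarith), sub_zero]
  · have hcongr : Set.EqOn (fun a : ℝ => a⁺ ^ s) (fun _ => 0) (Set.uIcc 0 v) := by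
      intro a ha
      rw [Set.uIcc_of_ge hv] at ha
      simp only [posPart_of_nonpos ha.2, Real.zero_rpow hs.ne']
    rw [intervalIntegral.integral_congr hcongr, intervalIntegral.integral_zero,
      posPart_of_nonpos hv, Real.zero_rpow (by linarith), zero_div]

lemma integral_posPart_rpow (hs : 0 < s) (u v : ℝ) :
    ∫ a in u..v, a⁺ ^ s = (v⁺ ^ (s + 1) - u⁺ ^ (s + 1)) / (s + 1) := by
  have hint := (continuous_posPart_rpow hs).intervalIntegrable (μ := volume)
  rw [← intervalIntegral.integral_interval_sub_left (hint 0 v) (hint 0 u),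
    integral_zero_posPart_rpow hs, integral_zero_posPart_rpow hs, sub_div]

lemma integral_endpointPow_add (hs : 0 < s) (hlr : l ≤ r) :
    ∫ a in l..r, (endpointPow s x l a + endpointPow s x a r) =
      (r - l) / (s + 1) * endpointPow s x l r := by
  have hcont := continuous_posPart_rpow hs
  have hleft : Continuous fun a => (x - l)⁺ ^ s * (a - x)⁺ ^ s :=
    (hcont.comp (continuous_id.sub continuous_const)).const_mul _
  have hright : Continuous fun a => (x - a)⁺ ^ s * (r - x)⁺ ^ s :=
    (hcont.comp (continuous_const.sub continuous_id)).mul_const _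
  simp only [endpointPow]
  rw [intervalIntegral.integral_add (hleft.intervalIntegrable _ _)
      (hright.intervalIntegrable _ _),
    intervalIntegral.integral_const_mul, intervalIntegral.integral_mul_const,
    intervalIntegral.integral_comp_sub_right (fun a => a⁺ ^ s),
    intervalIntegral.integral_comp_sub_left (fun a => a⁺ ^ s),
    integral_posPart_rpow hs, integral_posPart_rpow hs]
  have hs' : s + 1 ≠ 0 := by linarith
  rcases le_total x l with hx | hx
  · simp [posPart_of_nonpos (sub_nonpos.2 hx), posPart_of_nonpos (sub_nonpos.2 (hx.trans hlr)),
      Real.zero_rpow hs.ne', Real.zero_rpow hs']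
  rcases le_total r x with hx' | hx'
  · simp [posPart_of_nonpos (sub_nonpos.2 hx'), posPart_of_nonpos (sub_nonpos.2 (hlr.trans hx')),
      Real.zero_rpow hs.ne', Real.zero_rpow hs']
  have h₁ := sub_nonneg.2 hx
  have h₂ := sub_nonneg.2 hx'
  rw [posPart_of_nonneg h₁, posPart_of_nonneg h₂, posPart_of_nonpos (sub_nonpos.2 hx),
    posPart_of_nonpos (sub_nonpos.2 hx'), Real.zero_rpow hs', Real.rpow_add_one' h₁ hs',
    Real.rpow_add_one' h₂ hs']
  field_simp
  ring

end EndpointPow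

/-- The weight `(top - bottom) ^ γ * ((x - left) (right - x)) ^ (γ / 2)` of a rectangle, extended
by zero to the rectangles that are not above `x`. For `γ = β` it is `Rect.weight`. -/
noncomputable def Rect.powWeight (R : Rect) (γ x : ℝ) : ℝ :=
  (R.top - R.bottom) ^ γ * endpointPow (γ / 2) x R.left R.right

/-- The factor by which the mean total power weight changes at a uniform split. -/
noncomputable def splitRate (γ : ℝ) : ℝ := 4 / ((γ + 1) * (γ + 2))

/-- The change of the total power weight when a rectangle is split at `q`. -/
noncomputable def Rect.splitChange (R : Rect) (γ x : ℝ) (q : ℝ × ℝ) : ℝ :=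
  ∑ j, (R.split q j).powWeight γ x - R.powWeight γ x

section PowWeight

variable {R : Rect} {q : ℝ × ℝ} {γ : ℝ}

lemma measurable_powWeight (γ x : ℝ) : Measurable fun R : Rect => R.powWeight γ x := by
  have hleft : Measurable fun R : Rect => (x - R.left)⁺ :=
    continuous_posPart.measurable.comp (measurable_left.const_sub x)
  have hright : Measurable fun R : Rect => (R.right - x)⁺ :=
    continuous_posPart.measurable.comp (measurable_right.sub_const x)
  exact ((measurable_top.sub measurable_bottom).pow_const γ).mul
    ((hleft.pow_const _).mul (hright.pow_const _))

lemma measurable_sum_powWeight_split (R : Rect) (γ x : ℝ) :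
    Measurable fun q => ∑ j, (R.split q j).powWeight γ x :=
  Finset.measurable_sum _ fun j _ =>
    (measurable_powWeight γ x).comp (measurable_split measurable_const measurable_id j)

lemma measurable_splitChange (R : Rect) (γ x : ℝ) : Measurable (R.splitChange γ x) :=
  (measurable_sum_powWeight_split R γ x).sub measurable_const

lemma Rect.Proper.powWeight_nonneg (hR : R.Proper) (γ x : ℝ) : 0 ≤ R.powWeight γ x :=
  mul_nonneg (Real.rpow_nonneg (sub_nonneg.2 hR.bottom_lt_top.le) _) (endpointPow_nonneg _ _ _ _)

lemma Rect.Proper.powWeight_le_one (hR : R.Proper) (hγ : 0 < γ) (x : ℝ) :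
    R.powWeight γ x ≤ 1 := by
  obtain ⟨hl, -, hr, hb, hbt, ht⟩ := hR
  exact mul_le_one₀ (Real.rpow_le_one (by linarith) (by linarith) hγ.le)
    (endpointPow_nonneg _ _ _ _) (endpointPow_le_one (by linarith) (by linarith))

lemma Rect.Proper.powWeight_sq (hR : R.Proper) (γ x : ℝ) :
    R.powWeight γ x ^ 2 = R.powWeight (2 * γ) x := by
  rw [Rect.powWeight, Rect.powWeight, mul_pow, endpointPow_sq,
    ← Real.rpow_mul_natCast (sub_nonneg.2 hR.bottom_lt_top.le), Nat.cast_ofNat, mul_comm γ,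
    mul_div_assoc]

lemma powWeight_of_not_isAbove (hγ : 0 < γ) {x : ℝ} (hx : ¬ R.IsAbove x) :
    R.powWeight γ x = 0 := by
  rw [Rect.IsAbove, Set.mem_Icc, not_and_or, not_le, not_le] at hx
  rw [Rect.powWeight, hx.elim (fun h => endpointPow_of_le_left (half_pos hγ) h.le)
    fun h => endpointPow_of_right_le (half_pos hγ) h.le, mul_zero]

lemma Rect.sum_powWeight_split (R : Rect) (q : ℝ × ℝ) (γ x : ℝ) :
    ∑ j, (R.split q j).powWeight γ x =
      (endpointPow (γ / 2) x R.left q.1 + endpointPow (γ / 2) x q.1 R.right) *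
        ((R.top - q.2) ^ γ + (q.2 - R.bottom) ^ γ) := by
  simp only [Fin.sum_univ_four, Rect.powWeight, Rect.split, Matrix.cons_val]
  ring

lemma Rect.Proper.sum_powWeight_split_nonneg (hR : R.Proper) (hq : q ∈ R.inner) (γ x : ℝ) :
    0 ≤ ∑ j, (R.split q j).powWeight γ x :=
  Finset.sum_nonneg fun j _ => (hR.split hq j).powWeight_nonneg γ x

lemma sum_powWeight_split_le (hq : q ∈ R.inner) (hγ : 0 < γ) (x : ℝ) :
    ∑ j, (R.split q j).powWeight γ x ≤ 2 * R.powWeight γ x := by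
  obtain ⟨⟨hl, hr⟩, hb, ht⟩ := Rect.mem_inner.1 hq
  have htop : (R.top - q.2) ^ γ ≤ (R.top - R.bottom) ^ γ :=
    Real.rpow_le_rpow (by linarith) (by linarith) hγ.le
  have hbottom : (q.2 - R.bottom) ^ γ ≤ (R.top - R.bottom) ^ γ :=
    Real.rpow_le_rpow (by linarith) (by linarith) hγ.le
  have htop₀ : 0 ≤ (R.top - q.2) ^ γ := Real.rpow_nonneg (by linarith) _
  have hbottom₀ : 0 ≤ (q.2 - R.bottom) ^ γ := Real.rpow_nonneg (by linarith) _
  calc ∑ j, (R.split q j).powWeight γ x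
      ≤ endpointPow (γ / 2) x R.left R.right *
          ((R.top - R.bottom) ^ γ + (R.top - R.bottom) ^ γ) := by
        rw [R.sum_powWeight_split]
        exact mul_le_mul (endpointPow_add_le (half_pos hγ) hl.le hr.le) (add_le_add htop hbottom)
          (add_nonneg htop₀ hbottom₀) (endpointPow_nonneg _ _ _ _)
    _ = 2 * R.powWeight γ x := by rw [Rect.powWeight]; ring

lemma Rect.Proper.abs_splitChange_le (hR : R.Proper) (hq : q ∈ R.inner) (hγ : 0 < γ) (x : ℝ) :
    |R.splitChange γ x q| ≤ R.powWeight γ x := by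
  have hnonneg := hR.sum_powWeight_split_nonneg hq γ x
  have hle := sum_powWeight_split_le hq hγ x
  rw [Rect.splitChange, abs_le]
  constructor <;> linarith

lemma integral_sub_rpow_add_sub_rpow (hγ : 0 < γ) (b t : ℝ) :
    ∫ v in b..t, ((t - v) ^ γ + (v - b) ^ γ) = 2 * (t - b) ^ (γ + 1) / (γ + 1) := by
  have hcont : Continuous fun v : ℝ => v ^ γ := continuous_id.rpow_const fun _ => Or.inr hγ.le
  have htop : Continuous fun v => (t - v) ^ γ := hcont.comp (continuous_const.sub continuous_id)
  have hbottom : Continuous fun v => (v - b) ^ γ :=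
    hcont.comp (continuous_id.sub continuous_const)
  rw [intervalIntegral.integral_add (htop.intervalIntegrable _ _)
      (hbottom.intervalIntegrable _ _),
    intervalIntegral.integral_comp_sub_left (fun u => u ^ γ) t,
    intervalIntegral.integral_comp_sub_right (fun u => u ^ γ) b, sub_self, sub_self,
    integral_rpow (Or.inl (by linarith)), Real.zero_rpow (by linarith), sub_zero]
  ring

lemma Rect.volume_inner (R : Rect) :
    volume R.inner = ENNReal.ofReal (R.right - R.left) * ENNReal.ofReal (R.top - R.bottom) := by
  rw [Rect.inner, Measure.volume_eq_prod, Measure.prod_prod, Real.volume_Ioo, Real.volume_Ioo]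

lemma Rect.volume_inner_ne_top (R : Rect) : volume R.inner ≠ ⊤ := by
  rw [R.volume_inner]
  exact ENNReal.mul_ne_top ENNReal.ofReal_ne_top ENNReal.ofReal_ne_top

lemma Rect.Proper.volume_real_inner (hR : R.Proper) :
    volume.real R.inner = (R.right - R.left) * (R.top - R.bottom) := by
  rw [Measure.real, R.volume_inner, ENNReal.toReal_mul,
    ENNReal.toReal_ofReal (sub_nonneg.2 hR.left_lt_right.le),
    ENNReal.toReal_ofReal (sub_nonneg.2 hR.bottom_lt_top.le)]

lemma integrableOn_inner_of_abs_le {f : ℝ × ℝ → ℝ} {C : ℝ} (hf : Measurable f)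
    (hC : ∀ q ∈ R.inner, |f q| ≤ C) : IntegrableOn f R.inner :=
  Measure.integrableOn_of_bounded R.volume_inner_ne_top hf.aestronglyMeasurable
    ((ae_restrict_mem R.measurableSet_inner).mono hC)

lemma Rect.Proper.setIntegral_sum_powWeight_split (hR : R.Proper) (hγ : 0 < γ) (x : ℝ) :
    ∫ q in R.inner, ∑ j, (R.split q j).powWeight γ x =
      splitRate γ * (volume.real R.inner * R.powWeight γ x) := by
  simp only [R.sum_powWeight_split]
  have hlr := hR.left_lt_right.le
  have hbt := hR.bottom_lt_top.le
  rw [Rect.inner, Measure.volume_eq_prod, setIntegral_prod_mul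
      (fun a => endpointPow (γ / 2) x R.left a + endpointPow (γ / 2) x a R.right)
      (fun v => (R.top - v) ^ γ + (v - R.bottom) ^ γ),
    ← integral_Ioc_eq_integral_Ioo, ← integral_Ioc_eq_integral_Ioo,
    ← intervalIntegral.integral_of_le hlr, ← intervalIntegral.integral_of_le hbt,
    integral_endpointPow_add (half_pos hγ) hlr, integral_sub_rpow_add_sub_rpow hγ,
    ← Measure.volume_eq_prod, ← Rect.inner, hR.volume_real_inner, Rect.powWeight, splitRate,
    Real.rpow_add_one' (sub_nonneg.2 hbt) (by linarith)]
  field_simp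
  ring

lemma Rect.Proper.integrableOn_splitChange (hR : R.Proper) (hγ : 0 < γ) (x : ℝ) :
    IntegrableOn (R.splitChange γ x) R.inner :=
  integrableOn_inner_of_abs_le (measurable_splitChange R γ x)
    fun _ hq => hR.abs_splitChange_le hq hγ x

lemma Rect.Proper.setIntegral_splitChange (hR : R.Proper) (hγ : 0 < γ) (x : ℝ) :
    ∫ q in R.inner, R.splitChange γ x q =
      (splitRate γ - 1) * (volume.real R.inner * R.powWeight γ x) := by
  have hint : IntegrableOn (fun q => ∑ j, (R.split q j).powWeight γ x) R.inner := by
    refine integrableOn_inner_of_abs_le (C := 2 * R.powWeight γ x)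
      (measurable_sum_powWeight_split R γ x) fun q hq => ?_
    rw [abs_of_nonneg (hR.sum_powWeight_split_nonneg hq γ x)]
    exact sum_powWeight_split_le hq hγ x
  simp only [Rect.splitChange]
  rw [integral_sub hint (integrableOn_const R.volume_inner_ne_top),
    hR.setIntegral_sum_powWeight_split hγ x, setIntegral_const, smul_eq_mul]
  ring

end PowWeight

section Beta

lemma beta_pos : 0 < beta := by
  have : (3 : ℝ) < Real.sqrt 17 := (Real.lt_sqrt (by norm_num)).2 (by norm_num)
  rw [beta]
  linarith

lemma beta_add_one_mul_beta_add_two : (beta + 1) * (beta + 2) = 4 := by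
  have := Real.mul_self_sqrt (show (0 : ℝ) ≤ 17 by norm_num)
  rw [beta]
  linarith

lemma splitRate_beta : splitRate beta = 1 := by
  rw [splitRate, beta_add_one_mul_beta_add_two, div_self four_ne_zero]

lemma splitRate_two_mul_beta_lt_one : splitRate (2 * beta) < 1 := by
  have := beta_pos
  have := beta_add_one_mul_beta_add_two
  rw [splitRate, div_lt_one (by positivity)]
  nlinarith

lemma splitRate_two_mul_beta_pos : 0 < splitRate (2 * beta) := by
  have := beta_pos
  rw [splitRate]
  positivity

lemma Rect.Proper.weight_eq_powWeight {R : Rect} (hR : R.Proper) {x : ℝ} (hx : R.IsAbove x) :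
    R.weight x = R.powWeight beta x := by
  have hw : 0 < R.right - R.left := sub_pos.2 hR.left_lt_right
  have hh : 0 < R.top - R.bottom := sub_pos.2 hR.bottom_lt_top
  have hvol : (volume R.carrier).toReal = (R.right - R.left) * (R.top - R.bottom) := by
    rw [Rect.carrier, Measure.volume_eq_prod, Measure.prod_prod, Real.volume_Icc, Real.volume_Icc,
      ENNReal.toReal_mul, ENNReal.toReal_ofReal hw.le, ENNReal.toReal_ofReal hh.le]
  have hpos : R.position x * (1 - R.position x) =
      ((x - R.left) * (R.right - x)) / (R.right - R.left) ^ 2 := by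
    rw [Rect.position]
    field_simp
    ring
  have hsq : ((R.right - R.left) ^ 2) ^ (beta / 2) = (R.right - R.left) ^ beta := by
    rw [← Real.rpow_natCast_mul hw.le, Nat.cast_ofNat, mul_div_cancel₀ _ two_ne_zero]
  have hprod : 0 ≤ (x - R.left) * (R.right - x) :=
    mul_nonneg (sub_nonneg.2 hx.1) (sub_nonneg.2 hx.2)
  rw [Rect.weight, hvol, h, hpos, Real.div_rpow hprod (sq_nonneg _), hsq,
    Real.mul_rpow hw.le hh.le, Rect.powWeight, endpointPow_of_mem_Icc hx]
  have := (Real.rpow_pos_of_pos hw beta).ne'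
  field_simp

end Beta

/-! ### One uniform insertion -/

/-- The uniform distribution on the unit square. -/
noncomputable def unif : Measure (ℝ × ℝ) := volume.restrict (Set.Icc 0 1 ×ˢ Set.Icc 0 1)

instance : IsProbabilityMeasure unif := by
  constructor
  rw [unif, Measure.restrict_apply_univ, Measure.volume_eq_prod, Measure.prod_prod,
    Real.volume_Icc]
  simp

lemma Rect.Proper.inner_subset {R : Rect} (hR : R.Proper) :
    R.inner ⊆ Set.Icc 0 1 ×ˢ Set.Icc 0 1 :=
  Set.prod_mono (Set.Ioo_subset_Icc_self.trans (Set.Icc_subset_Icc hR.left_nonneg hR.right_le_one))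
    (Set.Ioo_subset_Icc_self.trans (Set.Icc_subset_Icc hR.bottom_nonneg hR.top_le_one))

lemma IsPacking.integral_unif_eq_add_sum {s : Finset Cell} (hs : IsPacking s) {f : ℝ × ℝ → ℝ}
    {a : ℝ} (hf : Integrable f unif) (hfa : ∀ q, (∀ c ∈ s, q ∉ c.2.inner) → f q = a) :
    ∫ q, f q ∂unif = a + ∑ c ∈ s, ∫ q in c.2.inner, (f q - a) := by
  have hint : IntegrableOn (fun q => f q - a) (Set.Icc 0 1 ×ˢ Set.Icc 0 1) volume :=
    hf.sub (integrable_const _)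
  have hsub : (⋃ c ∈ s, c.2.inner) ⊆ Set.Icc 0 1 ×ˢ Set.Icc 0 1 :=
    Set.iUnion₂_subset fun c hc => (hs.proper c hc).inner_subset
  have hsum : ∫ q, (f q - a) ∂unif = ∑ c ∈ s, ∫ q in c.2.inner, (f q - a) := by
    rw [unif, setIntegral_eq_of_subset_of_forall_sdiff_eq_zero
      (measurableSet_Icc.prod measurableSet_Icc) hsub fun q hq => ?_,
      integral_biUnion_finset _ (fun c _ => c.2.measurableSet_inner) hs.pairwiseDisjoint
      fun c hc => hint.mono_set (hs.proper c hc).inner_subset]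
    rw [hfa q fun c hc hqc => hq.2 (Set.mem_biUnion hc hqc), sub_self]
  rw [← hsum, integral_sub hf (integrable_const _), integral_const, probReal_univ, one_smul,
    add_sub_cancel]

namespace IsNonanticipating

variable {E : Type*} [MeasurableSpace E] {Φ Ψ : ℕ → (ℕ → E) → ℝ}

lemma add (hΦ : IsNonanticipating Φ) (hΨ : IsNonanticipating Ψ) :
    IsNonanticipating fun k z => Φ k z + Ψ k z where
  measurable k := (hΦ.measurable k).add (hΨ.measurable k)
  exists_abs_le k := by
    obtain ⟨C, hC⟩ := hΦ.exists_abs_le k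
    obtain ⟨D, hD⟩ := hΨ.exists_abs_le k
    exact ⟨C + D, fun z => (abs_add_le _ _).trans (add_le_add (hC z) (hD z))⟩
  congr k z z' hz := by rw [hΦ.congr k z z' hz, hΨ.congr k z z' hz]

lemma comp_continuous (hΦ : IsNonanticipating Φ) {φ : ℝ → ℝ} (hφ : Continuous φ) :
    IsNonanticipating fun k z => φ (Φ k z) where
  measurable k := hφ.measurable.comp (hΦ.measurable k)
  exists_abs_le k := by
    obtain ⟨C, hC⟩ := hΦ.exists_abs_le k
    obtain ⟨D, hD⟩ := (isCompact_Icc (a := -C) (b := C)).exists_bound_of_continuousOn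
      hφ.continuousOn
    exact ⟨D, fun z => hD _ (abs_le.1 (hC z))⟩
  congr k z z' hz := by rw [hΦ.congr k z z' hz]

lemma sub (hΦ : IsNonanticipating Φ) (hΨ : IsNonanticipating Ψ) :
    IsNonanticipating fun k z => Φ k z - Ψ k z := by
  simpa only [sub_eq_add_neg] using hΦ.add (hΨ.comp_continuous continuous_neg)

lemma integrable_update (hΦ : IsNonanticipating Φ) {ν : Measure E} [IsFiniteMeasure ν] (k : ℕ)
    (z : ℕ → E) : Integrable (fun q => Φ (k + 1) (Function.update z k q)) ν := by
  obtain ⟨C, hC⟩ := hΦ.exists_abs_le (k + 1)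
  exact .of_bound ((hΦ.measurable (k + 1)).comp (measurable_update z)).aestronglyMeasurable
    C (ae_of_all _ fun q => hC _)

end IsNonanticipating

section Update

variable {n : ℕ∞} {k : ℕ} {p : ℕ → ℝ × ℝ} {q : ℝ × ℝ} {c : Cell}

lemma cappedCells_update (n : ℕ∞) (k : ℕ) (p : ℕ → ℝ × ℝ) (q : ℝ × ℝ) :
    cappedCells n (Function.update p k q) k = cappedCells n p k :=
  cappedCells_congr n fun _ hi => Function.update_of_ne hi.ne _ _

lemma cappedCells_update_of_forall_notMem (hq : ∀ c ∈ cellsAfter p k, q ∉ c.2.inner) (n : ℕ∞) :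
    cappedCells n (Function.update p k q) (k + 1) = cappedCells n p k := by
  rw [cappedCells_succ_of_forall_not_isSplit, cappedCells_update]
  rw [cappedCells_update, Function.update_self]
  exact fun c hc hsplit => hq c (mem_cellsAfter_of_mem_cappedCells hsplit.1 hc) hsplit.2

lemma sum_cappedCells_update_of_mem (hc : c ∈ cellsAfter p k) (hq : q ∈ c.2.inner) (n : ℕ∞)
    (g : Cell → ℝ) :
    ∑ d ∈ cappedCells n (Function.update p k q) (k + 1), g d =
      ∑ d ∈ cappedCells n p k, g d + if c.1.length < n then ∑ j, g (child q c j) - g c else 0 := by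
  split_ifs with hn
  · have hcn := mem_cappedCells_of_mem_cellsAfter hn.le hc
    rw [← cappedCells_update n k p q] at hcn
    rw [sum_cappedCells_succ_of_isSplit hcn, cappedCells_update, Function.update_self]
    rw [Function.update_self]
    exact ⟨hn, hq⟩
  · rw [cappedCells_succ_of_forall_not_isSplit, cappedCells_update, add_zero]
    rw [cappedCells_update, Function.update_self]
    rintro d hd ⟨hdn, hdq⟩
    have hdc : d = c := (isPacking_cellsAfter p k).eq_of_mem_inner
      (mem_cellsAfter_of_mem_cappedCells hdn hd) hc hdq hq
    exact hn (hdc ▸ hdn)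

lemma card_cappedCells_le (n : ℕ∞) (p : ℕ → ℝ × ℝ) (k : ℕ) : (cappedCells n p k).card ≤ 4 ^ k := by
  classical
  induction k with
  | zero => exact (Finset.card_singleton _).le
  | succ k ih =>
    refine (Finset.card_biUnion_le_card_mul _ _ 4 fun c _ => ?_).trans (Nat.mul_le_mul_right 4 ih)
    by_cases h : IsSplit n (p k) c
    · rw [cappedStep_of_isSplit h]
      exact Finset.card_image_le
    · rw [cappedStep_of_not_isSplit h, Finset.card_singleton]
      norm_num

lemma isNonanticipating_sum_cappedCells (n : ℕ∞) {g : List (Fin 4) → Rect → ℝ}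
    (hg : ∀ u, Measurable (g u)) {C : ℝ} (hC : ∀ u R, R.Proper → |g u R| ≤ C) :
    IsNonanticipating fun k p => ∑ c ∈ cappedCells n p k, g c.1 c.2 where
  measurable k := measurable_sum_cappedCells n measurable_pi_apply k (fun u _ R => g u R)
    fun u => (hg u).comp measurable_snd
  exists_abs_le k := by
    have hC0 : 0 ≤ C := (abs_nonneg _).trans (hC [] _ unitSquare_proper)
    refine ⟨4 ^ k * C, fun p => ?_⟩
    calc |∑ c ∈ cappedCells n p k, g c.1 c.2| ≤ ∑ c ∈ cappedCells n p k, |g c.1 c.2| :=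
          Finset.abs_sum_le_sum_abs _ _
      _ ≤ (cappedCells n p k).card • C := Finset.sum_le_card_nsmul _ _ _ fun c hc =>
          hC _ _ ((isPacking_cappedCells n p k).proper c hc)
      _ ≤ 4 ^ k * C := by
          rw [nsmul_eq_mul]
          gcongr
          exact_mod_cast card_cappedCells_le n p k
  congr k p p' hp := by rw [cappedCells_congr n hp]

lemma integral_update_eq_add_sum {Φ : ℕ → (ℕ → ℝ × ℝ) → ℝ} (hΦ : IsNonanticipating Φ)
    (hΦq : ∀ q, (∀ c ∈ cellsAfter p k, q ∉ c.2.inner) →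
      Φ (k + 1) (Function.update p k q) = Φ k p) :
    ∫ q, Φ (k + 1) (Function.update p k q) ∂unif =
      Φ k p + ∑ c ∈ cellsAfter p k,
        ∫ q in c.2.inner, (Φ (k + 1) (Function.update p k q) - Φ k p) :=
  (isPacking_cellsAfter p k).integral_unif_eq_add_sum (hΦ.integrable_update k p) hΦq

end Update

/-- The total power weight of the quadtree capped at generation `n`, after `k` insertions. -/
noncomputable def cappedWeight (n : ℕ∞) (γ x : ℝ) (k : ℕ) (p : ℕ → ℝ × ℝ) : ℝ :=
  ∑ c ∈ cappedCells n p k, c.2.powWeight γ x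

section CappedWeight

variable {γ : ℝ} {k : ℕ} {p : ℕ → ℝ × ℝ} {q : ℝ × ℝ} {c : Cell}

lemma Rect.Proper.abs_powWeight_le_one {R : Rect} (hR : R.Proper) (hγ : 0 < γ) (x : ℝ) :
    |R.powWeight γ x| ≤ 1 :=
  (abs_of_nonneg (hR.powWeight_nonneg γ x)).trans_le (hR.powWeight_le_one hγ x)

lemma isNonanticipating_cappedWeight (n : ℕ∞) (hγ : 0 < γ) (x : ℝ) :
    IsNonanticipating (cappedWeight n γ x) :=
  isNonanticipating_sum_cappedCells n (fun _ => measurable_powWeight γ x)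
    fun _ _ hR => hR.abs_powWeight_le_one hγ x

lemma cappedWeight_nonneg (n : ℕ∞) (γ x : ℝ) (k : ℕ) (p : ℕ → ℝ × ℝ) :
    0 ≤ cappedWeight n γ x k p :=
  Finset.sum_nonneg fun c hc => ((isPacking_cappedCells n p k).proper c hc).powWeight_nonneg γ x

lemma cappedWeight_zero (n : ℕ∞) (γ x : ℝ) (p : ℕ → ℝ × ℝ) :
    cappedWeight n γ x 0 p = unitSquare.powWeight γ x :=
  Finset.sum_singleton _ _

lemma cappedWeight_update_of_forall_notMem (hq : ∀ c ∈ cellsAfter p k, q ∉ c.2.inner) (n : ℕ∞)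
    (γ x : ℝ) : cappedWeight n γ x (k + 1) (Function.update p k q) = cappedWeight n γ x k p := by
  rw [cappedWeight, cappedWeight, cappedCells_update_of_forall_notMem hq]

lemma cappedWeight_update_of_mem (hc : c ∈ cellsAfter p k) (hq : q ∈ c.2.inner) (n : ℕ∞)
    (γ x : ℝ) :
    cappedWeight n γ x (k + 1) (Function.update p k q) =
      cappedWeight n γ x k p + if c.1.length < n then c.2.splitChange γ x q else 0 :=
  sum_cappedCells_update_of_mem hc hq n _

lemma integral_cappedWeight_update (n : ℕ∞) (x : ℝ) (k : ℕ) (p : ℕ → ℝ × ℝ) :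
    ∫ q, cappedWeight n beta x (k + 1) (Function.update p k q) ∂unif =
      cappedWeight n beta x k p := by
  rw [integral_update_eq_add_sum (isNonanticipating_cappedWeight n beta_pos x)
    fun q hq => cappedWeight_update_of_forall_notMem hq n beta x, add_eq_left]
  refine Finset.sum_eq_zero fun c hc => ?_
  rw [setIntegral_congr_fun c.2.measurableSet_inner fun q hq => by
    rw [cappedWeight_update_of_mem hc hq, add_sub_cancel_left]]
  split_ifs
  · rw [((isPacking_cellsAfter p k).proper c hc).setIntegral_splitChange beta_pos, splitRate_beta,
      sub_self, zero_mul]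
  · exact integral_zero _ _

end CappedWeight

/-! ### An exponential supermartingale -/

/-- The exponent for which the mean decrease of the total weight of exponent `2β` makes up for the
second-order term of the exponential of the total weight of exponent `β`. -/
noncomputable def expRate : ℝ := (1 - splitRate (2 * beta)) / 4

lemma expRate_pos : 0 < expRate :=
  div_pos (sub_pos.2 splitRate_two_mul_beta_lt_one) four_pos

lemma expRate_le : expRate ≤ 1 / 4 := by
  have := splitRate_two_mul_beta_pos
  rw [expRate]
  linarith

lemma two_mul_beta_pos : 0 < 2 * beta := mul_pos two_pos beta_pos

/-- The change of the sum of the total weights of exponents `β` and `2β` at a split. -/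
noncomputable def Rect.pairChange (R : Rect) (x : ℝ) (q : ℝ × ℝ) : ℝ :=
  R.splitChange beta x q + R.splitChange (2 * beta) x q

section PairChange

variable {R : Rect} {q : ℝ × ℝ}

lemma measurable_pairChange (R : Rect) (x : ℝ) : Measurable (R.pairChange x) :=
  (measurable_splitChange R beta x).add (measurable_splitChange R (2 * beta) x)

lemma Rect.Proper.abs_expRate_mul_pairChange_le (hR : R.Proper) (hq : q ∈ R.inner) (x : ℝ) :
    |expRate * R.pairChange x q| ≤ expRate * (2 * R.powWeight beta x) := by
  have hβ := hR.abs_splitChange_le hq beta_pos x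
  have h2β := hR.abs_splitChange_le hq two_mul_beta_pos x
  rw [← hR.powWeight_sq] at h2β
  rw [abs_mul, abs_of_pos expRate_pos]
  refine mul_le_mul_of_nonneg_left ((abs_add_le _ _).trans ?_) expRate_pos.le
  nlinarith [hR.powWeight_nonneg beta x, hR.powWeight_le_one beta_pos x]

lemma Rect.Proper.abs_expRate_mul_pairChange_le_one (hR : R.Proper) (hq : q ∈ R.inner) (x : ℝ) :
    |expRate * R.pairChange x q| ≤ 1 := by
  have := expRate_le
  have := expRate_pos
  refine (hR.abs_expRate_mul_pairChange_le hq x).trans ?_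
  nlinarith [hR.powWeight_nonneg beta x, hR.powWeight_le_one beta_pos x]

lemma Rect.Proper.exp_pairChange_sub_one_le (hR : R.Proper) (hq : q ∈ R.inner) (x : ℝ) :
    Real.exp (expRate * R.pairChange x q) - 1 ≤
      expRate * R.pairChange x q + expRate ^ 2 * (4 * R.powWeight (2 * beta) x) := by
  have hle := abs_le.1 (hR.abs_expRate_mul_pairChange_le hq x)
  have hquad := (abs_le.1 (Real.abs_exp_sub_one_sub_id_le
    (hR.abs_expRate_mul_pairChange_le_one hq x))).2
  have hsq := sq_le_sq' hle.1 hle.2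
  rw [← hR.powWeight_sq]
  linarith

lemma Rect.Proper.integrableOn_exp_pairChange_sub_one (hR : R.Proper) (x : ℝ) :
    IntegrableOn (fun q => Real.exp (expRate * R.pairChange x q) - 1) R.inner := by
  refine integrableOn_inner_of_abs_le (C := Real.exp 1 + 1)
    ((((measurable_pairChange R x).const_mul _).exp).sub_const 1) fun q hq => ?_
  rw [← abs_of_pos (Real.exp_pos 1)]
  refine (abs_sub _ _).trans (add_le_add ?_ abs_one.le)
  rw [abs_of_pos (Real.exp_pos _), abs_of_pos (Real.exp_pos _), Real.exp_le_exp]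
  exact (le_abs_self _).trans (hR.abs_expRate_mul_pairChange_le_one hq x)

lemma Rect.Proper.setIntegral_exp_pairChange_sub_one_nonpos (hR : R.Proper) (x : ℝ) :
    ∫ q in R.inner, (Real.exp (expRate * R.pairChange x q) - 1) ≤ 0 := by
  have hβ := hR.integrableOn_splitChange beta_pos x
  have h2β := hR.integrableOn_splitChange two_mul_beta_pos x
  have hlin : IntegrableOn (fun q => expRate * R.pairChange x q) R.inner :=
    (hβ.add h2β).const_mul _
  have hconst : IntegrableOn (fun _ : ℝ × ℝ => expRate ^ 2 * (4 * R.powWeight (2 * beta) x))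
    R.inner := integrableOn_const R.volume_inner_ne_top
  calc ∫ q in R.inner, (Real.exp (expRate * R.pairChange x q) - 1)
      ≤ ∫ q in R.inner, (expRate * R.pairChange x q +
          expRate ^ 2 * (4 * R.powWeight (2 * beta) x)) :=
        setIntegral_mono_on (hR.integrableOn_exp_pairChange_sub_one x) (hlin.add hconst)
          R.measurableSet_inner fun q hq => hR.exp_pairChange_sub_one_le hq x
    _ = expRate * ((splitRate (2 * beta) - 1) *
          (volume.real R.inner * R.powWeight (2 * beta) x)) +
        volume.real R.inner * (expRate ^ 2 * (4 * R.powWeight (2 * beta) x)) := by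
        simp only [Rect.pairChange] at hlin ⊢
        rw [integral_add hlin hconst, integral_const_mul, integral_add hβ h2β,
          hR.setIntegral_splitChange beta_pos, hR.setIntegral_splitChange two_mul_beta_pos,
          splitRate_beta, sub_self, zero_mul, zero_add, setIntegral_const, smul_eq_mul]
    _ = 0 := by
        rw [show splitRate (2 * beta) - 1 = -(4 * expRate) by rw [expRate]; ring]
        ring

end PairChange

/-- The exponential of `expRate` times the sum of the total weights of exponents `β` and `2β`. -/
noncomputable def expWeight (n : ℕ∞) (x : ℝ) (k : ℕ) (p : ℕ → ℝ × ℝ) : ℝ :=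
  Real.exp (expRate * (cappedWeight n beta x k p + cappedWeight n (2 * beta) x k p))

lemma isNonanticipating_expWeight (n : ℕ∞) (x : ℝ) : IsNonanticipating (expWeight n x) :=
  ((isNonanticipating_cappedWeight n beta_pos x).add
    (isNonanticipating_cappedWeight n two_mul_beta_pos x)).comp_continuous
      (φ := fun a => Real.exp (expRate * a)) (by fun_prop)

lemma exp_cappedWeight_le_expWeight (n : ℕ∞) (x : ℝ) (k : ℕ) (p : ℕ → ℝ × ℝ) :
    Real.exp (expRate * cappedWeight n beta x k p) ≤ expWeight n x k p :=
  Real.exp_le_exp.2 (mul_le_mul_of_nonneg_left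
    (le_add_of_nonneg_right (cappedWeight_nonneg n _ x k p)) expRate_pos.le)

lemma expWeight_zero_le (n : ℕ∞) (x : ℝ) (p : ℕ → ℝ × ℝ) : expWeight n x 0 p ≤ Real.exp 1 := by
  rw [expWeight, cappedWeight_zero, cappedWeight_zero, Real.exp_le_exp]
  have hβ := unitSquare_proper.powWeight_le_one beta_pos x
  have h2β := unitSquare_proper.powWeight_le_one two_mul_beta_pos x
  nlinarith [expRate_pos, expRate_le]

lemma integral_expWeight_update_le (n : ℕ∞) (x : ℝ) (k : ℕ) (p : ℕ → ℝ × ℝ) :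
    ∫ q, expWeight n x (k + 1) (Function.update p k q) ∂unif ≤ expWeight n x k p := by
  rw [integral_update_eq_add_sum (isNonanticipating_expWeight n x) fun q hq => by
    simp only [expWeight, cappedWeight_update_of_forall_notMem hq]]
  refine add_le_of_nonpos_right (Finset.sum_nonpos fun c hc => ?_)
  by_cases hn : c.1.length < n
  · have hchange : ∀ q ∈ c.2.inner, expWeight n x (k + 1) (Function.update p k q) -
        expWeight n x k p = expWeight n x k p * (Real.exp (expRate * c.2.pairChange x q) - 1) := by
      intro q hq
      rw [mul_sub_one, expWeight, expWeight, ← Real.exp_add, cappedWeight_update_of_mem hc hq,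
        cappedWeight_update_of_mem hc hq, if_pos hn, if_pos hn, Rect.pairChange]
      ring_nf
    rw [setIntegral_congr_fun c.2.measurableSet_inner hchange, integral_const_mul]
    exact mul_nonpos_of_nonneg_of_nonpos (Real.exp_pos _).le
      (((isPacking_cellsAfter p k).proper c hc).setIntegral_exp_pairChange_sub_one_nonpos x)
  · have hchange : ∀ q ∈ c.2.inner, expWeight n x (k + 1) (Function.update p k q) -
        expWeight n x k p = 0 := fun q hq => by
      rw [expWeight, expWeight, cappedWeight_update_of_mem hc hq, cappedWeight_update_of_mem hc hq,
        if_neg hn, if_neg hn, add_zero, add_zero, sub_self]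
    exact (setIntegral_eq_zero_of_forall_eq_zero hchange).le

/-! ### The effect of the cap -/

/-- The variance of the total weight of exponent `β` still to come from the generations at least
`n`, up to a constant factor: `splitRate (2β)` is the factor by which the mean total weight of
exponent `2β` decreases per generation. -/
noncomputable def varPotential (n : ℕ) (x : ℝ) (k : ℕ) (p : ℕ → ℝ × ℝ) : ℝ :=
  ∑ c ∈ cellsAfter p k, splitRate (2 * beta) ^ (n - c.1.length) * c.2.powWeight (2 * beta) x

/-- The squared effect of the cap at generation `n` on the total weight, compensated by the
variance still to come. -/
noncomputable def capVariance (n : ℕ) (x : ℝ) (k : ℕ) (p : ℕ → ℝ × ℝ) : ℝ :=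
  (cappedWeight ⊤ beta x k p - cappedWeight n beta x k p) ^ 2 +
    (1 - splitRate (2 * beta))⁻¹ * varPotential n x k p

section CapVariance

variable {k : ℕ} {p : ℕ → ℝ × ℝ} {q : ℝ × ℝ} {c : Cell}

lemma isNonanticipating_varPotential (n : ℕ) (x : ℝ) : IsNonanticipating (varPotential n x) := by
  have hρ := splitRate_two_mul_beta_pos.le
  have h := isNonanticipating_sum_cappedCells ⊤ (C := 1)
    (g := fun u R => splitRate (2 * beta) ^ (n - u.length) * R.powWeight (2 * beta) x)
    (fun _ => (measurable_powWeight _ x).const_mul _) fun u R hR => by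
      rw [abs_mul, abs_of_nonneg (pow_nonneg hρ _)]
      exact mul_le_one₀ (pow_le_one₀ hρ splitRate_two_mul_beta_lt_one.le) (abs_nonneg _)
        (hR.abs_powWeight_le_one two_mul_beta_pos x)
  simp only [cappedCells_top] at h
  exact h

lemma isNonanticipating_capVariance (n : ℕ) (x : ℝ) : IsNonanticipating (capVariance n x) :=
  (((isNonanticipating_cappedWeight ⊤ beta_pos x).sub
    (isNonanticipating_cappedWeight n beta_pos x)).comp_continuous (continuous_pow 2)).add
    ((isNonanticipating_varPotential n x).comp_continuous (continuous_const_mul _))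

lemma inv_one_sub_splitRate_pos : 0 < (1 - splitRate (2 * beta))⁻¹ :=
  inv_pos.2 (sub_pos.2 splitRate_two_mul_beta_lt_one)

lemma sq_sub_le_capVariance (n : ℕ) (x : ℝ) (k : ℕ) (p : ℕ → ℝ × ℝ) :
    (cappedWeight ⊤ beta x k p - cappedWeight n beta x k p) ^ 2 ≤ capVariance n x k p :=
  le_add_of_nonneg_right (mul_nonneg inv_one_sub_splitRate_pos.le
    (Finset.sum_nonneg fun c hc => mul_nonneg (pow_nonneg splitRate_two_mul_beta_pos.le _)
      (((isPacking_cellsAfter p k).proper c hc).powWeight_nonneg _ x)))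

lemma capVariance_zero_le (n : ℕ) (x : ℝ) (p : ℕ → ℝ × ℝ) :
    capVariance n x 0 p ≤ (1 - splitRate (2 * beta))⁻¹ * splitRate (2 * beta) ^ n := by
  rw [capVariance, cappedWeight_zero, cappedWeight_zero, sub_self, zero_pow two_ne_zero, zero_add,
    varPotential, cellsAfter, Finset.sum_singleton, List.length_nil, Nat.sub_zero]
  exact mul_le_mul_of_nonneg_left (mul_le_of_le_one_right
    (pow_nonneg splitRate_two_mul_beta_pos.le _)
    (unitSquare_proper.powWeight_le_one two_mul_beta_pos x)) inv_one_sub_splitRate_pos.le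

lemma capVariance_update_of_forall_notMem (hq : ∀ c ∈ cellsAfter p k, q ∉ c.2.inner) (n : ℕ)
    (x : ℝ) : capVariance n x (k + 1) (Function.update p k q) = capVariance n x k p := by
  simp only [capVariance, varPotential, cappedWeight_update_of_forall_notMem hq, ← cappedCells_top,
    cappedCells_update_of_forall_notMem hq]

lemma varPotential_update_of_mem (hc : c ∈ cellsAfter p k) (hq : q ∈ c.2.inner) (n : ℕ) (x : ℝ) :
    varPotential n x (k + 1) (Function.update p k q) = varPotential n x k p +
      (splitRate (2 * beta) ^ (n - (c.1.length + 1)) * ∑ j, (c.2.split q j).powWeight (2 * beta) x -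
        splitRate (2 * beta) ^ (n - c.1.length) * c.2.powWeight (2 * beta) x) := by
  have h := sum_cappedCells_update_of_mem hc hq ⊤ fun d =>
    splitRate (2 * beta) ^ (n - d.1.length) * d.2.powWeight (2 * beta) x
  rw [if_pos (ENat.natCast_lt_top _), cappedCells_top, cappedCells_top] at h
  simp only [length_child] at h
  rw [varPotential, varPotential, h, Finset.mul_sum]
  rfl

lemma Rect.Proper.setIntegral_sq_splitChange_le {R : Rect} (hR : R.Proper) (x : ℝ) :
    ∫ q in R.inner, R.splitChange beta x q ^ 2 ≤
      volume.real R.inner * R.powWeight (2 * beta) x := by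
  have hle : ∀ q ∈ R.inner, R.splitChange beta x q ^ 2 ≤ R.powWeight (2 * beta) x := fun q hq => by
    rw [← hR.powWeight_sq]
    exact sq_le_sq' (abs_le.1 (hR.abs_splitChange_le hq beta_pos x)).1
      (abs_le.1 (hR.abs_splitChange_le hq beta_pos x)).2
  rw [← smul_eq_mul, ← setIntegral_const]
  refine setIntegral_mono_on (integrableOn_inner_of_abs_le (C := R.powWeight (2 * beta) x)
    ((measurable_splitChange R beta x).pow_const 2) fun q hq => ?_)
    (integrableOn_const R.volume_inner_ne_top) R.measurableSet_inner hle
  exact (abs_of_nonneg (sq_nonneg _)).trans_le (hle q hq)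

lemma setIntegral_capVariance_update_of_length_lt (hc : c ∈ cellsAfter p k) {n : ℕ}
    (hn : c.1.length < n) (x : ℝ) :
    ∫ q in c.2.inner, (capVariance n x (k + 1) (Function.update p k q) - capVariance n x k p) =
      0 := by
  have hR := (isPacking_cellsAfter p k).proper c hc
  have hchange : ∀ q ∈ c.2.inner,
      capVariance n x (k + 1) (Function.update p k q) - capVariance n x k p =
        (1 - splitRate (2 * beta))⁻¹ * splitRate (2 * beta) ^ (n - (c.1.length + 1)) *
          (c.2.splitChange (2 * beta) x q +
            (1 - splitRate (2 * beta)) * c.2.powWeight (2 * beta) x) := by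
    intro q hq
    rw [capVariance, capVariance, cappedWeight_update_of_mem hc hq,
      cappedWeight_update_of_mem hc hq, if_pos (ENat.natCast_lt_top _),
      if_pos (Nat.cast_lt.2 hn), varPotential_update_of_mem hc hq, Rect.splitChange,
      Rect.splitChange, show n - c.1.length = n - (c.1.length + 1) + 1 by omega, pow_succ]
    ring
  rw [setIntegral_congr_fun c.2.measurableSet_inner hchange, integral_const_mul,
    integral_add (hR.integrableOn_splitChange two_mul_beta_pos x)
      (integrableOn_const c.2.volume_inner_ne_top),
    hR.setIntegral_splitChange two_mul_beta_pos, setIntegral_const, smul_eq_mul]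
  ring

lemma setIntegral_capVariance_update_le_of_le_length (hc : c ∈ cellsAfter p k) {n : ℕ}
    (hn : n ≤ c.1.length) (x : ℝ) :
    ∫ q in c.2.inner, (capVariance n x (k + 1) (Function.update p k q) - capVariance n x k p) ≤
      0 := by
  have hR := (isPacking_cellsAfter p k).proper c hc
  set X := cappedWeight ⊤ beta x k p - cappedWeight n beta x k p with hX
  have hchange : ∀ q ∈ c.2.inner,
      capVariance n x (k + 1) (Function.update p k q) - capVariance n x k p =
        2 * X * c.2.splitChange beta x q + c.2.splitChange beta x q ^ 2 +
          (1 - splitRate (2 * beta))⁻¹ * c.2.splitChange (2 * beta) x q := by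
    intro q hq
    rw [capVariance, capVariance, cappedWeight_update_of_mem hc hq,
      cappedWeight_update_of_mem hc hq, if_pos (ENat.natCast_lt_top _),
      if_neg (Nat.cast_le.2 hn).not_gt, varPotential_update_of_mem hc hq, Rect.splitChange,
      Rect.splitChange, Nat.sub_eq_zero_of_le hn, Nat.sub_eq_zero_of_le (hn.trans (Nat.le_succ _)),
      hX]
    ring
  have hlin : IntegrableOn (fun q => 2 * X * c.2.splitChange beta x q) c.2.inner :=
    (hR.integrableOn_splitChange beta_pos x).const_mul _
  have hsq : IntegrableOn (fun q => c.2.splitChange beta x q ^ 2) c.2.inner :=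
    integrableOn_inner_of_abs_le ((measurable_splitChange _ _ _).pow_const 2) fun q hq => by
      rw [abs_pow]
      exact pow_le_pow_left₀ (abs_nonneg _) (hR.abs_splitChange_le hq beta_pos x) 2
  have hlinsq : IntegrableOn (fun q => 2 * X * c.2.splitChange beta x q +
    c.2.splitChange beta x q ^ 2) c.2.inner := hlin.add hsq
  have hρ : 1 - splitRate (2 * beta) ≠ 0 := (sub_pos.2 splitRate_two_mul_beta_lt_one).ne'
  rw [setIntegral_congr_fun c.2.measurableSet_inner hchange, integral_add hlinsq
      ((hR.integrableOn_splitChange two_mul_beta_pos x).const_mul _), integral_add hlin hsq,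
    integral_const_mul, integral_const_mul, hR.setIntegral_splitChange beta_pos,
    hR.setIntegral_splitChange two_mul_beta_pos, splitRate_beta, sub_self, zero_mul, mul_zero,
    zero_add, ← neg_sub 1 (splitRate (2 * beta)), neg_mul, mul_neg, inv_mul_cancel_left₀ hρ]
  exact add_neg_nonpos_iff.2 (hR.setIntegral_sq_splitChange_le x)

lemma integral_capVariance_update_le (n : ℕ) (x : ℝ) (k : ℕ) (p : ℕ → ℝ × ℝ) :
    ∫ q, capVariance n x (k + 1) (Function.update p k q) ∂unif ≤ capVariance n x k p := by
  rw [integral_update_eq_add_sum (isNonanticipating_capVariance n x) fun q hq =>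
    capVariance_update_of_forall_notMem hq n x]
  refine add_le_of_nonpos_right (Finset.sum_nonpos fun c hc => ?_)
  rcases lt_or_ge c.1.length n with hn | hn
  · exact (setIntegral_capVariance_update_of_length_lt hc hn x).le
  · exact setIntegral_capVariance_update_le_of_le_length hc hn x

end CapVariance

namespace IsIndependentMarking

variable {Ω 𝒯 : Type*} [MeasurableSpace Ω] [MeasurableSpace 𝒯] {P : Measure Ω}
  [IsProbabilityMeasure P] {T : Ω → 𝒯} {p : ℕ → Ω → ℝ × ℝ}

lemma martingale_cappedWeight (hI : IsIndependentMarking P unif T p) (n : ℕ∞) (x : ℝ) :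
    Martingale (fun k ω => cappedWeight n beta x k fun i => p i ω) hI.pastFiltration P :=
  hI.martingale_functional (isNonanticipating_cappedWeight n beta_pos x)
    (integral_cappedWeight_update n x)

lemma setLIntegral_exp_cappedWeight_le (hI : IsIndependentMarking P unif T p) (n : ℕ∞) (x : ℝ)
    (k : ℕ) {A : Set Ω} (hA : MeasurableSet[MeasurableSpace.comap T inferInstance] A) :
    ∫⁻ ω in A, ENNReal.ofReal (Real.exp (expRate * cappedWeight n beta x k fun i => p i ω)) ∂P ≤
      ENNReal.ofReal (Real.exp 1) * P A := by
  have hΦ := isNonanticipating_expWeight n x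
  have hsuper := hI.supermartingale_functional hΦ (integral_expWeight_update_le n x)
  have hint := fun j => (hI.integrable_functional hΦ j).integrableOn (s := A)
  calc _ ≤ ∫⁻ ω in A, ENNReal.ofReal (expWeight n x k fun i => p i ω) ∂P :=
        lintegral_mono fun ω => ENNReal.ofReal_le_ofReal (exp_cappedWeight_le_expWeight n x k _)
    _ = ENNReal.ofReal (∫ ω in A, expWeight n x k (fun i => p i ω) ∂P) :=
        .symm <| ofReal_integral_eq_lintegral_ofReal (hint k)
          (ae_of_all _ fun _ => (Real.exp_pos _).le)
    _ ≤ ENNReal.ofReal (∫ ω in A, expWeight n x 0 (fun i => p i ω) ∂P) :=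
        ENNReal.ofReal_le_ofReal
          (hsuper.setIntegral_le (Nat.zero_le k) (hI.comap_le_pastFiltration 0 A hA))
    _ ≤ ENNReal.ofReal (∫ _ in A, Real.exp 1 ∂P) :=
        ENNReal.ofReal_le_ofReal (setIntegral_mono (hint 0) (integrable_const _).integrableOn
          fun ω => expWeight_zero_le n x _)
    _ = ENNReal.ofReal (Real.exp 1) * P A := by
        rw [setIntegral_const, smul_eq_mul, mul_comm, ENNReal.ofReal_mul (Real.exp_pos 1).le,
          ofReal_measureReal]

lemma expBounded_cappedWeight (hI : IsIndependentMarking P unif T p) (n : ℕ∞) (x : ℝ) (k : ℕ) :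
    ExpBounded P expRate (Real.exp 1) fun ω => cappedWeight n beta x k fun i => p i ω where
  aestronglyMeasurable :=
    (hI.integrable_functional (isNonanticipating_cappedWeight n beta_pos x) k).aestronglyMeasurable
  nonneg := ae_of_all _ fun _ => cappedWeight_nonneg n beta x k _
  lintegral_exp_le := by
    simpa only [setLIntegral_univ, measure_univ, mul_one] using
      hI.setLIntegral_exp_cappedWeight_le n x k MeasurableSet.univ

lemma lintegral_sq_cappedWeight_sub_le (hI : IsIndependentMarking P unif T p) (x : ℝ)
    (n k : ℕ) :
    ∫⁻ ω, ENNReal.ofReal ((cappedWeight ⊤ beta x k (fun i => p i ω) -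
        cappedWeight n beta x k fun i => p i ω) ^ 2) ∂P ≤
      ENNReal.ofReal ((1 - splitRate (2 * beta))⁻¹ * splitRate (2 * beta) ^ n) := by
  have hΦ := isNonanticipating_capVariance n x
  have hsuper := hI.supermartingale_functional hΦ (integral_capVariance_update_le n x)
  have hmono := hsuper.setIntegral_le (Nat.zero_le k) (MeasurableSet.univ)
  rw [setIntegral_univ, setIntegral_univ] at hmono
  calc _ ≤ ∫⁻ ω, ENNReal.ofReal (capVariance n x k fun i => p i ω) ∂P :=
        lintegral_mono fun ω => ENNReal.ofReal_le_ofReal (sq_sub_le_capVariance n x k _)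
    _ = ENNReal.ofReal (∫ ω, capVariance n x k (fun i => p i ω) ∂P) :=
        (ofReal_integral_eq_lintegral_ofReal (hI.integrable_functional hΦ k)
          (ae_of_all _ fun ω => (sq_nonneg _).trans (sq_sub_le_capVariance n x k _))).symm
    _ ≤ ENNReal.ofReal (∫ ω, capVariance n x 0 (fun i => p i ω) ∂P) :=
        ENNReal.ofReal_le_ofReal hmono
    _ ≤ _ := by
        refine ENNReal.ofReal_le_ofReal ((integral_mono (hI.integrable_functional hΦ 0)
          (integrable_const _) fun ω => capVariance_zero_le n x _).trans_eq ?_)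
        rw [integral_const, probReal_univ, one_smul]

end IsIndependentMarking

/-! ### Completeness of the generations -/

namespace IsIndependentMarking

variable {Ω 𝒯 E : Type*} [MeasurableSpace Ω] [MeasurableSpace 𝒯] [MeasurableSpace E]
  {P : Measure Ω} [IsProbabilityMeasure P] {ν : Measure E} [IsProbabilityMeasure ν] {T : Ω → 𝒯}
  {p : ℕ → Ω → E}

lemma map_marks (hI : IsIndependentMarking P ν T p) :
    P.map (fun ω i => p i ω) = Measure.infinitePi fun _ => ν := by
  have : IsProbabilityMeasure (P.map T) :=
    Measure.isProbabilityMeasure_map hI.measurable_left.aemeasurable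
  have hsnd := congrArg (Measure.map Prod.snd) hI.map_eq
  rwa [Measure.map_map measurable_snd (hI.measurable_left.prodMk hI.measurable_marks),
    Measure.map_snd_prod, measure_univ, one_smul] at hsnd

lemma ae_frequently_mem (hI : IsIndependentMarking P ν T p) {B : Set E} (hB : MeasurableSet B)
    (hνB : ν B ≠ 0) : ∀ᵐ ω ∂P, ∃ᶠ j in atTop, p j ω ∈ B := by
  have hlt : ν Bᶜ < 1 := by
    rw [prob_compl_eq_one_sub hB]
    exact ENNReal.sub_lt_self ENNReal.one_ne_top one_ne_zero hνB
  have havoid : ∀ k m, P {ω | ∀ j ∈ Finset.Ico k (k + m), p j ω ∉ B} = ν Bᶜ ^ m := fun k m => by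
    have hpi : {ω | ∀ j ∈ Finset.Ico k (k + m), p j ω ∉ B} =
        (fun ω i => p i ω) ⁻¹' Set.pi (Finset.Ico k (k + m)) fun _ => Bᶜ := rfl
    rw [hpi, ← Measure.map_apply hI.measurable_marks
      (.pi (Finset.countable_toSet _) fun _ _ => hB.compl), hI.map_marks,
      Measure.infinitePi_pi _ fun _ _ => hB.compl, Finset.prod_const, Nat.card_Ico,
      Nat.add_sub_cancel_left]
  simp only [frequently_atTop, ae_all_iff]
  intro k
  refine ae_iff.2 (le_antisymm (ge_of_tendsto'
    (ENNReal.tendsto_pow_atTop_nhds_zero_of_lt_one hlt) fun m => ?_) zero_le)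
  rw [← havoid k m]
  exact measure_mono fun ω hω j hj hmem => hω ⟨j, (Finset.mem_Ico.1 hj).1, hmem⟩

end IsIndependentMarking

/-- Every non-degenerate subrectangle of the unit square is visited infinitely often. -/
def IsRecurrent (p : ℕ → ℝ × ℝ) : Prop := ∀ R : Rect, R.Proper → ∃ᶠ j in atTop, p j ∈ R.inner

lemma Rect.Proper.unif_inner_ne_zero {R : Rect} (hR : R.Proper) : unif R.inner ≠ 0 := by
  rw [unif, Measure.restrict_apply R.measurableSet_inner, Set.inter_eq_left.2 hR.inner_subset,
    Rect.volume_inner]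
  exact mul_ne_zero (by simpa using hR.left_lt_right) (by simpa using hR.bottom_lt_top)

lemma Rect.Proper.exists_rat_inner_subset {R : Rect} (hR : R.Proper) : ∃ a b c d : ℚ,
    (⟨a, b, c, d⟩ : Rect).Proper ∧ (⟨a, b, c, d⟩ : Rect).inner ⊆ R.inner := by
  obtain ⟨a, hla, har⟩ := exists_rat_btwn hR.left_lt_right
  obtain ⟨b, hab, hbr⟩ := exists_rat_btwn har
  obtain ⟨c, hbc, hct⟩ := exists_rat_btwn hR.bottom_lt_top
  obtain ⟨d, hcd, hdt⟩ := exists_rat_btwn hct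
  exact ⟨a, b, c, d, ⟨hR.left_nonneg.trans hla.le, hab, hbr.le.trans hR.right_le_one,
    hR.bottom_nonneg.trans hbc.le, hcd, hdt.le.trans hR.top_le_one⟩,
    Set.prod_mono (Set.Ioo_subset_Ioo hla.le hbr.le) (Set.Ioo_subset_Ioo hbc.le hdt.le)⟩

lemma IsIndependentMarking.ae_isRecurrent {Ω 𝒯 : Type*} [MeasurableSpace Ω]
    [MeasurableSpace 𝒯] {P : Measure Ω} [IsProbabilityMeasure P] {T : Ω → 𝒯} {p : ℕ → Ω → ℝ × ℝ}
    (hI : IsIndependentMarking P unif T p) : ∀ᵐ ω ∂P, IsRecurrent fun i => p i ω := by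
  have hrat : ∀ᵐ ω ∂P, ∀ a b c d : ℚ, (⟨a, b, c, d⟩ : Rect).Proper →
      ∃ᶠ j in atTop, p j ω ∈ (⟨a, b, c, d⟩ : Rect).inner := by
    simp only [ae_all_iff]
    exact fun a b c d hR =>
      hI.ae_frequently_mem (Rect.measurableSet_inner _) hR.unif_inner_ne_zero
  filter_upwards [hrat] with ω hω R hR
  obtain ⟨a, b, c, d, hR', hsub⟩ := hR.exists_rat_inner_subset
  exact (hω a b c d hR').mono fun j hj => hsub hj

section Generations

variable {p : ℕ → ℝ × ℝ} {k n : ℕ} {c : Cell}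

lemma mem_cappedCells_of_mem_cappedCells_succ {n : ℕ∞} (hc : c ∈ cappedCells n p (k + 1))
    (hle : ∀ d ∈ cappedCells n p k, c.1.length ≤ d.1.length) :
    c ∈ cappedCells n p k ∧ ¬ IsSplit n (p k) c := by
  obtain ⟨d, hd, hcd⟩ := mem_cappedCells_succ.1 hc
  rcases mem_cappedStep.1 hcd with ⟨-, j, rfl⟩ | ⟨hsplit, rfl⟩
  · exact absurd (hle d hd) (by simp only [length_child]; omega)
  · exact ⟨hd, hsplit⟩

lemma eventually_notMem_cappedCells_of_frequently_mem_inner {n : ℕ∞} (hcn : c.1.length < n)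
    (hle : ∀ᶠ k in atTop, ∀ d ∈ cappedCells n p k, c.1.length ≤ d.1.length)
    (hvisit : ∃ᶠ j in atTop, p j ∈ c.2.inner) : ∀ᶠ k in atTop, c ∉ cappedCells n p k := by
  obtain ⟨K, hK⟩ := eventually_atTop.1 hle
  obtain ⟨j, hKj, hj⟩ := frequently_atTop.1 hvisit K
  refine eventually_atTop.2 ⟨j + 1, fun k hk => ?_⟩
  induction k, hk using Nat.le_induction with
  | base =>
    exact fun hc => (mem_cappedCells_of_mem_cappedCells_succ hc (hK j hKj)).2 ⟨hcn, hj⟩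
  | succ k hk ih =>
    exact fun hc => ih (mem_cappedCells_of_mem_cappedCells_succ hc (hK k (by omega))).1

lemma IsRecurrent.eventually_le_length (hp : IsRecurrent p) {m : ℕ} (hmn : m ≤ n) :
    ∀ᶠ k in atTop, ∀ c ∈ cappedCells n p k, m ≤ c.1.length := by
  induction m with
  | zero => exact Eventually.of_forall fun k c _ => Nat.zero_le _
  | succ m ih =>
    have hle := ih (Nat.le_of_succ_le hmn)
    obtain ⟨K, hK⟩ := eventually_atTop.1 hle
    have hsplit : ∀ᶠ k in atTop, ∀ c ∈ cappedCells n p K, c.1.length = m →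
        c ∉ cappedCells n p k := by
      refine (Finset.eventually_all _).2 fun c hc => eventually_imp_distrib_left.2 fun hcm => ?_
      exact eventually_notMem_cappedCells_of_frequently_mem_inner
        (Nat.cast_lt.2 (hcm.trans_lt hmn)) (hcm ▸ hle)
        (hp c.2 ((isPacking_cappedCells n p K).proper c hc))
    have hold : ∀ k, K ≤ k → ∀ c ∈ cappedCells n p k, c.1.length = m → c ∈ cappedCells n p K := by
      intro k hk c hc hcm
      induction k, hk using Nat.le_induction with
      | base => exact hc
      | succ k hk ih =>
        exact ih (mem_cappedCells_of_mem_cappedCells_succ hc (hcm ▸ hK k hk)).1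
    filter_upwards [hsplit, eventually_ge_atTop K] with k hk hKk c hc
    exact (hK k hKk c hc).lt_of_ne' fun hcm => hk c (hold k hKk c hc hcm) hcm hc

lemma cappedCells_eq_of_forall_le_length (hK : ∀ c ∈ cappedCells n p k, n ≤ c.1.length) {l : ℕ}
    (hkl : k ≤ l) : cappedCells n p l = cappedCells n p k := by
  induction l, hkl using Nat.le_induction with
  | base => rfl
  | succ l _ ih =>
    rw [cappedCells_succ_of_forall_not_isSplit fun c hc hsplit => ?_, ih]
    exact (hK c (ih ▸ hc)).not_gt (Nat.cast_lt.1 hsplit.1)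

lemma mem_cappedCells_iff_of_forall_le_length (hk : ∀ d ∈ cappedCells n p k, n ≤ d.1.length) :
    c ∈ cappedCells n p k ↔ (∃ j, c ∈ cellsAfter p j) ∧ c.1.length = n := by
  refine ⟨fun hc => ?_, fun ⟨⟨j, hj⟩, hcn⟩ => ?_⟩
  · obtain ⟨j, -, hj⟩ := exists_le_mem_cellsAfter_of_mem_cappedCells hc
    exact ⟨⟨j, hj⟩, (Nat.cast_le.1 (length_le_of_mem_cappedCells hc)).antisymm (hk c hc)⟩
  · have hc : c ∈ cappedCells n p j :=
      mem_cappedCells_of_mem_cellsAfter (Nat.cast_le.2 hcn.le) hj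
    rw [← cappedCells_eq_of_forall_le_length hk (le_max_right j k)]
    exact mem_cappedCells_of_le (Nat.cast_le.2 hcn.ge) hc (le_max_left j k)

lemma sum_filter_weight {ι : Type*} {s : Finset ι} {R : ι → Rect} (hs : ∀ i ∈ s, (R i).Proper)
    (x : ℝ) [DecidablePred fun i => (R i).IsAbove x] :
    ∑ i ∈ s with (R i).IsAbove x, (R i).weight x = ∑ i ∈ s, (R i).powWeight beta x := by
  rw [Finset.sum_filter]
  refine Finset.sum_congr rfl fun i hi => ?_
  split_ifs with h
  · exact (hs i hi).weight_eq_powWeight h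
  · exact (powWeight_of_not_isAbove beta_pos h).symm

lemma IsRecurrent.eventually_cappedWeight_eq_Mgen (hp : IsRecurrent p) (x : ℝ) (n : ℕ) :
    ∀ᶠ k in atTop, cappedWeight n beta x k p = Mgen p x n := by
  classical
  filter_upwards [hp.eventually_le_length (le_refl n)] with k hk
  have hgen : generationAbove p x n = ↑{c ∈ cappedCells n p k | c.2.IsAbove x} := by
    ext c
    simp only [generationAbove, Set.mem_ofPred_eq, Finset.coe_filter,
      mem_cappedCells_iff_of_forall_le_length hk, and_assoc]
  rw [Mgen, hgen, finsum_mem_coe_finset,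
    sum_filter_weight (isPacking_cappedCells n p k).proper]
  rfl

end Generations

/-! ### The covering as a measurable function of the atoms -/

/-- Exactly `k` of the times are at most `t`. This is stronger than `numAtoms τ t = k`, since
`numAtoms τ t = 0` when infinitely many of the times are at most `t`. -/
def HasAtoms (t : ℝ≥0) (k : ℕ) (τ : ℕ → ℝ) : Prop := {i | τ i ≤ t}.encard = k

lemma HasAtoms.numAtoms_eq {t : ℝ≥0} {k : ℕ} {τ : ℕ → ℝ} (hk : HasAtoms t k τ) :
    numAtoms τ t = k := by
  rw [numAtoms, Set.ncard, show {i | τ i ≤ t}.encard = k from hk, ENat.toNat_natCast]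

lemma HasAtoms.numAtoms_le {t u : ℝ≥0} (hut : u ≤ t) {k : ℕ} {τ : ℕ → ℝ} (hk : HasAtoms t k τ) :
    numAtoms τ u ≤ k := by
  rw [← hk.numAtoms_eq]
  exact Set.ncard_le_ncard (fun i (hi : τ i ≤ u) => hi.trans (NNReal.coe_le_coe.2 hut))
    (Set.finite_of_encard_eq_coe hk)

lemma hasAtoms_numAtoms {t : ℝ≥0} {τ : ℕ → ℝ} (hfin : {i | τ i ≤ t}.Finite) :
    HasAtoms t (numAtoms τ t) τ :=
  hfin.cast_ncard_eq.symm

lemma measurable_setOf_le (t : ℝ≥0) : Measurable fun τ : ℕ → ℝ => {i | τ i ≤ t} :=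
  measurable_set_iff.2 fun i =>
    measurableSet_setOfPred.1 (measurableSet_le (measurable_pi_apply i) measurable_const)

lemma measurableSet_hasAtoms (t : ℝ≥0) (k : ℕ) : MeasurableSet {τ : ℕ → ℝ | HasAtoms t k τ} :=
  (measurable_encard.comp (measurable_setOf_le t)) (measurableSet_singleton (k : ℕ∞))

lemma measurable_numAtoms (t : ℝ≥0) : Measurable fun τ : ℕ → ℝ => numAtoms τ t :=
  measurable_ncard.comp (measurable_setOf_le t)

open Classical in
lemma sum_quad {A : Type*} [AddCommMonoid A] (τ : ℕ → ℝ) (p : ℕ → ℝ × ℝ) (t : ℝ≥0) (g : Rect → A) :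
    ∑ R ∈ quad τ p t, g R = ∑ c ∈ cellsAfter p (numAtoms τ t), g c.2 :=
  Finset.sum_image (isPacking_cellsAfter p _).injOn_snd

lemma proper_of_mem_quad {τ : ℕ → ℝ} {p : ℕ → ℝ × ℝ} {t : ℝ≥0} {R : Rect} (hR : R ∈ quad τ p t) :
    R.Proper := by
  classical
  obtain ⟨c, hc, rfl⟩ := Finset.mem_image.1 hR
  exact (isPacking_cellsAfter p _).proper c hc

open Classical in
lemma measurable_rectFinsetSigma_iff {Z : Type*} [MeasurableSpace Z] {s : Z → Finset Rect} :
    Measurable[_, rectFinsetSigma] s ↔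
      ∀ B, MeasurableSet B → Measurable fun z => ((s z).filter (· ∈ B)).card := by
  simp only [measurable_iff_comap_le, rectFinsetSigma, MeasurableSpace.comap_iSup,
    MeasurableSpace.comap_comp, iSup_le_iff, Subtype.forall]
  rfl

lemma measurable_quad {Z : Type*} [MeasurableSpace Z] {τ : Z → ℕ → ℝ} {p : Z → ℕ → ℝ × ℝ}
    (hτ : Measurable τ) (hp : ∀ i, Measurable fun z => p z i) (t : ℝ≥0) :
    Measurable[_, rectFinsetSigma] fun z => quad (τ z) (p z) t := by
  classical
  refine measurable_rectFinsetSigma_iff.2 fun B hB => ?_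
  have hcard : ∀ k, Measurable fun z =>
      ∑ c ∈ cappedCells ⊤ (p z) k, if c.2 ∈ B then (1 : ℝ) else 0 := fun k =>
    measurable_sum_cappedCells ⊤ hp k (fun _ _ R => if R ∈ B then 1 else 0) fun _ =>
      .ite (measurable_snd hB) measurable_const measurable_const
  have hfloor : (fun z => ((quad (τ z) (p z) t).filter (· ∈ B)).card) = fun z =>
      ⌊∑ c ∈ cappedCells ⊤ (p z) (numAtoms (τ z) t), if c.2 ∈ B then (1 : ℝ) else 0⌋₊ :=
    funext fun z => by
      rw [cappedCells_top, ← sum_quad (τ z) (p z) t fun R => if R ∈ B then (1 : ℝ) else 0,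
        Finset.sum_boole, Nat.floor_natCast]
  rw [hfloor]
  exact Nat.measurable_floor.comp ((measurable_from_prod_countable_right
    (f := fun y : ℕ × Z => ∑ c ∈ cappedCells ⊤ (p y.2) y.1, if c.2 ∈ B then (1 : ℝ) else 0)
    hcard).comp (((measurable_numAtoms t).comp hτ).prodMk measurable_id))

-- The sum is the integral of `g` with respect to the counting measure of the finite set.
lemma measurable_sum_rect {g : Rect → ℝ≥0∞} (hg : Measurable g) :
    Measurable[rectFinsetSigma] fun s : Finset Rect => ∑ R ∈ s, g R := by
  classical
  let _ : MeasurableSpace (Finset Rect) := rectFinsetSigma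
  have hcard := measurable_rectFinsetSigma_iff.1 (measurable_id (α := Finset Rect))
  have hcounting : Measurable fun s : Finset Rect => ∑ R ∈ s, Measure.dirac R := by
    refine Measure.measurable_of_measurable_coe _ fun B hB => ?_
    simpa [Measure.dirac_apply' _ hB, Set.indicator_apply, Finset.sum_ite, Function.comp_def] using
      measurable_from_nat (f := ((↑) : ℕ → ℝ≥0∞)) |>.comp (hcard B hB)
  simpa only [Function.comp_def, lintegral_finsetSum_measure, lintegral_dirac' _ hg] using
    (Measure.measurable_lintegral hg).comp hcounting

lemma M_eq_sum_powWeight (τ : ℕ → ℝ) (p : ℕ → ℝ × ℝ) (x : ℝ) (t : ℝ≥0) :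
    M τ p x t = ∑ R ∈ quad τ p t, R.powWeight beta x :=
  open Classical in sum_filter_weight (fun _ => proper_of_mem_quad) x

lemma M_eq_cappedWeight (τ : ℕ → ℝ) (p : ℕ → ℝ × ℝ) (x : ℝ) (t : ℝ≥0) :
    M τ p x t = cappedWeight ⊤ beta x (numAtoms τ t) p := by
  rw [M_eq_sum_powWeight, sum_quad, ← cappedCells_top, cappedWeight]

lemma M_nonneg (τ : ℕ → ℝ) (p : ℕ → ℝ × ℝ) (x : ℝ) (t : ℝ≥0) : 0 ≤ M τ p x t := by
  rw [M_eq_cappedWeight]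
  exact cappedWeight_nonneg _ _ _ _ _

section History

variable {Ω : Type*} {τ : ℕ → Ω → ℝ} {p : ℕ → Ω → ℝ × ℝ}

lemma measurable_history_quad (τ : ℕ → Ω → ℝ) (p : ℕ → Ω → ℝ × ℝ) {u t : ℝ≥0} (hut : u ≤ t) :
    Measurable[history τ p t, rectFinsetSigma]
      fun ω => quad (fun i => τ i ω) (fun i => p i ω) u :=
  measurable_iff_comap_le.2 (le_iSup (fun v : {v : ℝ≥0 // v ≤ t} => MeasurableSpace.comap
    (fun ω => quad (fun i => τ i ω) (fun i => p i ω) v.1) rectFinsetSigma) ⟨u, hut⟩)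

lemma measurable_M (τ : ℕ → Ω → ℝ) (p : ℕ → Ω → ℝ × ℝ) (x : ℝ) (t : ℝ≥0) :
    Measurable[history τ p t] fun ω => M (fun i => τ i ω) (fun i => p i ω) x t := by
  have htoReal : ∀ ω, M (fun i => τ i ω) (fun i => p i ω) x t = (∑ R ∈ quad (fun i => τ i ω)
      (fun i => p i ω) t, ENNReal.ofReal (R.powWeight beta x)).toReal := fun ω => by
    have hnonneg : ∀ R ∈ quad (fun i => τ i ω) (fun i => p i ω) t, 0 ≤ R.powWeight beta x :=
      fun R hR => (proper_of_mem_quad hR).powWeight_nonneg beta x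
    rw [M_eq_sum_powWeight, ← ENNReal.ofReal_sum_of_nonneg hnonneg,
      ENNReal.toReal_ofReal (Finset.sum_nonneg hnonneg)]
  simp only [htoReal]
  exact ENNReal.measurable_toReal.comp ((measurable_sum_rect
    (measurable_powWeight beta x).ennreal_ofReal).comp (measurable_history_quad τ p le_rfl))

/-- The filtration generated by the coverings. -/
noncomputable def quadFiltration [mΩ : MeasurableSpace Ω] (hτ : Measurable fun ω i => τ i ω)
    (hp : ∀ i, Measurable (p i)) : Filtration ℝ≥0 mΩ where
  seq t := history τ p t
  mono' _ _ hst := iSup_le fun u => (measurable_history_quad τ p (u.2.trans hst)).comap_le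
  le' _ := iSup_le fun u => (measurable_quad hτ hp u.1).comap_le

-- With `k` atoms up to time `t`, the coverings up to `t` do not change when the points from the
-- `k`-th on are replaced by the origin.
lemma measurableSet_history_inter_hasAtoms [MeasurableSpace Ω] (hτ : Measurable fun ω i => τ i ω)
    {k : ℕ} (hp : ∀ i < k, Measurable (p i)) {t : ℝ≥0} {A : Set Ω}
    (hA : MeasurableSet[history τ p t] A) :
    MeasurableSet (A ∩ {ω | HasAtoms t k fun i => τ i ω}) := by
  set E := {ω | HasAtoms t k fun i => τ i ω}
  let p' : ℕ → Ω → ℝ × ℝ := fun i ω => if i < k then p i ω else 0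
  have hp' : ∀ i, Measurable (p' i) := fun i => by
    by_cases hi : i < k
    · simpa only [p', if_pos hi] using hp i hi
    · simpa only [p', if_neg hi] using measurable_const
  have hquad : ∀ u : {u : ℝ≥0 // u ≤ t}, ∀ ω : E,
      quad (fun i => τ i ω) (fun i => p i ω) u = quad (fun i => τ i ω) (fun i => p' i ω) u :=
    fun u ω => by
      have hlt : ∀ i < numAtoms (fun i => τ i ω) u, i < k := fun i hi =>
        hi.trans_le (HasAtoms.numAtoms_le u.2 ω.2)
      have hcells := cappedCells_congr ⊤ (p := fun i => p i ω) (p' := fun i => p' i ω)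
        fun i hi => (if_pos (hlt i hi)).symm
      rw [quad, quad, ← cappedCells_top, hcells, cappedCells_top]
  have hle : (history τ p t).comap ((↑) : E → Ω) ≤ Subtype.instMeasurableSpace := by
    rw [history, MeasurableSpace.comap_iSup]
    refine iSup_le fun u => ?_
    rw [MeasurableSpace.comap_comp]
    refine Measurable.comap_le ?_
    simp only [Function.comp_def, hquad u]
    exact (measurable_quad hτ hp' u).comp measurable_subtype_coe
  rw [Set.inter_comm, ← Subtype.image_preimage_coe]
  exact (hτ (measurableSet_hasAtoms t k)).subtype_image (hle _ ⟨A, hA, rfl⟩)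

end History

/-! ### The limit of the weights -/

/-- The limit of the weight of the quadtree above `x` as the number of inserted points tends to
infinity. -/
noncomputable def limitWeight {Ω : Type*} (p : ℕ → Ω → ℝ × ℝ) (x : ℝ) (ω : Ω) : ℝ :=
  limUnder atTop fun k => cappedWeight ⊤ beta x k fun i => p i ω

namespace IsIndependentMarking

variable {Ω 𝒯 : Type*} [MeasurableSpace Ω] [MeasurableSpace 𝒯] {P : Measure Ω}
  [IsProbabilityMeasure P] {T : Ω → 𝒯} {p : ℕ → Ω → ℝ × ℝ}

lemma ae_tendsto_cappedWeight_Mgen (hI : IsIndependentMarking P unif T p) (x : ℝ) (n : ℕ) :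
    ∀ᵐ ω ∂P, Tendsto (fun k => cappedWeight n beta x k fun i => p i ω) atTop
      (𝓝 (Mgen (fun i => p i ω) x n)) :=
  hI.ae_isRecurrent.mono fun _ hω =>
    tendsto_const_nhds.congr' ((hω.eventually_cappedWeight_eq_Mgen x n).mono fun _ => Eq.symm)

lemma expBounded_Mgen (hI : IsIndependentMarking P unif T p) (x : ℝ) (n : ℕ) :
    ExpBounded P expRate (Real.exp 1) fun ω => Mgen (fun i => p i ω) x n :=
  .of_tendsto_ae (hI.expBounded_cappedWeight n x) (hI.ae_tendsto_cappedWeight_Mgen x n)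

lemma ae_tendsto_limitWeight (hI : IsIndependentMarking P unif T p) (x : ℝ) :
    ∀ᵐ ω ∂P, Tendsto (fun k => cappedWeight ⊤ beta x k fun i => p i ω) atTop
      (𝓝 (limitWeight p x ω)) := by
  obtain ⟨C, hC⟩ := ExpBounded.exists_eLpNorm_le (P := P) expRate_pos (Real.exp 1) one_ne_zero
    ENNReal.one_ne_top
  exact ((hI.martingale_cappedWeight ⊤ x).submartingale.exists_ae_tendsto_of_bdd
    fun k => hC _ (hI.expBounded_cappedWeight ⊤ x k)).mono fun _ => tendsto_nhds_limUnder

lemma expBounded_limitWeight (hI : IsIndependentMarking P unif T p) (x : ℝ) :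
    ExpBounded P expRate (Real.exp 1) (limitWeight p x) :=
  .of_tendsto_ae (hI.expBounded_cappedWeight ⊤ x) (hI.ae_tendsto_limitWeight x)

lemma integrable_limitWeight (hI : IsIndependentMarking P unif T p) (x : ℝ) :
    Integrable (limitWeight p x) P :=
  memLp_one_iff_integrable.1
    ((hI.expBounded_limitWeight x).memLp expRate_pos one_ne_zero ENNReal.one_ne_top)

lemma cappedWeight_ae_eq_condExp (hI : IsIndependentMarking P unif T p) (x : ℝ) (k : ℕ) :
    (fun ω => cappedWeight ⊤ beta x k fun i => p i ω) =ᵐ[P]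
      P[limitWeight p x | hI.pastFiltration k] :=
  (hI.martingale_cappedWeight ⊤ x).eq_condExp_of_tendsto_eLpNorm (hI.integrable_limitWeight x)
    (ExpBounded.tendsto_eLpNorm_sub expRate_pos (hI.expBounded_cappedWeight ⊤ x)
      (hI.ae_tendsto_limitWeight x) le_rfl ENNReal.one_ne_top) k

lemma lintegral_sq_limitWeight_sub_le (hI : IsIndependentMarking P unif T p) (x : ℝ) (n : ℕ) :
    ∫⁻ ω, ENNReal.ofReal ((limitWeight p x ω - Mgen (fun i => p i ω) x n) ^ 2) ∂P ≤
      ENNReal.ofReal ((1 - splitRate (2 * beta))⁻¹ * splitRate (2 * beta) ^ n) := by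
  refine lintegral_le_of_ae_tendsto (fun k => ?_) (hI.lintegral_sq_cappedWeight_sub_le x n) ?_
  · have hsub := (hI.expBounded_cappedWeight ⊤ x k).aestronglyMeasurable.sub
      (hI.expBounded_cappedWeight n x k).aestronglyMeasurable
    exact (hsub.aemeasurable.pow_const 2).ennreal_ofReal
  · filter_upwards [hI.ae_tendsto_limitWeight x, hI.ae_tendsto_cappedWeight_Mgen x n] with ω h h'
    exact (ENNReal.continuous_ofReal.tendsto _).comp ((h.sub h').pow 2)

lemma ae_tendsto_Mgen (hI : IsIndependentMarking P unif T p) (x : ℝ) :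
    ∀ᵐ ω ∂P, Tendsto (fun n => Mgen (fun i => p i ω) x n) atTop (𝓝 (limitWeight p x ω)) := by
  refine ae_tendsto_of_tsum_lintegral_sq_sub_ne_top
    (fun n => (hI.expBounded_Mgen x n).aestronglyMeasurable.aemeasurable)
    (hI.expBounded_limitWeight x).aestronglyMeasurable.aemeasurable
    (ne_top_of_le_ne_top ?_ (ENNReal.tsum_le_tsum (hI.lintegral_sq_limitWeight_sub_le x)))
  rw [← ENNReal.ofReal_tsum_of_nonneg]
  · exact ENNReal.ofReal_ne_top
  · exact fun n =>
      mul_nonneg inv_one_sub_splitRate_pos.le (pow_nonneg splitRate_two_mul_beta_pos.le n)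
  · exact (summable_geometric_of_lt_one splitRate_two_mul_beta_pos.le
      splitRate_two_mul_beta_lt_one).mul_left _

end IsIndependentMarking

/-! ### The continuous-time process -/

lemma tendsto_numAtoms {τ : ℕ → ℝ} (hfin : ∀ t : ℝ≥0, {i | τ i ≤ t}.Finite) :
    Tendsto (numAtoms τ) atTop atTop := by
  refine tendsto_atTop.2 fun b => ?_
  have hle : ∀ᶠ t : ℝ≥0 in atTop, ∀ i ∈ Finset.range b, τ i ≤ t :=
    (Finset.eventually_all _).2 fun i _ =>
      (eventually_ge_atTop (τ i).toNNReal).mono fun t => Real.toNNReal_le_iff_le_coe.1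
  filter_upwards [hle] with t ht
  have hcard := Set.ncard_le_ncard (s := (Finset.range b : Set ℕ)) ht (hfin t)
  rwa [Set.ncard_coe_finset, Finset.card_range] at hcard

section HasAtoms

variable {Ω : Type*} [MeasurableSpace Ω] {P : Measure Ω} {τ : ℕ → Ω → ℝ} {t : ℝ≥0}

lemma sum_restrict_hasAtoms (hτ : Measurable fun ω i => τ i ω)
    (hfin : ∀ᵐ ω ∂P, {i | τ i ω ≤ t}.Finite) :
    Measure.sum (fun k => P.restrict {ω | HasAtoms t k fun i => τ i ω}) = P := by
  have hdisj : Pairwise (Function.onFun Disjoint fun k => {ω | HasAtoms t k fun i => τ i ω}) :=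
    fun k l hkl => Set.disjoint_left.2 fun ω hk hl =>
      hkl ((HasAtoms.numAtoms_eq hk).symm.trans (HasAtoms.numAtoms_eq hl))
  rw [← Measure.restrict_iUnion hdisj fun k => hτ (measurableSet_hasAtoms t k)]
  exact Measure.restrict_eq_self_of_ae_mem
    (hfin.mono fun ω hω => Set.mem_iUnion.2 ⟨_, hasAtoms_numAtoms hω⟩)

lemma setIntegral_eq_of_forall_inter_hasAtoms (hτ : Measurable fun ω i => τ i ω)
    (hfin : ∀ᵐ ω ∂P, {i | τ i ω ≤ t}.Finite) {A : Set Ω} {f g : Ω → ℝ}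
    (hf : IntegrableOn f A P) (hg : IntegrableOn g A P)
    (hfg : ∀ k, ∫ ω in A ∩ {ω | HasAtoms t k fun i => τ i ω}, f ω ∂P =
      ∫ ω in A ∩ {ω | HasAtoms t k fun i => τ i ω}, g ω ∂P) :
    ∫ ω in A, f ω ∂P = ∫ ω in A, g ω ∂P := by
  have hE : ∀ k, MeasurableSet {ω | HasAtoms t k fun i => τ i ω} := fun k =>
    hτ (measurableSet_hasAtoms t k)
  have hsum := sum_restrict_hasAtoms hτ (ae_restrict_of_ae (s := A) hfin)
  simp only [Measure.restrict_restrict (hE _), Set.inter_comm _ A] at hsum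
  rw [IntegrableOn, ← hsum] at hf hg
  rw [← hsum, integral_sum_measure hf, integral_sum_measure hg]
  exact tsum_congr hfg

end HasAtoms

namespace IsIndependentMarking

variable {Ω : Type*} [MeasurableSpace Ω] {P : Measure Ω} [IsProbabilityMeasure P]
  {τ : ℕ → Ω → ℝ} {p : ℕ → Ω → ℝ × ℝ}

lemma expBounded_M (hI : IsIndependentMarking P unif (fun ω i => τ i ω) p) (x : ℝ) {t : ℝ≥0}
    (hfin : ∀ᵐ ω ∂P, {i | τ i ω ≤ t}.Finite) :
    ExpBounded P expRate (Real.exp 1) fun ω => M (fun i => τ i ω) (fun i => p i ω) x t where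
  aestronglyMeasurable := ((measurable_M τ p x t).mono
    ((quadFiltration hI.measurable_left hI.measurable_mark).le t) le_rfl).aestronglyMeasurable
  nonneg := ae_of_all _ fun _ => M_nonneg _ _ x t
  lintegral_exp_le := by
    have hsum := sum_restrict_hasAtoms hI.measurable_left hfin
    set E := fun k => {ω | HasAtoms t k fun i => τ i ω}
    calc _ = ∑' k, ∫⁻ ω in E k, ENNReal.ofReal (Real.exp (expRate *
          M (fun i => τ i ω) (fun i => p i ω) x t)) ∂P := by
          rw [← lintegral_sum_measure, hsum]
      _ = ∑' k, ∫⁻ ω in E k, ENNReal.ofReal (Real.exp (expRate *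
          cappedWeight ⊤ beta x k fun i => p i ω)) ∂P := by
          refine tsum_congr fun k => setLIntegral_congr_fun
            (hI.measurable_left (measurableSet_hasAtoms t k)) fun ω hω => ?_
          simp only [M_eq_cappedWeight, HasAtoms.numAtoms_eq hω]
      _ ≤ ∑' k, ENNReal.ofReal (Real.exp 1) * P (E k) :=
          ENNReal.tsum_le_tsum fun k => hI.setLIntegral_exp_cappedWeight_le ⊤ x k
            ⟨_, measurableSet_hasAtoms t k, rfl⟩
      _ = ENNReal.ofReal (Real.exp 1) * ∑' k, P.restrict (E k) Set.univ := by
          simp only [Measure.restrict_apply_univ, ENNReal.tsum_mul_left]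
      _ = ENNReal.ofReal (Real.exp 1) := by
          rw [← Measure.sum_apply _ MeasurableSet.univ, hsum, measure_univ, mul_one]

lemma M_ae_eq_condExp (hI : IsIndependentMarking P unif (fun ω i => τ i ω) p) (x : ℝ) {t : ℝ≥0}
    (hfin : ∀ᵐ ω ∂P, {i | τ i ω ≤ t}.Finite) :
    (fun ω => M (fun i => τ i ω) (fun i => p i ω) x t) =ᵐ[P]
      P[limitWeight p x | quadFiltration hI.measurable_left hI.measurable_mark t] := by
  have hle := (quadFiltration hI.measurable_left hI.measurable_mark).le t
  have hM : Integrable (fun ω => M (fun i => τ i ω) (fun i => p i ω) x t) P :=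
    memLp_one_iff_integrable.1
      ((hI.expBounded_M x hfin).memLp expRate_pos one_ne_zero ENNReal.one_ne_top)
  have hlim := hI.integrable_limitWeight x
  refine ae_eq_condExp_of_forall_setIntegral_eq hle hlim (fun _ _ _ => hM.integrableOn)
    (fun A hA _ => ?_) (measurable_M τ p x t).stronglyMeasurable.aestronglyMeasurable
  refine setIntegral_eq_of_forall_inter_hasAtoms hI.measurable_left hfin hM.integrableOn
    hlim.integrableOn fun k => ?_
  set E := {ω | HasAtoms t k fun i => τ i ω}
  have hpast : Measurable[hI.pastFiltration k] (past (fun ω i => τ i ω) p k) := comap_measurable _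
  have hAE : MeasurableSet[hI.pastFiltration k] (A ∩ E) :=
    @measurableSet_history_inter_hasAtoms Ω τ p (hI.pastFiltration k) (measurable_fst.comp hpast) k
      (fun i hi => (measurable_pi_apply (⟨i, hi⟩ : Fin k)).comp (measurable_snd.comp hpast)) t A hA
  calc ∫ ω in A ∩ E, M (fun i => τ i ω) (fun i => p i ω) x t ∂P
      = ∫ ω in A ∩ E, cappedWeight ⊤ beta x k (fun i => p i ω) ∂P := by
        refine setIntegral_congr_fun (hI.pastFiltration.le k _ hAE) fun ω hω => ?_
        simp only [M_eq_cappedWeight, HasAtoms.numAtoms_eq hω.2]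
    _ = ∫ ω in A ∩ E, (P[limitWeight p x | hI.pastFiltration k]) ω ∂P :=
        integral_congr_ae (ae_restrict_of_ae (hI.cappedWeight_ae_eq_condExp x k))
    _ = ∫ ω in A ∩ E, limitWeight p x ω ∂P :=
        setIntegral_condExp (hI.pastFiltration.le k) hlim hAE

lemma ae_tendsto_M (hI : IsIndependentMarking P unif (fun ω i => τ i ω) p) (x : ℝ)
    (hfin : ∀ᵐ ω ∂P, ∀ t : ℝ≥0, {i | τ i ω ≤ t}.Finite) :
    ∀ᵐ ω ∂P, Tendsto (fun t => M (fun i => τ i ω) (fun i => p i ω) x t) atTop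
      (𝓝 (limitWeight p x ω)) := by
  filter_upwards [hfin, hI.ae_tendsto_limitWeight x] with ω hω hlim
  simp only [M_eq_cappedWeight]
  exact hlim.comp (tendsto_numAtoms hω)

lemma martingale_M (hI : IsIndependentMarking P unif (fun ω i => τ i ω) p) (x : ℝ)
    (hfin : ∀ t : ℝ≥0, ∀ᵐ ω ∂P, {i | τ i ω ≤ t}.Finite) :
    Martingale (fun t ω => M (fun i => τ i ω) (fun i => p i ω) x t)
      (quadFiltration hI.measurable_left hI.measurable_mark) P :=
  ⟨fun t => (measurable_M τ p x t).stronglyMeasurable, fun s t hst =>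
    (condExp_congr_ae (hI.M_ae_eq_condExp x (hfin t))).trans
      ((condExp_condExp_of_le (Filtration.mono _ hst) (Filtration.le _ t)).trans
        (hI.M_ae_eq_condExp x (hfin s)).symm)⟩

end IsIndependentMarking

lemma intensity_eq_prod : intensity = (volume.restrict (Set.Ici 0)).prod unif := by
  rw [intensity, unif, Measure.prod_restrict]
  rfl

lemma ae_finite_atoms {Ω : Type*} [MeasurableSpace Ω] {P : Measure Ω}
    {N : Ω → Measure (ℝ × ℝ × ℝ)} (hN : IsPoissonPointProcess N intensity P) {τ : ℕ → Ω → ℝ}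
    {p : ℕ → Ω → ℝ × ℝ}
    (hatoms : ∀ᵐ ω ∂P, N ω = Measure.sum fun i => Measure.dirac (τ i ω, p i ω)) :
    ∀ᵐ ω ∂P, ∀ t : ℝ≥0, {i | τ i ω ≤ t}.Finite := by
  have hS : ∀ n : ℕ, MeasurableSet (Set.Iic (n : ℝ) ×ˢ (Set.univ : Set (ℝ × ℝ))) := fun n =>
    measurableSet_Iic.prod .univ
  have hS_fin : ∀ n : ℕ, intensity (Set.Iic (n : ℝ) ×ˢ (Set.univ : Set (ℝ × ℝ))) ≠ ∞ := fun n => by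
    rw [intensity_eq_prod, Measure.prod_prod, measure_univ, mul_one,
      Measure.restrict_apply measurableSet_Iic, Set.Iic_inter_Ici, Real.volume_Icc]
    exact ENNReal.ofReal_ne_top
  filter_upwards [ae_all_iff.2 fun n => hN.ae_count_ne_top (hS n) (hS_fin n), hatoms]
    with ω hcount hω t
  obtain ⟨n, hn⟩ := exists_nat_ge (t : ℝ)
  have hcard := hcount n
  rw [hω, sum_dirac_apply _ (hS n)] at hcard
  refine (Set.encard_ne_top_iff.1 (by simpa using hcard)).subset fun i (hi : τ i ω ≤ t) => ?_
  simpa using hi.trans hn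

end Quadtree

theorem proposition3_general {Ω : Type*} [mΩ : MeasurableSpace Ω] (P : Measure Ω)
    [IsProbabilityMeasure P] (τ : ℕ → Ω → ℝ) (p : ℕ → Ω → ℝ × ℝ)
    (hI : Quadtree.IsIndependentMarking P Quadtree.unif (fun ω i => τ i ω) p)
    (hfin : ∀ᵐ ω ∂P, ∀ t : ℝ≥0, {i | τ i ω ≤ t}.Finite) (x : ℝ) :
    let ℱ := Quadtree.quadFiltration hI.measurable_left hI.measurable_mark
    let M : ℝ≥0 → Ω → ℝ := fun t ω => Quadtree.M (fun i => τ i ω) (fun i => p i ω) x t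
    let Mgen : ℕ → Ω → ℝ := fun n ω => Quadtree.Mgen (fun i => p i ω) x n
    (∀ t ω, 0 ≤ M t ω) ∧
    Martingale M ℱ P ∧
    ∃ Minf : Ω → ℝ,
      (∀ᵐ ω ∂P, Tendsto (fun n => Mgen n ω) atTop (𝓝 (Minf ω))) ∧
      (∀ᵐ ω ∂P, Tendsto (fun t => M t ω) atTop (𝓝 (Minf ω))) ∧
      (∀ t, M t =ᵐ[P] P[Minf | ℱ t]) ∧
      ∀ q : ℝ≥0∞, 1 < q → q ≠ ⊤ →
        MemLp Minf q P ∧ (∀ n, MemLp (Mgen n) q P) ∧ (∀ t, MemLp (M t) q P) ∧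
        Tendsto (fun n => eLpNorm (Mgen n - Minf) q P) atTop (𝓝 0) ∧
        Tendsto (fun t => eLpNorm (M t - Minf) q P) atTop (𝓝 0) := by
  intro ℱ M Mgen
  have hθ := Quadtree.expRate_pos
  have hfin_t : ∀ t : ℝ≥0, ∀ᵐ ω ∂P, {i | τ i ω ≤ t}.Finite := fun t =>
    hfin.mono fun _ hω => hω t
  have hM := fun t => hI.expBounded_M x (hfin_t t)
  have hMgen := hI.expBounded_Mgen x
  refine ⟨fun t ω => Quadtree.M_nonneg _ _ x t, hI.martingale_M x hfin_t,
    Quadtree.limitWeight p x, hI.ae_tendsto_Mgen x, hI.ae_tendsto_M x hfin,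
    fun t => hI.M_ae_eq_condExp x (hfin_t t), fun q hq hq' => ?_⟩
  have hq0 : q ≠ 0 := (zero_lt_one.trans hq).ne'
  exact ⟨(hI.expBounded_limitWeight x).memLp hθ hq0 hq', fun n => (hMgen n).memLp hθ hq0 hq',
    fun t => (hM t).memLp hθ hq0 hq',
    Quadtree.ExpBounded.tendsto_eLpNorm_sub hθ hMgen (hI.ae_tendsto_Mgen x) hq.le hq',
    Quadtree.ExpBounded.tendsto_eLpNorm_sub hθ hM (hI.ae_tendsto_M x hfin) hq.le hq'⟩

theorem proposition3 {Ω : Type*} [mΩ : MeasurableSpace Ω] (P : Measure Ω)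
    [IsProbabilityMeasure P]
    (N : Ω → Measure (ℝ × ℝ × ℝ))
    (hN : IsPoissonPointProcess N Quadtree.intensity P)
    (τ : ℕ → Ω → ℝ) (p : ℕ → Ω → ℝ × ℝ)
    (hτ : ∀ i, Measurable (τ i)) (hp : ∀ i, Measurable (p i))
    (hatoms : ∀ᵐ ω ∂P, N ω = Measure.sum (fun i => Measure.dirac (τ i ω, p i ω)))
    (hrank : ∀ᵐ ω ∂P, StrictMono (fun i => τ i ω)) :
    ∃ ℱ : Filtration ℝ≥0 mΩ, (∀ t, ℱ t = Quadtree.history τ p t) ∧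
      ∀ x ∈ Set.Icc (0 : ℝ) 1,
        let M : ℝ≥0 → Ω → ℝ := fun t ω => Quadtree.M (fun i => τ i ω) (fun i => p i ω) x t
        let Mgen : ℕ → Ω → ℝ := fun n ω => Quadtree.Mgen (fun i => p i ω) x n
        (∀ t ω, 0 ≤ M t ω) ∧
        Martingale M ℱ P ∧
        ∃ Minf : Ω → ℝ,
          (∀ᵐ ω ∂P, Tendsto (fun n => Mgen n ω) atTop (𝓝 (Minf ω))) ∧
          (∀ᵐ ω ∂P, Tendsto (fun t => M t ω) atTop (𝓝 (Minf ω))) ∧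
          (∀ t, M t =ᵐ[P] P[Minf | ℱ t]) ∧
          ∀ q : ℝ≥0∞, 1 < q → q ≠ ⊤ →
            MemLp Minf q P ∧ (∀ n, MemLp (Mgen n) q P) ∧ (∀ t, MemLp (M t) q P) ∧
            Tendsto (fun n => eLpNorm (Mgen n - Minf) q P) atTop (𝓝 0) ∧
            Tendsto (fun t => eLpNorm (M t - Minf) q P) atTop (𝓝 0) := by
  have hfin := Quadtree.ae_finite_atoms hN hatoms
  rw [Quadtree.intensity_eq_prod] at hN
  have hI := hN.isIndependentMarking hτ hp hatoms hrank
  exact ⟨Quadtree.quadFiltration hI.measurable_left hI.measurable_mark, fun _ => rfl,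
    fun x _ => proposition3_general P τ p hI hfin x⟩
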